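/- \textbf{Setting.} Let $\mathcal S,\mathcal A$ be finite sets, $\mu:\mathcal S\to\Delta(\mathcal A)$ a policy, $\gamma\in[0,1)$, $\beta\in(1/2,1)$, $R_{\max}>0$, $\vartheta_0\in\mathbb R^d$, and let $\Phi\in\mathbb R^{|\mathcal S|\times d}$, with rows $\phi(s)^\top$, have full column rank and Frobenius norm $\|\Phi\|_F=1$. There are $N\ge 1$ agents; agent $i\in[N]$ has a reward function $\mathcal R_i:\mathcal S\times\mathcal A\to[-R_{\max},R_{\max}]$ and a transition function $\mathcal P_i:\mathcal S\times\mathcal A\to\Delta(\mathcal S)$. Put $\mathcal P_i^\mu(s,s')=\sum_a\mu(a|s)\mathcal P_i(s'|s,a)$ and $\mathcal R_i^\mu(s)=\sum_a\mu(a|s)\mathcal R_i(s,a)$. Assume that every $\mathcal P_i^\mu$ is irreducible and aperiodic, with stationary distribution $d_i^\mu$, and that for some $0\le\varepsilon_p<1$, $\varepsilon_r\ge0$ and all $i,j,s,s'$, $$|\mathcal P_i^\mu(s,s')-\mathcal P_j^\mu(s,s')|\le\varepsilon_p\,\mathcal P_i^\mu(s,s'),\qquad \|\mathcal R_i-\mathcal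 R_j\|\le\varepsilon_r$$ (Euclidean norm). Let $D_i=\mathrm{diag}(d_i^\mu)$, $\Upsilon_i=\Phi^\top D_i(I-\gamma\mathcal P_i^\mu)\Phi$, $b_i=\Phi^\top D_i\mathcal R_i^\mu$, $\vartheta_i^*=\Upsilon_i^{-1}b_i$. With the spectral norm and $\kappa(X)=\|X\|\|X^{-1}\|$, let $$C_d(\varepsilon_p)=\Big(\tfrac{1+\varepsilon_p}{1-\varepsilon_p}\Big)^{|\mathcal S|}-1,\quad \Upsilon(\varepsilon_p)=\varepsilon_p\sqrt{|\mathcal S|}+C_d(\varepsilon_p)\big(1+\sqrt{|\mathcal S|}\big),\quad b(\varepsilon_p,\varepsilon_r)=\sqrt{|\mathcal S|}\,\big(\varepsilon_r+C_d(\varepsilon_p)R_{\max}\big),$$ $$\hat H(\varepsilon_p,\varepsilon_r)=\max_{i\in[N]}\frac{2\kappa^2(\Upsilon_i)\,\|\Upsilon_i\|^2\,\|\vartheta_i^*\|^2}{[\|\Upsilon_i\|-\kappa(\Upsilon_i)\Upsilon(\varepsilon_p)]^2}\Big[\frac{\Upsilon^2(\varepsilon_p)}{\|\Upsilon_i\|^2}+\frac{b^2(\varepsilon_p,\varepsilon_r)}{\|b_i\|^2}\Big].$$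 \textbf{Algorithm} (federated discounted TD(0) with Polyak--Ruppert averaging). The initial states $(s_0^i)_{i\in[N]}$ have an arbitrary joint law; then the agents, independently of each other, follow $a_t^i\sim\mu(\cdot|s_t^i)$, $s_{t+1}^i\sim\mathcal P_i(\cdot|s_t^i,a_t^i)$. With $\beta_t=(t+1)^{-\beta}$ and $\bar\vartheta_0=\vartheta_0$, $$\delta_{t+1}^i=\mathcal R_i(s_t^i,a_t^i)\phi(s_t^i)+\phi(s_t^i)\big(\gamma\phi(s_{t+1}^i)-\phi(s_t^i)\big)^{\!\top}\vartheta_t,\quad \vartheta_{t+1}=\vartheta_t+\frac{\beta_t}{N}\sum_{i\in[N]}\delta_{t+1}^i,\quad \bar\vartheta_{t+1}=\bar\vartheta_t+\frac{1}{t+1}(\vartheta_t-\bar\vartheta_t).$$ \textbf{Theorem.} Assume in addition that $\hat H(\varepsilon_p,\varepsilon_r)$ is meaningful: $b_i\ne0$ and $\kappa(\Upsilon_i)\Upsilon(\varepsilon_p)<\|\Upsilon_i\|$ for all $i$. Then there are constants $C,C'$ that depend only on $\mathcal S,\mathcal A,\mu,\Phi,\gamma,\beta,R_{\max},\vartheta_0$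 and the transition matrix $\mathcal P_{i_0}^\mu$ of one agent $i_0$ (in particular not on $N$, $T$, $i$, $\varepsilon_p$, $\varepsilon_r$, the initial law), and constants $K_N,T_N$ that depend only on the same data and on $N$, such that for every agent $i$: $$\mathbb E\|\bar\vartheta_T-\vartheta_i^*\|^2\le\frac{C}{N(T+1)}+\frac{C'\ln^2T}{(T+1)^{2\beta}}+\hat H(\varepsilon_p,\varepsilon_r)\quad\text{for all }T\ge2;$$ $$\mathbb E\|\bar\vartheta_T-\vartheta_i^*\|^2\le\frac{C}{N(T+1)}+\hat H(\varepsilon_p,\varepsilon_r)\quad\text{for all }T\ge T_N;$$ $$\mathbb E\|\bar\vartheta_T-\vartheta_i^*\|^2\le\frac{K_N}{N(T+1)}+\hat H(\varepsilon_p,\varepsilon_r)\quad\text{for all }T\ge0.$$ Moreover, $\hat H(\varepsilon_p,\varepsilon_r)\to0$ as $\max\{\varepsilon_p,\varepsilon_r\}\to0$, both for fixed agents, as a function of $(\varepsilon_p,\varepsilon_r)$, and uniformly: for every $\eta>0$ there is $\delta>0$, depending only on $\eta$ and the data that $C$ depends on, such that whenever the agents satisfy the assumptions of the setting with $\varepsilon_p,\varepsilon_r\le\delta$,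 for any $N$, then $\kappa(\Upsilon_i)\Upsilon(\varepsilon_p)<\|\Upsilon_i\|$ for all $i$ and $\hat H(\varepsilon_p,\varepsilon_r)\le\eta$. -/

import Mathlib

open MeasureTheory Filter Topology
open scoped Matrix Matrix.Norms.L2Operator

namespace FedTD

/-- Aperiodicity of a transition matrix: at every state the greatest common divisor of the possible
return times is `1`. -/
def IsAperiodic {S : Type*} [Fintype S] [DecidableEq S] (P : Matrix S S ℝ) : Prop :=
  ∀ s : S, ∀ g : ℕ, (∀ n : ℕ, 0 < n → 0 < (P ^ n) s s → g ∣ n) → g = 1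

/-- `q` is a stationary probability distribution of the transition matrix `P`. -/
def IsStationary {S : Type*} [Fintype S] (P : Matrix S S ℝ) (q : S → ℝ) : Prop :=
  q ∈ stdSimplex ℝ S ∧ q ᵥ* P = q

/-- The stationary distribution of `P` (it exists and is unique for the irreducible chains
considered below). -/
noncomputable def stationaryDist {S : Type*} [Fintype S] (P : Matrix S S ℝ) : S → ℝ :=
  Classical.epsilon (IsStationary P)

/-- `N` Markov decision processes on a common finite state space `S` and a common finite action
space `A`: agent `i` has the transition function `P i : S → A → Δ(S)` and the reward function
`R i : S → A → ℝ`. -/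
structure MDPs (S A : Type*) [Fintype S] (N : ℕ) where
  P : Fin N → S → A → stdSimplex ℝ S
  R : Fin N → S → A → ℝ

section Model

variable {S A : Type*} [Fintype S] [DecidableEq S] [Fintype A] {N d : ℕ}

/-- Transition matrix of the chain that the policy `μ` induces in the MDP of agent `i`. -/
noncomputable def MDPs.Pμ (M : MDPs S A N) (μ : S → stdSimplex ℝ A) (i : Fin N) : Matrix S S ℝ :=
  Matrix.of fun s s' => ∑ a, μ s a * M.P i s a s'

/-- Expected one-step reward of agent `i` under the policy `μ`. -/
noncomputable def MDPs.Rμ (M : MDPs S A N) (μ : S → stdSimplex ℝ A) (i : Fin N) : S → ℝ :=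
  fun s => ∑ a, μ s a * M.R i s a

/-- Ergodicity: every induced chain is irreducible and aperiodic. -/
def MDPs.Ergodic (M : MDPs S A N) (μ : S → stdSimplex ℝ A) : Prop :=
  ∀ i, (M.Pμ μ i).IsIrreducible ∧ IsAperiodic (M.Pμ μ i)

/-- Heterogeneity bound; the norm of a difference of reward functions is the Euclidean one. -/
def MDPs.HeterogeneityBound (M : MDPs S A N) (μ : S → stdSimplex ℝ A) (εp εr : ℝ) : Prop :=
  ∀ i j, (∀ s s', |M.Pμ μ i s s' - M.Pμ μ j s s'| ≤ εp * M.Pμ μ i s s') ∧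
    Real.sqrt (∑ s, ∑ a, (M.R i s a - M.R j s a) ^ 2) ≤ εr

/-- Bounded rewards. -/
def MDPs.RewardBound (M : MDPs S A N) (Rmax : ℝ) : Prop :=
  ∀ i s a, |M.R i s a| ≤ Rmax

/-- Conditions on the feature matrix: full column rank and Frobenius norm one. -/
def FeatureCondition (Φ : Matrix S (Fin d) ℝ) : Prop :=
  Φ.rank = d ∧ Real.sqrt (∑ s, ∑ k, Φ s k ^ 2) = 1

/-- The feature vector of the state `s`, the row `s` of the feature matrix. -/
noncomputable def feature (Φ : Matrix S (Fin d) ℝ) (s : S) : EuclideanSpace ℝ (Fin d) :=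
  WithLp.toLp 2 (Φ s)

/-- `Υ_i = Φᵀ D_i (I - γ P_i) Φ`. -/
noncomputable def MDPs.Ups (M : MDPs S A N) (μ : S → stdSimplex ℝ A) (Φ : Matrix S (Fin d) ℝ)
    (γ : ℝ) (i : Fin N) : Matrix (Fin d) (Fin d) ℝ :=
  Φᵀ * Matrix.diagonal (stationaryDist (M.Pμ μ i)) * (1 - γ • M.Pμ μ i) * Φ

/-- `b_i = Φᵀ D_i R_i`. -/
noncomputable def MDPs.b (M : MDPs S A N) (μ : S → stdSimplex ℝ A) (Φ : Matrix S (Fin d) ℝ)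
    (i : Fin N) : EuclideanSpace ℝ (Fin d) :=
  WithLp.toLp 2 (Φᵀ *ᵥ (Matrix.diagonal (stationaryDist (M.Pμ μ i)) *ᵥ M.Rμ μ i))

/-- The local solution `ϑ_i^* = Υ_i⁻¹ b_i` of agent `i`. -/
noncomputable def MDPs.localSol (M : MDPs S A N) (μ : S → stdSimplex ℝ A)
    (Φ : Matrix S (Fin d) ℝ) (γ : ℝ) (i : Fin N) : EuclideanSpace ℝ (Fin d) :=
  WithLp.toLp 2 ((M.Ups μ Φ γ i)⁻¹ *ᵥ (M.b μ Φ i).ofLp)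

/-- Condition number with respect to the spectral norm. -/
noncomputable def condNumber (X : Matrix (Fin d) (Fin d) ℝ) : ℝ := ‖X‖ * ‖X⁻¹‖

/-- `C_d(ε_p) = ((1 + ε_p) / (1 - ε_p)) ^ n - 1`, where `n` is the number of states. -/
noncomputable def Cd (n : ℕ) (εp : ℝ) : ℝ := ((1 + εp) / (1 - εp)) ^ n - 1

/-- `Υ(ε_p) = ε_p √n + C_d(ε_p) (1 + √n)`. -/
noncomputable def UpsGap (n : ℕ) (εp : ℝ) : ℝ :=
  εp * Real.sqrt n + Cd n εp * (1 + Real.sqrt n)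

/-- `b(ε_p, ε_r) = √n (ε_r + C_d(ε_p) R_max)`. -/
noncomputable def bGap (n : ℕ) (Rmax εp εr : ℝ) : ℝ :=
  Real.sqrt n * (εr + Cd n εp * Rmax)

/-- The heterogeneity gap `Ĥ(ε_p, ε_r)`, a maximum over the agents. -/
noncomputable def MDPs.hetGap (M : MDPs S A N) (μ : S → stdSimplex ℝ A)
    (Φ : Matrix S (Fin d) ℝ) (γ Rmax εp εr : ℝ) : ℝ :=
  ⨆ i : Fin N,
    2 * condNumber (M.Ups μ Φ γ i) ^ 2 * ‖M.Ups μ Φ γ i‖ ^ 2 * ‖M.localSol μ Φ γ i‖ ^ 2 /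
        (‖M.Ups μ Φ γ i‖ - condNumber (M.Ups μ Φ γ i) * UpsGap (Fintype.card S) εp) ^ 2 *
      (UpsGap (Fintype.card S) εp ^ 2 / ‖M.Ups μ Φ γ i‖ ^ 2 +
        bGap (Fintype.card S) Rmax εp εr ^ 2 / ‖M.b μ Φ i‖ ^ 2)

/-- The perturbation that the heterogeneity level `ε_p` allows is small relative to the
conditioning of each `Υ_i`: the denominators in `hetGap` come from positive numbers. -/
def MDPs.SmallPerturbation (M : MDPs S A N) (μ : S → stdSimplex ℝ A)
    (Φ : Matrix S (Fin d) ℝ) (γ εp : ℝ) : Prop :=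
  ∀ i, condNumber (M.Ups μ Φ γ i) * UpsGap (Fintype.card S) εp < ‖M.Ups μ Φ γ i‖

/-- Local TD error of an agent with reward function `R` that takes the action `a` in the state `s`
and observes the next state `s'`, for the current global parameter `v`. -/
noncomputable def tdError (Φ : Matrix S (Fin d) ℝ) (γ : ℝ) (R : S → A → ℝ) (s : S) (a : A)
    (s' : S) (v : EuclideanSpace ℝ (Fin d)) : EuclideanSpace ℝ (Fin d) :=
  R s a • feature Φ s +
    (γ * inner ℝ (feature Φ s') v - inner ℝ (feature Φ s) v) • feature Φ s

/-- Global parameters `ϑ_t` of the algorithm with step sizes `1 / (t + 1) ^ β`, along the state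
trajectories `s t i` and the action trajectories `a t i` of the agents `i`. -/
noncomputable def iterate (M : MDPs S A N) (Φ : Matrix S (Fin d) ℝ) (γ β : ℝ)
    (v₀ : EuclideanSpace ℝ (Fin d)) (s : ℕ → Fin N → S) (a : ℕ → Fin N → A) :
    ℕ → EuclideanSpace ℝ (Fin d)
  | 0 => v₀
  | t + 1 => iterate M Φ γ β v₀ s a t + ((1 / ((t : ℝ) + 1) ^ β) / (N : ℝ)) •
      ∑ i, tdError Φ γ (M.R i) (s t i) (a t i) (s (t + 1) i) (iterate M Φ γ β v₀ s a t)

/-- The Polyak-Ruppert averages of the global parameters. -/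
noncomputable def average (M : MDPs S A N) (Φ : Matrix S (Fin d) ℝ) (γ β : ℝ)
    (v₀ : EuclideanSpace ℝ (Fin d)) (s : ℕ → Fin N → S) (a : ℕ → Fin N → A) :
    ℕ → EuclideanSpace ℝ (Fin d)
  | 0 => v₀
  | t + 1 => average M Φ γ β v₀ s a t +
      (1 / ((t : ℝ) + 1)) • (iterate M Φ γ β v₀ s a t - average M Φ γ β v₀ s a t)

/-- The Markovian sampling model: the initial states of the agents have the (arbitrary) joint law
`ν`, and then every agent `i`, independently of the others, repeatedly draws an action from `μ` and
a next state from `P i`. The condition prescribes the finite-dimensional laws. -/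
structure IsMarkovSample {Ω : Type*} [MeasurableSpace Ω] (ℙ : Measure Ω) (M : MDPs S A N)
    (μ : S → stdSimplex ℝ A) (ν : stdSimplex ℝ (Fin N → S))
    (s : ℕ → Fin N → Ω → S) (a : ℕ → Fin N → Ω → A) : Prop where
  measurable_state : ∀ t i x, MeasurableSet {ω | s t i ω = x}
  measurable_action : ∀ t i u, MeasurableSet {ω | a t i ω = u}
  law : ∀ (T : ℕ) (x : ℕ → Fin N → S) (u : ℕ → Fin N → A),
    ℙ.real {ω | (∀ t ≤ T, ∀ i, s t i ω = x t i) ∧ (∀ t < T, ∀ i, a t i ω = u t i)} =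
      ν (x 0) * ∏ t ∈ Finset.range T, ∏ i,
        (μ (x t i) (u t i) * M.P i (x t i) (u t i) (x (t + 1) i))

/-- The mean square error `E ‖ϑ̄_T - ϑ_i^*‖²` of the averaged iterate with respect to agent `i`. -/
noncomputable def mse {Ω : Type*} [MeasurableSpace Ω] (ℙ : Measure Ω) (M : MDPs S A N)
    (μ : S → stdSimplex ℝ A) (Φ : Matrix S (Fin d) ℝ) (γ β : ℝ)
    (v₀ : EuclideanSpace ℝ (Fin d)) (s : ℕ → Fin N → Ω → S) (a : ℕ → Fin N → Ω → A)
    (i : Fin N) (T : ℕ) : ℝ :=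
  ∫ ω, ‖average M Φ γ β v₀ (fun t j => s t j ω) (fun t j => a t j ω) T - M.localSol μ Φ γ i‖ ^ 2
    ∂ℙ

end Model

end FedTD

/-! Let `w` solve the averaged equation `∑ b_i = ∑ Υ_i w`. The error of the averaged iterate splits
into a fluctuation around `w` and the deterministic distance from `w` to the local solution of agent
`i`.

Fluctuation. With `b_t` the step size, the centered iterate obeys `z ↦ z + b_t (e - A z)`, driven by
the joint chain of all agents, with mean field `-U z`, where `U` is the average of the coercive
`Υ_i`. The Poisson equation turns the Markov noise into martingale differences plus a corrector that
telescopes. It is solved agent by agent, so the corrector of the joint chain is an average of `N`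
functions of one coordinate each. Given the present state the agents move independently, hence the
martingale increments have variance `O(1/N)` (`MDPs.isLinearSA`). The initial law may correlate the
agents, but off-diagonal covariances of functions with stationary mean zero decay at least like
`1/(t+1)²`, which is at most `b_t`; so averages of the noise over the agents have second moment
`O(1/N + b_t)` (`MDPs.ex_norm_sq_average_le`). A Lyapunov function corrected by the Poisson solution
then gives `E‖z_t‖² = O(b_t (1/N + b_t))` (`exists_secondMoment_bound`). Summation by parts writes
`U ∑ z_t` as a martingale plus boundary and remainder terms, and `E‖∑_{t<T} z_t‖² = O(T/N +
T^(2-2β))` (`exists_averaging_bound`). Division by `T²` yields `1/(NT) + T^(-2β)`, even without the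
logarithm.

Heterogeneity. `Υ_i w - b_i` is the average over `j` of `(Υ_i - Υ_j) w + (b_j - b_i)`. Stationary
distributions are multiplicatively Lipschitz in the transition matrix (`stationary_ratio`), which
bounds both differences, and a perturbation argument for linear systems follows. Separating the two
parts of the error by Young's inequality costs a factor `1 + c'` on the heterogeneity, whereas the
gap must appear with coefficient one. The discount pays for it: `γ < 1` improves the bound on `Υ_i -
Υ_j` to `ρ` times the nominal gap with `ρ < 1`, and Cauchy-Schwarz with `1 + ρ²` in place of `2`
leaves exactly `1 + c' = 2/(1 + ρ²)` (`perturbation_sq_le`).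

Uniform constants. Meaningfulness of the gap forces `εp < 1/3`
(`MDPs.SmallPerturbation.lt_one_third`), so every chain dominates `2/3` of the reference matrix `Q`.
A single minorization, hence one mixing rate and one coercivity constant, then serves all agents and
all `N` (`exists_uniform_constants`). -/

namespace FedTD

/-! ### Finite Markov chains: stationary distributions, their perturbation, minorization. -/

section MarkovChain

variable {S : Type*} [Fintype S] {P P' : Matrix S S ℝ} {q q' : S → ℝ}

theorem IsStationary.nonneg (h : IsStationary P q) (s : S) : 0 ≤ q s := h.1.1 s

theorem IsStationary.sum_eq_one (h : IsStationary P q) : ∑ s, q s = 1 := h.1.2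

theorem IsStationary.le_one (h : IsStationary P q) (s : S) : q s ≤ 1 := by
  rw [← h.sum_eq_one]
  exact Finset.single_le_sum (fun u _ => h.nonneg u) (Finset.mem_univ s)

theorem IsStationary.sum_mul (h : IsStationary P q) (s : S) : ∑ u, q u * P u s = q s := by
  have := congrFun h.2 s
  simpa [Matrix.vecMul, dotProduct] using this

variable [DecidableEq S]

theorem IsStationary.pow (h : IsStationary P q) (k : ℕ) : IsStationary (P ^ k) q := by
  refine ⟨h.1, ?_⟩
  induction k with
  | zero => simp
  | succ k ih => rw [pow_succ, ← Matrix.vecMul_vecMul, ih, h.2]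

theorem exists_isStationary [Nonempty S] (hP : P ∈ Matrix.rowStochastic ℝ S) :
    ∃ q, IsStationary P q := by
  rw [Matrix.mem_rowStochastic_iff_sum] at hP
  obtain ⟨hP0, hP1⟩ := hP
  have hdet : (1 - P).det = 0 := by
    rw [← Matrix.exists_mulVec_eq_zero_iff]
    refine ⟨1, one_ne_zero, ?_⟩
    funext s
    simp [Matrix.mulVec, dotProduct, hP1, Matrix.one_apply]
  obtain ⟨v, hv0, hv⟩ := Matrix.exists_vecMul_eq_zero_iff.mpr hdet
  have hvP : ∀ s, ∑ u, v u * P u s = v s := by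
    intro s
    have := congrFun hv s
    simp only [Matrix.vecMul_sub, Matrix.vecMul_one, Pi.sub_apply, Pi.zero_apply] at this
    simp only [Matrix.vecMul, dotProduct] at this
    linarith
  have habs : ∀ s, |v s| ≤ ∑ u, |v u| * P u s := by
    intro s
    rw [← hvP s]
    refine (Finset.abs_sum_le_sum_abs _ _).trans (Finset.sum_le_sum fun u _ => ?_)
    rw [abs_mul, abs_of_nonneg (hP0 u s)]
  have hsum : ∑ s, |v s| = ∑ s, ∑ u, |v u| * P u s := by
    rw [Finset.sum_comm]
    refine Finset.sum_congr rfl fun u _ => ?_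
    rw [← Finset.mul_sum, hP1, mul_one]
  have heq : ∀ s, |v s| = ∑ u, |v u| * P u s := fun s =>
    (Finset.sum_eq_sum_iff_of_le fun s _ => habs s).mp hsum s (Finset.mem_univ s)
  have hpos : 0 < ∑ s, |v s| := by
    obtain ⟨s, hs⟩ := Function.ne_iff.mp hv0
    exact Finset.sum_pos' (fun _ _ => abs_nonneg _) ⟨s, Finset.mem_univ s, abs_pos.mpr hs⟩
  refine ⟨fun s => |v s| / ∑ u, |v u|, ⟨fun s => by positivity, ?_⟩, ?_⟩
  · rw [← Finset.sum_div, div_self hpos.ne']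
  · funext s
    simp only [Matrix.vecMul, dotProduct]
    rw [heq s, Finset.sum_div]
    exact Finset.sum_congr rfl fun u _ => by ring

theorem isStationary_stationaryDist [Nonempty S] (hP : P ∈ Matrix.rowStochastic ℝ S) :
    IsStationary P (stationaryDist P) :=
  Classical.epsilon_spec (exists_isStationary hP)

theorem IsStationary.pos (h : IsStationary P q) (hirr : P.IsIrreducible) (s : S) : 0 < q s := by
  obtain ⟨u, hu⟩ : ∃ u, 0 < q u := by
    by_contra! hcon
    have : ∑ s, q s ≤ 0 := Finset.sum_nonpos fun s _ => hcon s
    rw [h.sum_eq_one] at this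
    linarith
  obtain ⟨k, -, hk⟩ := (Matrix.isIrreducible_iff_exists_pow_pos hirr.nonneg).mp hirr u s
  rw [← (h.pow k).sum_mul s]
  have hnn : ∀ i j, 0 ≤ (P ^ k) i j := Matrix.pow_apply_nonneg hirr.nonneg k
  exact Finset.sum_pos' (fun v _ => mul_nonneg (h.nonneg v) (hnn v s))
    ⟨u, Finset.mem_univ u, mul_pos hu hk⟩

/-- In an irreducible chain a set of states that cannot be left is everything or empty. -/
theorem eq_univ_of_closed (hirr : P.IsIrreducible) (U : Finset S) (hU : U.Nonempty)
    (hcl : ∀ u ∈ U, ∀ v ∉ U, P u v = 0) (r : S) : r ∈ U := by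
  by_contra hr
  obtain ⟨u, hu⟩ := hU
  have key : ∀ k : ℕ, ∀ v ∉ U, (P ^ k) u v = 0 := by
    intro k
    induction k with
    | zero =>
      intro v hv
      rw [pow_zero, Matrix.one_apply_ne]
      rintro rfl
      exact hv hu
    | succ k ih =>
      intro v hv
      rw [pow_succ, Matrix.mul_apply]
      refine Finset.sum_eq_zero fun w _ => ?_
      by_cases hw : w ∈ U
      · rw [hcl w hw v hv, mul_zero]
      · rw [ih w hw, zero_mul]
  obtain ⟨k, -, hk⟩ := (Matrix.isIrreducible_iff_exists_pow_pos hirr.nonneg).mp hirr u r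
  exact hk.ne' (key k r hr)

/-- The signed measure `z = a q'(r) q - q(r) q'` is nonnegative at `r`, and since the two chains
agree off `r`, it is excessive for `P` killed at `r`. By irreducibility such a `z` cannot be
negative anywhere. -/
theorem stationary_one_row_aux (hP : P ∈ Matrix.rowStochastic ℝ S) (hirr : P.IsIrreducible)
    (hq : IsStationary P q) (hq' : IsStationary P' q') (r : S)
    (hoff : ∀ u, u ≠ r → P' u = P u) {a : ℝ} (ha : 1 ≤ a) (hr : ∀ s, P' r s ≤ a * P r s) (s : S) :
    q r * q' s ≤ a * q' r * q s := by
  rw [Matrix.mem_rowStochastic_iff_sum] at hP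
  obtain ⟨hP0, hP1⟩ := hP
  set z : S → ℝ := fun s => a * q' r * q s - q r * q' s with hz
  have hzr : 0 ≤ z r := by
    have := mul_nonneg (hq'.nonneg r) (hq.nonneg r)
    simp only [hz]
    nlinarith
  have hzP : ∀ s, ∑ u ∈ Finset.univ.erase r, z u * P u s ≤ z s := by
    intro s
    have e1 : z s = ∑ u, (a * q' r * (q u * P u s) - q r * (q' u * P' u s)) := by
      rw [Finset.sum_sub_distrib, ← Finset.mul_sum, ← Finset.mul_sum, hq.sum_mul, hq'.sum_mul]
    rw [e1, ← Finset.add_sum_erase _ _ (Finset.mem_univ r)]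
    have e2 : ∑ u ∈ Finset.univ.erase r, (a * q' r * (q u * P u s) - q r * (q' u * P' u s)) =
        ∑ u ∈ Finset.univ.erase r, z u * P u s := by
      refine Finset.sum_congr rfl fun u hu => ?_
      rw [hoff u (Finset.ne_of_mem_erase hu)]
      simp only [hz]
      ring
    rw [e2]
    have := mul_nonneg (mul_nonneg (hq'.nonneg r) (hq.nonneg r)) (sub_nonneg.mpr (hr s))
    nlinarith
  suffices hs : 0 ≤ z s by
    simp only [hz] at hs
    linarith
  by_contra! hneg
  set U : Finset S := Finset.univ.filter fun s => z s < 0 with hU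
  have hrU : r ∉ U := by simp [hU, hzr]
  -- Summing the excessivity of `z` over the negative set `U` bounds `∑ z u * P(u, U)` by `∑ z u`,
  -- while `P(u, U) ≤ 1` and `z < 0` give the opposite inequality. Hence `P(u, U) = 1` on `U`: a
  -- closed set that misses `r`.
  have hcl : ∀ u ∈ U, ∀ v ∉ U, P u v = 0 := by
    have h1 : ∑ s ∈ U, ∑ u ∈ Finset.univ.erase r, z u * P u s ≤ ∑ s ∈ U, z s :=
      Finset.sum_le_sum fun s _ => hzP s
    rw [Finset.sum_comm] at h1
    have h2 : ∑ u ∈ U, z u * ∑ s ∈ U, P u s ≤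
        ∑ u ∈ Finset.univ.erase r, ∑ s ∈ U, z u * P u s := by
      simp_rw [← Finset.mul_sum]
      refine Finset.sum_le_sum_of_subset_of_nonneg ?_ ?_
      · intro u hu
        simp only [Finset.mem_erase, Finset.mem_univ, and_true]
        rintro rfl
        exact hrU hu
      · intro u _ hu
        have : 0 ≤ z u := by simpa [hU] using hu
        exact mul_nonneg this (Finset.sum_nonneg fun s _ => hP0 u s)
    have h3 : ∀ u ∈ U, z u ≤ z u * ∑ s ∈ U, P u s := by
      intro u hu
      have hu' : z u < 0 := by simpa [hU] using hu
      have : ∑ s ∈ U, P u s ≤ 1 := by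
        rw [← hP1 u]
        exact Finset.sum_le_sum_of_subset_of_nonneg (Finset.subset_univ _) fun s _ _ => hP0 u s
      nlinarith
    have h4 : ∑ u ∈ U, z u = ∑ u ∈ U, z u * ∑ s ∈ U, P u s :=
      le_antisymm (Finset.sum_le_sum h3) (h2.trans h1)
    intro u hu v hv
    have h5 := (Finset.sum_eq_sum_iff_of_le h3).mp h4 u hu
    have hu' : z u < 0 := by simpa [hU] using hu
    have h6 : ∑ s ∈ U, P u s = 1 := by
      have : z u * (∑ s ∈ U, P u s - 1) = 0 := by linarith
      rcases mul_eq_zero.mp this with h | h <;> linarith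
    have h7 : ∑ s ∈ insert v U, P u s ≤ 1 := by
      rw [← hP1 u]
      exact Finset.sum_le_sum_of_subset_of_nonneg (Finset.subset_univ _) fun s _ _ => hP0 u s
    rw [Finset.sum_insert hv, h6] at h7
    linarith [hP0 u v]
  exact hrU (eq_univ_of_closed hirr U ⟨s, by simpa [hU] using hneg⟩ hcl r)

/-- Stationary distributions of two chains that differ in one row only. -/
theorem stationary_one_row (hP : P ∈ Matrix.rowStochastic ℝ S) (hirr : P.IsIrreducible)
    (hP' : P' ∈ Matrix.rowStochastic ℝ S) (hirr' : P'.IsIrreducible)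
    (hq : IsStationary P q) (hq' : IsStationary P' q') (r : S)
    (hoff : ∀ u, u ≠ r → P' u = P u) {ε : ℝ} (hε₀ : 0 ≤ ε) (hε₁ : ε < 1)
    (hle : ∀ s, P' r s ≤ (1 + ε) * P r s) (hge : ∀ s, (1 - ε) * P r s ≤ P' r s) (s : S) :
    q' s ≤ (1 + ε) / (1 - ε) * q s ∧ q s ≤ (1 + ε) / (1 - ε) * q' s := by
  have hε : 0 < 1 - ε := by linarith
  have ha' : 1 ≤ 1 / (1 - ε) := by rw [le_div_iff₀ hε]; linarith
  have hr' : ∀ s, P r s ≤ 1 / (1 - ε) * P' r s := by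
    intro s
    rw [one_div, ← div_eq_inv_mul, le_div_iff₀ hε]
    linarith [hge s]
  have h1 := stationary_one_row_aux hP hirr hq hq' r hoff (a := 1 + ε) (by linarith) hle
  have h2 := stationary_one_row_aux hP' hirr' hq' hq r (fun u hu => (hoff u hu).symm) ha' hr'
  -- Summed over `s`, the comparisons relate the masses at `r` alone; this removes the prefactors
  -- and produces the ratio `(1 + ε) / (1 - ε)`.
  have k1 : q r ≤ (1 + ε) * q' r := by
    have := Finset.sum_le_sum fun s (_ : s ∈ Finset.univ) => h1 s
    rwa [← Finset.mul_sum, ← Finset.mul_sum, hq.sum_eq_one, hq'.sum_eq_one, mul_one, mul_one]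
      at this
  have k2 : q' r ≤ 1 / (1 - ε) * q r := by
    have := Finset.sum_le_sum fun s (_ : s ∈ Finset.univ) => h2 s
    rwa [← Finset.mul_sum, ← Finset.mul_sum, hq.sum_eq_one, hq'.sum_eq_one, mul_one, mul_one]
      at this
  have hqr := hq.pos hirr r
  have hqr' := hq'.pos hirr' r
  constructor
  · have : q r * q' s ≤ q r * ((1 + ε) / (1 - ε) * q s) := by
      calc q r * q' s ≤ (1 + ε) * q' r * q s := h1 s
        _ ≤ (1 + ε) * (1 / (1 - ε) * q r) * q s := by
          have := hq.nonneg s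
          gcongr
        _ = _ := by ring
    exact le_of_mul_le_mul_left this hqr
  · have : q' r * q s ≤ q' r * ((1 + ε) / (1 - ε) * q' s) := by
      calc q' r * q s ≤ 1 / (1 - ε) * q r * q' s := h2 s
        _ ≤ 1 / (1 - ε) * ((1 + ε) * q' r) * q' s := by
          have := hq'.nonneg s
          gcongr
        _ = _ := by ring
    exact le_of_mul_le_mul_left this hqr'

theorem isIrreducible_of_pos_imp (hirr : P.IsIrreducible) (hP' : ∀ i j, 0 ≤ P' i j)
    (h : ∀ i j, 0 < P i j → 0 < P' i j) : P'.IsIrreducible := by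
  rw [Matrix.isIrreducible_iff_exists_pow_pos hP']
  intro i j
  obtain ⟨k, hk, hkp⟩ := (Matrix.isIrreducible_iff_exists_pow_pos hirr.nonneg).mp hirr i j
  refine ⟨k, hk, ?_⟩
  have key : ∀ k : ℕ, ∀ i j, 0 < (P ^ k) i j → 0 < (P' ^ k) i j := by
    intro k
    induction k with
    | zero => intro i j; simp
    | succ k ih =>
      intro i j hij
      rw [pow_succ, Matrix.mul_apply] at hij ⊢
      obtain ⟨w, hw⟩ : ∃ w, 0 < (P ^ k) i w * P w j := by
        by_contra! hcon
        exact hij.not_ge (Finset.sum_nonpos fun w _ => hcon w)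
      have hPk := Matrix.pow_apply_nonneg hirr.nonneg k i w
      have hPwj := hirr.nonneg w j
      have h1 : 0 < (P ^ k) i w := lt_of_le_of_ne hPk fun h0 => by simp [← h0] at hw
      have h2 : 0 < P w j := lt_of_le_of_ne hPwj fun h0 => by simp [← h0] at hw
      exact Finset.sum_pos' (fun v _ => mul_nonneg (Matrix.pow_apply_nonneg hP' k i v) (hP' v j))
        ⟨w, Finset.mem_univ w, mul_pos (ih i w h1) (h w j h2)⟩
  exact key k i j hkp

/-- The stationary distribution depends on the transition matrix in a multiplicatively Lipschitz
way. -/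
theorem stationary_ratio (hP : P ∈ Matrix.rowStochastic ℝ S) (hirr : P.IsIrreducible)
    (hP' : P' ∈ Matrix.rowStochastic ℝ S)
    (hq : IsStationary P q) (hq' : IsStationary P' q') {ε : ℝ} (hε₀ : 0 ≤ ε) (hε₁ : ε < 1)
    (h : ∀ s s', |P s s' - P' s s'| ≤ ε * P s s') (s : S) :
    q' s ≤ ((1 + ε) / (1 - ε)) ^ Fintype.card S * q s ∧
      q s ≤ ((1 + ε) / (1 - ε)) ^ Fintype.card S * q' s := by
  have hε : 0 < 1 - ε := by linarith
  have : Nonempty S := ⟨s⟩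
  have hle : ∀ s s', P' s s' ≤ (1 + ε) * P s s' := fun s s' => by
    linarith [(abs_le.mp (h s s')).1]
  have hge : ∀ s s', (1 - ε) * P s s' ≤ P' s s' := fun s s' => by
    linarith [(abs_le.mp (h s s')).2]
  rw [Matrix.mem_rowStochastic_iff_sum] at hP hP'
  -- Replace the rows one at a time. Each replacement costs one factor `(1 + ε) / (1 - ε)`, and all
  -- intermediate chains stay irreducible because `P'` dominates `(1 - ε) P`.
  set mix : Finset S → Matrix S S ℝ := fun F => Matrix.of fun s s' =>
    if s ∈ F then P' s s' else P s s' with hmix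
  have hmixS : ∀ F, mix F ∈ Matrix.rowStochastic ℝ S := by
    intro F
    rw [Matrix.mem_rowStochastic_iff_sum]
    refine ⟨fun i j => ?_, fun i => ?_⟩
    · simp only [hmix, Matrix.of_apply]
      split_ifs
      · exact hP'.1 i j
      · exact hP.1 i j
    · by_cases hi : i ∈ F
      · simp [hmix, hi, hP'.2]
      · simp [hmix, hi, hP.2]
  have hmixI : ∀ F, (mix F).IsIrreducible := by
    intro F
    refine isIrreducible_of_pos_imp hirr (fun i j => (Matrix.mem_rowStochastic.mp (hmixS F)).1 i j)
      fun i j hij => ?_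
    simp only [hmix, Matrix.of_apply]
    split_ifs
    · exact lt_of_lt_of_le (mul_pos hε hij) (hge i j)
    · exact hij
  have key : ∀ F : Finset S, ∀ p, IsStationary (mix F) p → ∀ s,
      p s ≤ ((1 + ε) / (1 - ε)) ^ F.card * q s ∧ q s ≤ ((1 + ε) / (1 - ε)) ^ F.card * p s := by
    intro F
    induction F using Finset.induction_on with
    | empty =>
      intro p hp s
      have e : mix ∅ = P := by ext; simp [hmix]
      have := stationary_one_row (hmixS ∅) (hmixI ∅) (hmixS ∅) (hmixI ∅) (e ▸ hq) hp s
        (fun _ _ => rfl) le_rfl zero_lt_one (fun s => by simp) (fun s => by simp) s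
      simpa using this
    | insert r F hr ih =>
      intro p hp s
      obtain ⟨p₀, hp₀⟩ := exists_isStationary (hmixS F)
      have h1 := ih p₀ hp₀ s
      have h2 := stationary_one_row (hmixS F) (hmixI F) (hmixS _) (hmixI _) hp₀ hp r
        (fun u hu => by
          funext s'
          simp [hmix, hu]) hε₀ hε₁
        (fun s' => by simpa [hmix, hr] using hle r s')
        (fun s' => by simpa [hmix, hr] using hge r s') s
      rw [Finset.card_insert_of_notMem hr, pow_succ]
      have hR : 0 ≤ (1 + ε) / (1 - ε) := by positivity
      constructor
      · calc p s ≤ (1 + ε) / (1 - ε) * p₀ s := h2.1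
          _ ≤ (1 + ε) / (1 - ε) * (((1 + ε) / (1 - ε)) ^ F.card * q s) := by gcongr; exact h1.1
          _ = _ := by ring
      · calc q s ≤ ((1 + ε) / (1 - ε)) ^ F.card * p₀ s := h1.2
          _ ≤ ((1 + ε) / (1 - ε)) ^ F.card * ((1 + ε) / (1 - ε) * p s) := by gcongr; exact h2.2
          _ = _ := by ring
  have e : mix Finset.univ = P' := by ext; simp [hmix]
  simpa using key Finset.univ q' (e ▸ hq') s

/-- Some power of the transition matrix of an irreducible aperiodic chain is positive. -/
theorem exists_pow_pos (hirr : P.IsIrreducible) (hap : IsAperiodic P) :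
    ∃ m : ℕ, ∀ x y, 0 < (P ^ m) x y := by
  have hmul : ∀ (k l : ℕ) (x y z : S), 0 < (P ^ k) x y → 0 < (P ^ l) y z →
      0 < (P ^ (k + l)) x z := by
    intro k l x y z h1 h2
    rw [pow_add, Matrix.mul_apply]
    exact Finset.sum_pos' (fun v _ => mul_nonneg (Matrix.pow_apply_nonneg hirr.nonneg k x v)
      (Matrix.pow_apply_nonneg hirr.nonneg l v z)) ⟨y, Finset.mem_univ y, mul_pos h1 h2⟩
  have hret : ∀ s : S, ∃ n, ∀ k ≥ n, 0 < (P ^ k) s s := by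
    intro s
    -- The additive monoid generated by a set of integers with gcd `1` contains all large integers,
    -- and return times are closed under addition.
    set R : Set ℕ := {n | 0 < n ∧ 0 < (P ^ n) s s} with hR
    have hg : Nat.setGcd R = 1 :=
      hap s _ fun n hn hp => Nat.setGcd_dvd_of_mem (show n ∈ R from ⟨hn, hp⟩)
    obtain ⟨n, hn⟩ := Nat.exists_mem_closure_of_ge R
    refine ⟨n, fun k hk => ?_⟩
    have hmem := hn k hk (by rw [hg]; exact one_dvd k)
    clear hk
    induction hmem using AddSubmonoid.closure_induction with
    | mem x hx => exact hx.2
    | zero => simp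
    | add x y _ _ hx hy => exact hmul x y s s s hx hy
  choose n hn using hret
  have hpath := (Matrix.isIrreducible_iff_exists_pow_pos hirr.nonneg).mp hirr
  choose k _ hk using hpath
  refine ⟨(∑ x, n x) + ∑ x, ∑ y, k x y, fun x y => ?_⟩
  have h1 : n x ≤ ∑ x, n x := Finset.single_le_sum (fun _ _ => Nat.zero_le _) (Finset.mem_univ x)
  have h2 : k x y ≤ ∑ x, ∑ y, k x y :=
    (Finset.single_le_sum (f := fun y => k x y) (fun _ _ => Nat.zero_le _)
      (Finset.mem_univ y)).trans
    (Finset.single_le_sum (f := fun x => ∑ y, k x y) (fun _ _ => Nat.zero_le _)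
      (Finset.mem_univ x))
  have := hmul ((∑ x, n x) + ∑ x, ∑ y, k x y - k x y) (k x y) x x y (hn x _ (by omega)) (hk x y)
  rwa [Nat.sub_add_cancel (by omega)] at this

/-- A minorization of all powers, uniform over the matrices that dominate `2 / 3` of `P`. -/
theorem exists_minorization (hP : P ∈ Matrix.rowStochastic ℝ S) (hirr : P.IsIrreducible)
    (hap : IsAperiodic P) : ∃ m : ℕ, 0 < m ∧ ∃ c : ℝ, 0 < c ∧ c < 1 ∧
      ∀ P' : Matrix S S ℝ, (∀ x y, 2 / 3 * P x y ≤ P' x y) → ∀ x y, c ≤ (P' ^ m) x y := by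
  obtain ⟨m₀, hm₀⟩ := exists_pow_pos hirr hap
  have hm1 : ∀ x y, 0 < (P ^ (m₀ + 1)) x y := by
    intro x y
    obtain ⟨w, hw⟩ : ∃ w, 0 < P x w := by
      by_contra! hcon
      have := Finset.sum_nonpos fun w (_ : w ∈ Finset.univ) => hcon w
      rw [(Matrix.mem_rowStochastic_iff_sum.mp hP).2 x] at this
      linarith
    rw [pow_succ', Matrix.mul_apply]
    exact Finset.sum_pos' (fun v _ => mul_nonneg (hirr.nonneg x v) (hm₀ v y).le)
      ⟨w, Finset.mem_univ w, mul_pos hw (hm₀ w y)⟩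
  obtain ⟨c, hc, hc'⟩ : ∃ c : ℝ, 0 < c ∧ ∀ x y, c ≤ (P ^ (m₀ + 1)) x y := by
    rcases isEmpty_or_nonempty S with h | h
    · exact ⟨1, one_pos, fun x => isEmptyElim x⟩
    · obtain ⟨p, hp⟩ := Finite.exists_min fun p : S × S => (P ^ (m₀ + 1)) p.1 p.2
      exact ⟨_, hm1 p.1 p.2, fun x y => hp (x, y)⟩
  -- The exponent is shifted to be positive, and the cap `1 / 2` keeps the constant below `1` also
  -- for a one-state chain.
  refine ⟨m₀ + 1, Nat.succ_pos _, min ((2 / 3) ^ (m₀ + 1) * c) (1 / 2), by positivity,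
    (min_le_right _ _).trans_lt (by norm_num), fun P' hP' x y => ?_⟩
  have hP'0 : ∀ x y, 0 ≤ P' x y := fun x y =>
    le_trans (mul_nonneg (by norm_num) (hirr.nonneg x y)) (hP' x y)
  have key : ∀ k : ℕ, ∀ x y, (2 / 3) ^ k * (P ^ k) x y ≤ (P' ^ k) x y := by
    intro k
    induction k with
    | zero => intro x y; simp
    | succ k ih =>
      intro x y
      simp only [pow_succ, Matrix.mul_apply, Finset.mul_sum]
      refine Finset.sum_le_sum fun w _ => ?_
      calc (2 / 3) ^ k * (2 / 3) * ((P ^ k) x w * P w y)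
          = ((2 / 3) ^ k * (P ^ k) x w) * (2 / 3 * P w y) := by ring
        _ ≤ (P' ^ k) x w * P' w y := by
          have h1 := Matrix.pow_apply_nonneg hirr.nonneg k x w
          have h2 := hirr.nonneg w y
          have h3 := Matrix.pow_apply_nonneg hP'0 k x w
          gcongr
          · exact ih x w
          · exact hP' w y
  calc min ((2 / 3) ^ (m₀ + 1) * c) (1 / 2) ≤ (2 / 3) ^ (m₀ + 1) * c := min_le_left _ _
    _ ≤ (2 / 3) ^ (m₀ + 1) * (P ^ (m₀ + 1)) x y := by gcongr; exact hc' x y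
    _ ≤ _ := key _ x y

theorem IsStationary.ge_of_minorization (h : IsStationary P q) {m : ℕ} {c : ℝ}
    (hc : ∀ x y, c ≤ (P ^ m) x y) (s : S) : c ≤ q s := by
  rw [← (h.pow m).sum_mul s]
  calc c = ∑ u, q u * c := by rw [← Finset.sum_mul, h.sum_eq_one, one_mul]
    _ ≤ _ := Finset.sum_le_sum fun u _ => mul_le_mul_of_nonneg_left (hc u s) (h.nonneg u)

end MarkovChain

/-! ### The Poisson equation for vector-valued functions. -/

section Poisson

variable {S : Type*} [Fintype S] {E : Type*} [NormedAddCommGroup E] [NormedSpace ℝ E]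

/-- The action of a matrix on vector-valued functions. -/
def act (P : Matrix S S ℝ) (f : S → E) : S → E := fun x => ∑ y, P x y • f y

theorem act_one [DecidableEq S] (f : S → E) : act (1 : Matrix S S ℝ) f = f := by
  funext x
  simp [act, Matrix.one_apply]

theorem act_mul (P Q : Matrix S S ℝ) (f : S → E) : act (P * Q) f = act P (act Q f) := by
  funext x
  simp only [act, Matrix.mul_apply, Finset.sum_smul, Finset.smul_sum, smul_smul]
  rw [Finset.sum_comm]

theorem act_add (P Q : Matrix S S ℝ) (f : S → E) : act (P + Q) f = act P f + act Q f := by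
  funext x
  simp [act, add_smul, Finset.sum_add_distrib]

theorem act_sub (P Q : Matrix S S ℝ) (f : S → E) : act (P - Q) f = act P f - act Q f := by
  funext x
  simp [act, sub_smul, Finset.sum_sub_distrib]

theorem act_add_right (P : Matrix S S ℝ) (f g : S → E) : act P (f + g) = act P f + act P g := by
  funext x
  simp [act, Finset.sum_add_distrib]

theorem act_smul_right (P : Matrix S S ℝ) (a : ℝ) (f : S → E) : act P (a • f) = a • act P f := by
  funext x
  simp only [act, Pi.smul_apply, Finset.smul_sum, smul_smul, mul_comm]

variable {P : Matrix S S ℝ} {q : S → ℝ}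

theorem act_const_row (f : S → E) :
    act (Matrix.of fun _ y => q y : Matrix S S ℝ) f = fun _ => ∑ y, q y • f y := rfl

theorem IsStationary.sum_smul_act (h : IsStationary P q) (f : S → E) :
    ∑ x, q x • act P f x = ∑ x, q x • f x := by
  simp only [act, Finset.smul_sum, smul_smul]
  rw [Finset.sum_comm]
  refine Finset.sum_congr rfl fun y _ => ?_
  rw [← Finset.sum_smul, h.sum_mul]

theorem sum_smul_centered (h : IsStationary P q) (f : S → E) :
    ∑ x, q x • (f x - ∑ y, q y • f y) = 0 := by
  simp only [smul_sub, Finset.sum_sub_distrib]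
  rw [← Finset.sum_smul, h.sum_eq_one, one_smul, sub_self]

theorem norm_centered_le (h : IsStationary P q) {f : S → E} {B : ℝ} (hf : ∀ x, ‖f x‖ ≤ B)
    (x : S) : ‖f x - ∑ y, q y • f y‖ ≤ 2 * B := by
  have h1 : ‖∑ y, q y • f y‖ ≤ B := by
    calc ‖∑ y, q y • f y‖ ≤ ∑ y, ‖q y • f y‖ := norm_sum_le _ _
      _ ≤ ∑ y, q y * B := by
        refine Finset.sum_le_sum fun y _ => ?_
        rw [norm_smul, Real.norm_of_nonneg (h.nonneg y)]
        exact mul_le_mul_of_nonneg_left (hf y) (h.nonneg y)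
      _ = B := by rw [← Finset.sum_mul, h.sum_eq_one, one_mul]
  linarith [norm_sub_le (f x) (∑ y, q y • f y), hf x]

variable [DecidableEq S]

theorem norm_act_le (hP : P ∈ Matrix.rowStochastic ℝ S) {f : S → E} {B : ℝ}
    (hf : ∀ x, ‖f x‖ ≤ B) (x : S) : ‖act P f x‖ ≤ B := by
  rw [Matrix.mem_rowStochastic_iff_sum] at hP
  calc ‖act P f x‖ ≤ ∑ y, ‖P x y • f y‖ := norm_sum_le _ _
    _ ≤ ∑ y, P x y * B := by
      refine Finset.sum_le_sum fun y _ => ?_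
      rw [norm_smul, Real.norm_of_nonneg (hP.1 x y)]
      exact mul_le_mul_of_nonneg_left (hf y) (hP.1 x y)
    _ = B := by rw [← Finset.sum_mul, hP.2, one_mul]

/-- A minorization contracts functions with stationary mean zero. -/
theorem norm_act_le_of_minorization (hP : P ∈ Matrix.rowStochastic ℝ S) (h : IsStationary P q)
    {c : ℝ} (hc₀ : 0 ≤ c) (hc : ∀ x y, c ≤ P x y) {f : S → E}
    (hqf : ∑ x, q x • f x = 0) {B : ℝ} (hf : ∀ x, ‖f x‖ ≤ B) (x : S) :
    ‖act P f x‖ ≤ (1 - c) * B := by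
  rw [Matrix.mem_rowStochastic_iff_sum] at hP
  -- Subtracting `c q` from each row does not change the action on functions of mean zero; since `q
  -- ≤ 1`, what remains is a nonnegative kernel of mass `1 - c`.
  have e : act P f x = ∑ y, (P x y - c * q y) • f y := by
    simp only [act, sub_smul, Finset.sum_sub_distrib, mul_smul]
    rw [← Finset.smul_sum, hqf, smul_zero, sub_zero]
  have hnn : ∀ y, 0 ≤ P x y - c * q y := fun y => by
    have := mul_le_mul_of_nonneg_left (h.le_one y) hc₀
    linarith [hc x y]
  rw [e]
  calc ‖∑ y, (P x y - c * q y) • f y‖ ≤ ∑ y, ‖(P x y - c * q y) • f y‖ := norm_sum_le _ _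
    _ ≤ ∑ y, (P x y - c * q y) * B := by
      refine Finset.sum_le_sum fun y _ => ?_
      rw [norm_smul, Real.norm_of_nonneg (hnn y)]
      exact mul_le_mul_of_nonneg_left (hf y) (hnn y)
    _ = (1 - c) * B := by
      rw [← Finset.sum_mul, Finset.sum_sub_distrib, ← Finset.mul_sum, hP.2, h.sum_eq_one, mul_one]

/-- Each block of `m` steps contracts by `1 - c`. The geometric rate is weakened to `1/(t+1)`
through Bernoulli's inequality and `(1 - c)^k (1 + c)^k ≤ 1`; its square is still dominated by the
step sizes, which is all that is needed. -/
theorem norm_act_pow_le (hP : P ∈ Matrix.rowStochastic ℝ S) (h : IsStationary P q)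
    {m : ℕ} (hm : 0 < m) {c : ℝ} (hc₀ : 0 < c) (hc₁ : c < 1) (hc : ∀ x y, c ≤ (P ^ m) x y)
    {f : S → E} (hqf : ∑ x, q x • f x = 0) {B : ℝ} (hB : 0 ≤ B) (hf : ∀ x, ‖f x‖ ≤ B)
    (t : ℕ) (x : S) : ‖act (P ^ t) f x‖ ≤ m / c / (t + 1) * B := by
  have hPm : ∀ k, P ^ k ∈ Matrix.rowStochastic ℝ S := fun k => pow_mem hP k
  have h1 : ∀ k : ℕ, ∀ x, ‖act (P ^ (m * k)) f x‖ ≤ (1 - c) ^ k * B := by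
    intro k
    induction k with
    | zero => simpa [act_one] using hf
    | succ k ih =>
      intro x
      have e : P ^ (m * (k + 1)) = P ^ m * P ^ (m * k) := by rw [← pow_add]; congr 1; ring
      rw [e, act_mul, pow_succ', mul_assoc]
      refine norm_act_le_of_minorization (hPm m) (h.pow m) hc₀.le hc ?_ ih x
      rw [(h.pow (m * k)).sum_smul_act, hqf]
  have e : P ^ t = P ^ (t % m) * P ^ (m * (t / m)) := by rw [← pow_add, Nat.mod_add_div]
  rw [e, act_mul]
  refine (norm_act_le (hPm _) (h1 (t / m)) x).trans ?_
  refine mul_le_mul_of_nonneg_right ?_ hB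
  set k := t / m with hk
  have hmR : (0 : ℝ) < m := by exact_mod_cast hm
  have hb : 1 + (k : ℝ) * c ≤ (1 + c) ^ k := one_add_mul_le_pow (by linarith) k
  have hprod : (1 - c) ^ k * (1 + c) ^ k ≤ 1 := by
    rw [← mul_pow]
    exact pow_le_one₀ (by nlinarith) (by nlinarith)
  have hpk : 0 ≤ (1 - c) ^ k := pow_nonneg (by linarith) k
  have hkm : (t : ℝ) + 1 ≤ m * (k + 1) := by
    have := Nat.lt_mul_div_succ t hm
    rw [← hk] at this
    exact_mod_cast this
  rw [le_div_iff₀ (by positivity), le_div_iff₀ hc₀]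
  have h3 : (1 - c) ^ k * (1 + k * c) ≤ 1 := (mul_le_mul_of_nonneg_left hb hpk).trans hprod
  calc (1 - c) ^ k * (t + 1) * c ≤ (1 - c) ^ k * (m * (k + 1)) * c := by gcongr
    _ = m * ((1 - c) ^ k * (c + k * c)) := by ring
    _ ≤ m * ((1 - c) ^ k * (1 + k * c)) := by gcongr
    _ ≤ m := by nlinarith

/-- The fundamental matrix of a chain with stationary distribution `q`. -/
noncomputable def fundamental (P : Matrix S S ℝ) (q : S → ℝ) : Matrix S S ℝ :=
  (1 - P + Matrix.of fun _ y => q y)⁻¹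

/-- Telescoping bounds `f - P^m f` by `m B`, and `P^m` contracts `f`; at a maximizer of `‖f‖` this
reads `‖f‖ ≤ m B + (1 - c) ‖f‖`. -/
theorem norm_le_of_act_eq (hP : P ∈ Matrix.rowStochastic ℝ S) (h : IsStationary P q)
    {m : ℕ} {c : ℝ} (hc₀ : 0 < c) (hc : ∀ x y, c ≤ (P ^ m) x y)
    {f : S → E} {B : ℝ} (hqf : ∑ x, q x • f x = 0)
    (hf : ∀ x, ‖f x - act P f x‖ ≤ B) (x : S) : ‖f x‖ ≤ m / c * B := by
  have hPm : ∀ k, P ^ k ∈ Matrix.rowStochastic ℝ S := fun k => pow_mem hP k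
  have h1 : ∀ k : ℕ, ∀ x, ‖f x - act (P ^ k) f x‖ ≤ k * B := by
    intro k
    induction k with
    | zero => intro x; simp [act_one]
    | succ k ih =>
      intro x
      have e : f x - act (P ^ (k + 1)) f x =
          (f x - act (P ^ k) f x) + act (P ^ k) (fun x => f x - act P f x) x := by
        rw [pow_succ, act_mul]
        simp only [act, smul_sub, Finset.sum_sub_distrib]
        abel
      rw [e]
      refine (norm_add_le _ _).trans ?_
      push_cast
      linarith [ih x, norm_act_le (hPm k) hf x]
  have : Nonempty S := ⟨x⟩
  obtain ⟨y, hy⟩ := Finite.exists_max fun y => ‖f y‖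
  have h2 := norm_act_le_of_minorization (hPm m) (h.pow m) hc₀.le hc hqf hy y
  have h3 : ‖f y‖ ≤ m * B + (1 - c) * ‖f y‖ := by
    calc ‖f y‖ = ‖(f y - act (P ^ m) f y) + act (P ^ m) f y‖ := by rw [sub_add_cancel]
      _ ≤ _ := (norm_add_le _ _).trans (add_le_add (h1 m y) h2)
  refine (hy x).trans ?_
  rw [div_mul_eq_mul_div, le_div_iff₀ hc₀]
  linarith

/-- Integrating a kernel vector against `q` shows that it has mean zero, so it is harmonic; the
bound above with `B = 0` then makes it vanish. -/
theorem mul_fundamental (hP : P ∈ Matrix.rowStochastic ℝ S) (h : IsStationary P q)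
    {m : ℕ} {c : ℝ} (hc₀ : 0 < c) (hc : ∀ x y, c ≤ (P ^ m) x y) :
    (1 - P + Matrix.of fun _ y => q y) * fundamental P q = 1 := by
  refine Matrix.mul_nonsing_inv _ ?_
  rw [isUnit_iff_ne_zero]
  intro hdet
  obtain ⟨w, hw0, hw⟩ := Matrix.exists_mulVec_eq_zero_iff.mpr hdet
  have hact : ∀ x, w x - act P w x + ∑ y, q y • w y = 0 := by
    intro x
    have := congrFun hw x
    rw [Matrix.add_mulVec, Matrix.sub_mulVec, Matrix.one_mulVec] at this
    simpa [Matrix.mulVec, dotProduct, act] using this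
  have hq : ∑ y, q y • w y = 0 := by
    have h1 : ∑ x, q x • (w x - act P w x + ∑ y, q y • w y) = 0 :=
      Finset.sum_eq_zero fun x _ => by rw [hact, smul_zero]
    simp only [smul_add, smul_sub, Finset.sum_add_distrib, Finset.sum_sub_distrib] at h1
    rw [h.sum_smul_act, sub_self, zero_add, ← Finset.sum_smul, h.sum_eq_one, one_smul] at h1
    exact h1
  apply hw0
  funext x
  have := norm_le_of_act_eq hP h hc₀ hc (B := 0) hq (fun x => by
    have := hact x
    rw [hq, add_zero] at this
    rw [this, norm_zero]) x
  simpa using this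

/-- The solution of the Poisson equation with right-hand side `f`, centered. -/
noncomputable def poisson (P : Matrix S S ℝ) (q : S → ℝ) (f : S → E) : S → E :=
  act (fundamental P q) fun x => f x - ∑ y, q y • f y

theorem poisson_add (P : Matrix S S ℝ) (q : S → ℝ) (f g : S → E) :
    poisson P q (f + g) = poisson P q f + poisson P q g := by
  rw [poisson, poisson, poisson, ← act_add_right]
  congr 1
  funext x
  simp only [Pi.add_apply, smul_add, Finset.sum_add_distrib]
  abel

theorem poisson_smul (P : Matrix S S ℝ) (q : S → ℝ) (a : ℝ) (f : S → E) :
    poisson P q (a • f) = a • poisson P q f := by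
  rw [poisson, poisson, ← act_smul_right]
  congr 1
  funext x
  simp only [Pi.smul_apply, smul_sub, Finset.smul_sum, smul_smul, mul_comm]

theorem poisson_spec (hP : P ∈ Matrix.rowStochastic ℝ S) (h : IsStationary P q)
    {m : ℕ} {c : ℝ} (hc₀ : 0 < c) (hc : ∀ x y, c ≤ (P ^ m) x y) (f : S → E) :
    (∑ x, q x • poisson P q f x = 0) ∧
      ∀ x, poisson P q f x - act P (poisson P q f) x = f x - ∑ y, q y • f y := by
  set g : S → E := fun x => f x - ∑ y, q y • f y with hg
  have hqg : ∑ x, q x • g x = 0 := sum_smul_centered h f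
  set w := poisson P q f with hw
  have hact : ∀ x, w x - act P w x + ∑ y, q y • w y = g x := by
    intro x
    have : act ((1 - P + Matrix.of fun _ y => q y) * fundamental P q) g x = g x := by
      rw [mul_fundamental hP h hc₀ hc, act_one]
    rw [act_mul, act_add, act_sub, act_one, act_const_row] at this
    exact this
  have hq : ∑ y, q y • w y = 0 := by
    have h1 : ∑ x, q x • (w x - act P w x + ∑ y, q y • w y) = 0 := by
      rw [← hqg]
      exact Finset.sum_congr rfl fun x _ => by rw [hact]
    simp only [smul_add, smul_sub, Finset.sum_add_distrib, Finset.sum_sub_distrib] at h1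
    rw [h.sum_smul_act, sub_self, zero_add, ← Finset.sum_smul, h.sum_eq_one, one_smul] at h1
    exact h1
  refine ⟨hq, fun x => ?_⟩
  have := hact x
  rwa [hq, add_zero] at this

theorem norm_poisson_le (hP : P ∈ Matrix.rowStochastic ℝ S) (h : IsStationary P q)
    {m : ℕ} {c : ℝ} (hc₀ : 0 < c) (hc : ∀ x y, c ≤ (P ^ m) x y) {f : S → E} {B : ℝ}
    (hf : ∀ x, ‖f x‖ ≤ B) (x : S) : ‖poisson P q f x‖ ≤ m / c * (2 * B) := by
  obtain ⟨h1, h2⟩ := poisson_spec hP h hc₀ hc f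
  refine norm_le_of_act_eq hP h hc₀ hc h1 (fun x => ?_) x
  rw [h2]
  exact norm_centered_le h hf x

end Poisson

/-! ### Product laws and sums of independent vectors. -/

section ProductWeights

variable {ι α : Type*} [Fintype ι] [DecidableEq ι] [Fintype α]
  {w : ι → α → ℝ} {E : Type*} [NormedAddCommGroup E] [InnerProductSpace ℝ E]

theorem sum_prod_pi (h : ι → α → ℝ) : ∑ o : ι → α, ∏ k, h k (o k) = ∏ k, ∑ a, h k a := by
  rw [Finset.prod_univ_sum, Fintype.piFinset_univ]

theorem sum_prod_mul_ite (hw : ∀ i, ∑ a, w i a = 1) [DecidableEq α] (i : ι) (a : α) :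
    ∑ o : ι → α, (∏ k, w k (o k)) * (if o i = a then 1 else 0) = w i a := by
  have e : ∀ o : ι → α, (∏ k, w k (o k)) * (if o i = a then 1 else 0) =
      ∏ k, (w k (o k) * if k = i then (if o k = a then 1 else 0) else 1) := by
    intro o
    rw [Finset.prod_mul_distrib, Finset.prod_ite_eq' Finset.univ i]
    simp
  simp_rw [e]
  rw [sum_prod_pi fun k b => w k b * if k = i then (if b = a then 1 else 0) else 1]
  have e2 : ∀ k, ∑ b, (w k b * if k = i then (if b = a then 1 else 0) else 1) =
      if k = i then w k a else 1 := by
    intro k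
    split_ifs <;> simp [hw]
  simp_rw [e2]
  simp

theorem sum_prod_mul_ite_ite (hw : ∀ i, ∑ a, w i a = 1) [DecidableEq α] {i j : ι} (hij : i ≠ j)
    (a b : α) :
    ∑ o : ι → α, (∏ k, w k (o k)) *
      ((if o i = a then 1 else 0) * (if o j = b then 1 else 0)) = w i a * w j b := by
  have e : ∀ o : ι → α, (∏ k, w k (o k)) *
      ((if o i = a then 1 else 0) * (if o j = b then 1 else 0)) =
      ∏ k, (w k (o k) * ((if k = i then (if o k = a then 1 else 0) else 1) *
        (if k = j then (if o k = b then 1 else 0) else 1))) := by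
    intro o
    rw [Finset.prod_mul_distrib, Finset.prod_mul_distrib, Finset.prod_ite_eq' Finset.univ i,
      Finset.prod_ite_eq' Finset.univ j]
    simp
  simp_rw [e]
  rw [sum_prod_pi fun k c => w k c * ((if k = i then (if c = a then 1 else 0) else 1) *
        (if k = j then (if c = b then 1 else 0) else 1))]
  have e2 : ∀ k, ∑ c, (w k c * ((if k = i then (if c = a then 1 else 0) else 1) *
        (if k = j then (if c = b then 1 else 0) else 1))) =
      (if k = i then w k a else 1) * (if k = j then w k b else 1) := by
    intro k
    by_cases h1 : k = i
    · have h2 : k ≠ j := h1 ▸ hij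
      simp [h1, hij]
    · by_cases h2 : k = j
      · simp [h2, hij.symm]
      · simp [h1, h2, hw]
  simp_rw [e2]
  rw [Finset.prod_mul_distrib]
  simp

theorem sum_prod_smul (hw : ∀ i, ∑ a, w i a = 1) (i : ι) (f : α → E) :
    ∑ o : ι → α, (∏ k, w k (o k)) • f (o i) = ∑ a, w i a • f a := by
  classical
  have e : ∀ o : ι → α, f (o i) = ∑ a, (if o i = a then (1 : ℝ) else 0) • f a := by
    intro o
    simp
  calc ∑ o : ι → α, (∏ k, w k (o k)) • f (o i)
      = ∑ o : ι → α, ∑ a, ((∏ k, w k (o k)) * (if o i = a then 1 else 0)) • f a := by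
        refine Finset.sum_congr rfl fun o _ => ?_
        rw [e o, Finset.smul_sum]
        simp_rw [smul_smul]
    _ = ∑ a, w i a • f a := by
        rw [Finset.sum_comm]
        simp_rw [← Finset.sum_smul, sum_prod_mul_ite hw]

theorem sum_prod_inner (hw : ∀ i, ∑ a, w i a = 1) {i j : ι} (hij : i ≠ j) (f g : α → E) :
    ∑ o : ι → α, (∏ k, w k (o k)) * inner ℝ (f (o i)) (g (o j)) =
      inner ℝ (∑ a, w i a • f a) (∑ a, w j a • g a) := by
  classical
  have e : ∀ o : ι → α, inner ℝ (f (o i)) (g (o j)) = ∑ a, ∑ b,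
      ((if o i = a then (1 : ℝ) else 0) * (if o j = b then 1 else 0)) * inner ℝ (f a) (g b) := by
    intro o
    simp
  calc ∑ o : ι → α, (∏ k, w k (o k)) * inner ℝ (f (o i)) (g (o j))
      = ∑ o : ι → α, ∑ a, ∑ b, ((∏ k, w k (o k)) * ((if o i = a then 1 else 0) *
          (if o j = b then 1 else 0))) * inner ℝ (f a) (g b) := by
        refine Finset.sum_congr rfl fun o _ => ?_
        rw [e o, Finset.mul_sum]
        refine Finset.sum_congr rfl fun a _ => ?_
        rw [Finset.mul_sum]
        exact Finset.sum_congr rfl fun b _ => by ring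
    _ = ∑ a, ∑ b, (w i a * w j b) * inner ℝ (f a) (g b) := by
        rw [Finset.sum_comm]
        refine Finset.sum_congr rfl fun a _ => ?_
        rw [Finset.sum_comm]
        refine Finset.sum_congr rfl fun b _ => ?_
        rw [← Finset.sum_mul, sum_prod_mul_ite_ite hw hij]
    _ = _ := by
        rw [sum_inner]
        refine Finset.sum_congr rfl fun a _ => ?_
        rw [inner_sum]
        refine Finset.sum_congr rfl fun b _ => ?_
        rw [real_inner_smul_left, real_inner_smul_right]
        ring

/-- The off-diagonal part of the squared norm of a sum. -/
noncomputable def offDiag (z : ι → E) : ℝ := ‖∑ i, z i‖ ^ 2 - ∑ i, ‖z i‖ ^ 2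

theorem offDiag_eq (z : ι → E) :
    offDiag z = ∑ i, ∑ j, if i = j then 0 else inner ℝ (z i) (z j) := by
  have h1 : ‖∑ i, z i‖ ^ 2 = ∑ i, ∑ j, inner ℝ (z i) (z j) := by
    rw [← real_inner_self_eq_norm_sq, sum_inner]
    simp_rw [inner_sum]
  have h2 : ∑ i, ‖z i‖ ^ 2 = ∑ i, ∑ j, if i = j then inner ℝ (z i) (z j) else 0 := by
    simp
  rw [offDiag, h1, h2, ← Finset.sum_sub_distrib]
  refine Finset.sum_congr rfl fun i _ => ?_
  rw [← Finset.sum_sub_distrib]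
  refine Finset.sum_congr rfl fun j _ => ?_
  split_ifs <;> simp

/-- Distinct coordinates are independent, so expectations pass inside every mixed inner product.
Only the diagonal, with `N` instead of `N²` terms, resists; this is the source of the linear
speedup. -/
theorem sum_prod_offDiag (hw : ∀ i, ∑ a, w i a = 1) (f : ι → α → E) :
    ∑ o : ι → α, (∏ k, w k (o k)) * offDiag (fun i => f i (o i)) =
      offDiag fun i => ∑ a, w i a • f i a := by
  simp_rw [offDiag_eq, Finset.mul_sum]
  rw [Finset.sum_comm]
  refine Finset.sum_congr rfl fun i _ => ?_
  rw [Finset.sum_comm]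
  refine Finset.sum_congr rfl fun j _ => ?_
  split_ifs with hij
  · simp
  · exact sum_prod_inner hw hij (f i) (f j)

end ProductWeights

/-! ### Expectations along a finite chain, without measure theory. -/

/-- A time-homogeneous sampling mechanism: in the state `x` an outcome `o` is drawn with
probability `weight x o`, and the next state is `next o`. -/
structure Sampler (X O : Type*) [Fintype X] [Fintype O] where
  init : X → ℝ
  weight : X → O → ℝ
  next : O → X
  init_nonneg : ∀ x, 0 ≤ init x
  init_sum : ∑ x, init x = 1
  weight_nonneg : ∀ x o, 0 ≤ weight x o
  weight_sum : ∀ x, ∑ o, weight x o = 1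

namespace Sampler

variable {X O : Type*} [Fintype X] [Fintype O] (C : Sampler X O)

/-- Conditional mean, given the current state, of a function of the outcome. -/
def mean {E : Type*} [AddCommGroup E] [Module ℝ E] (x : X) (h : O → E) : E :=
  ∑ o, C.weight x o • h o

section Mean

variable {E : Type*} [AddCommGroup E] [Module ℝ E]

theorem mean_add (x : X) (f g : O → E) :
    C.mean x (fun o => f o + g o) = C.mean x f + C.mean x g := by
  simp [mean, Finset.sum_add_distrib]

theorem mean_sub (x : X) (f g : O → E) :
    C.mean x (fun o => f o - g o) = C.mean x f - C.mean x g := by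
  simp [mean, smul_sub, Finset.sum_sub_distrib]

theorem mean_const (x : X) (z : E) : C.mean x (fun _ => z) = z := by
  rw [mean, ← Finset.sum_smul, C.weight_sum, one_smul]

theorem mean_smul (x : X) (a : ℝ) (f : O → E) :
    C.mean x (fun o => a • f o) = a • C.mean x f := by
  simp only [mean, Finset.smul_sum]
  exact Finset.sum_congr rfl fun o _ => smul_comm _ _ _

theorem mean_mul (x : X) (a : ℝ) (f : O → ℝ) :
    C.mean x (fun o => a * f o) = a * C.mean x f := C.mean_smul x a f

theorem mean_sum {ι : Type*} (s : Finset ι) (x : X) (f : ι → O → E) :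
    C.mean x (fun o => ∑ i ∈ s, f i o) = ∑ i ∈ s, C.mean x (f i) := by
  simp only [mean, Finset.smul_sum]
  exact Finset.sum_comm

theorem mean_mono (x : X) {f g : O → ℝ} (h : ∀ o, f o ≤ g o) : C.mean x f ≤ C.mean x g :=
  Finset.sum_le_sum fun o _ => mul_le_mul_of_nonneg_left (h o) (C.weight_nonneg x o)

end Mean

theorem mean_inner {E : Type*} [NormedAddCommGroup E] [InnerProductSpace ℝ E] (x : X) (z : E)
    (f : O → E) : C.mean x (fun o => inner ℝ z (f o)) = inner ℝ z (C.mean x f) := by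
  simp only [mean, inner_sum, real_inner_smul_right, smul_eq_mul]

variable {Y : Type*} (y₀ : X → Y) (G : ℕ → Y → X → O → Y)

/-- Expectation of a function of the algorithm state and of the chain state at time `t`; the
algorithm state starts at `y₀` and is updated by `G`. -/
def ex : ℕ → (Y → X → ℝ) → ℝ
  | 0, f => ∑ x, C.init x * f (y₀ x) x
  -- The test function is pulled back by one step instead of the law being pushed forward, so facts
  -- about `ex` follow by induction on `t` with the test function generalized.
  | t + 1, f => ex t fun y x => C.mean x fun o => f (G t y x o) (C.next o)

theorem ex_mono (t : ℕ) {f g : Y → X → ℝ} (h : ∀ y x, f y x ≤ g y x) :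
    C.ex y₀ G t f ≤ C.ex y₀ G t g := by
  induction t generalizing f g with
  | zero => exact Finset.sum_le_sum fun x _ => mul_le_mul_of_nonneg_left (h _ _) (C.init_nonneg x)
  | succ t ih => exact ih fun y x => C.mean_mono x fun o => h _ _

theorem ex_add (t : ℕ) (f g : Y → X → ℝ) :
    C.ex y₀ G t (fun y x => f y x + g y x) = C.ex y₀ G t f + C.ex y₀ G t g := by
  induction t generalizing f g with
  | zero => simp [ex, mul_add, Finset.sum_add_distrib]
  | succ t ih =>
    simp only [ex]
    rw [← ih]
    congr 1
    funext y x
    exact C.mean_add x _ _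

theorem ex_mul (t : ℕ) (a : ℝ) (f : Y → X → ℝ) :
    C.ex y₀ G t (fun y x => a * f y x) = a * C.ex y₀ G t f := by
  induction t generalizing f with
  | zero => simp only [ex, Finset.mul_sum]; exact Finset.sum_congr rfl fun x _ => by ring
  | succ t ih =>
    simp only [ex]
    rw [← ih]
    congr 1
    funext y x
    exact C.mean_mul x _ _

theorem ex_sub (t : ℕ) (f g : Y → X → ℝ) :
    C.ex y₀ G t (fun y x => f y x - g y x) = C.ex y₀ G t f - C.ex y₀ G t g := by
  have h : (fun y x => f y x - g y x) = fun y x => f y x + (-1) * g y x := by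
    funext y x; ring
  rw [h, ex_add, ex_mul]
  ring

theorem ex_const (t : ℕ) (a : ℝ) : C.ex y₀ G t (fun _ _ => a) = a := by
  induction t with
  | zero => simp only [ex]; rw [← Finset.sum_mul, C.init_sum, one_mul]
  | succ t ih => simpa only [ex, mean_const] using ih

theorem ex_nonneg (t : ℕ) {f : Y → X → ℝ} (h : ∀ y x, 0 ≤ f y x) : 0 ≤ C.ex y₀ G t f := by
  rw [← C.ex_const y₀ G t 0]
  exact C.ex_mono y₀ G t h

theorem ex_succ (t : ℕ) (f : Y → X → ℝ) : C.ex y₀ G (t + 1) f =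
    C.ex y₀ G t fun y x => C.mean x fun o => f (G t y x o) (C.next o) := rfl

end Sampler

/-! ### Step sizes and the recursion for second moments. -/

/-- The step sizes of the algorithm. -/
noncomputable def stepSize (β : ℝ) (t : ℕ) : ℝ := 1 / ((t : ℝ) + 1) ^ β

section StepSize

variable {β : ℝ}

theorem stepSize_pos (β : ℝ) (t : ℕ) : 0 < stepSize β t := by unfold stepSize; positivity

theorem stepSize_zero (β : ℝ) : stepSize β 0 = 1 := by simp [stepSize]

theorem inv_stepSize (β : ℝ) (t : ℕ) : (stepSize β t)⁻¹ = ((t : ℝ) + 1) ^ β := by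
  simp [stepSize]

theorem stepSize_le_one (hβ : 0 ≤ β) (t : ℕ) : stepSize β t ≤ 1 := by
  unfold stepSize
  rw [div_le_one (by positivity)]
  exact Real.one_le_rpow (by linarith [t.cast_nonneg (α := ℝ)]) hβ

theorem stepSize_anti (hβ : 0 ≤ β) : Antitone (stepSize β) := by
  intro t u htu
  unfold stepSize
  have : (t : ℝ) ≤ u := by exact_mod_cast htu
  gcongr

theorem one_div_le_stepSize (hβ : β ≤ 1) (t : ℕ) : 1 / ((t : ℝ) + 1) ≤ stepSize β t := by
  unfold stepSize
  have h1 : (1 : ℝ) ≤ (t : ℝ) + 1 := by linarith [t.cast_nonneg (α := ℝ)]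
  refine one_div_le_one_div_of_le (by positivity) ?_
  calc ((t : ℝ) + 1) ^ β ≤ ((t : ℝ) + 1) ^ (1 : ℝ) := Real.rpow_le_rpow_of_exponent_le h1 hβ
    _ = _ := Real.rpow_one _

/-- The inverse step sizes grow slowly. -/
theorem inv_stepSize_succ_le (hβ₀ : 0 ≤ β) (hβ₁ : β ≤ 1) (t : ℕ) :
    (stepSize β (t + 1))⁻¹ - (stepSize β t)⁻¹ ≤ (stepSize β t)⁻¹ / ((t : ℝ) + 1) := by
  rw [inv_stepSize, inv_stepSize]
  have ht : (0 : ℝ) < (t : ℝ) + 1 := by positivity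
  have e : ((t + 1 : ℕ) : ℝ) + 1 = ((t : ℝ) + 1) * (1 + 1 / ((t : ℝ) + 1)) := by
    push_cast; field_simp
  rw [e, Real.mul_rpow ht.le (by positivity)]
  have h1 : (1 + 1 / ((t : ℝ) + 1)) ^ β ≤ 1 + β * (1 / ((t : ℝ) + 1)) :=
    rpow_one_add_le_one_add_mul_self (by have : 0 < 1 / ((t : ℝ) + 1) := by positivity
                                         linarith) hβ₀ hβ₁
  have h2 : β * (1 / ((t : ℝ) + 1)) ≤ 1 / ((t : ℝ) + 1) := by
    have : 0 < 1 / ((t : ℝ) + 1) := by positivity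
    nlinarith
  calc ((t : ℝ) + 1) ^ β * (1 + 1 / ((t : ℝ) + 1)) ^ β - ((t : ℝ) + 1) ^ β
      ≤ ((t : ℝ) + 1) ^ β * (1 + 1 / ((t : ℝ) + 1)) - ((t : ℝ) + 1) ^ β := by
        gcongr; linarith
    _ = _ := by ring

theorem stepSize_succ_ge (hβ₀ : 0 ≤ β) (hβ₁ : β ≤ 1) (t : ℕ) :
    stepSize β t * (1 - 1 / ((t : ℝ) + 1)) ≤ stepSize β (t + 1) := by
  have h := inv_stepSize_succ_le hβ₀ hβ₁ t
  set a := stepSize β t with ha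
  set a' := stepSize β (t + 1) with ha'
  have hp : 0 < a := stepSize_pos β t
  have hp' : 0 < a' := stepSize_pos β (t + 1)
  set z := 1 / ((t : ℝ) + 1) with hz
  have hz0 : 0 < z := by positivity
  have h1 : a'⁻¹ ≤ a⁻¹ * (1 + z) := by
    have : a⁻¹ / ((t : ℝ) + 1) = a⁻¹ * z := by rw [hz]; ring
    linarith
  have h2 : a ≤ a' * (1 + z) := by
    have h3 := mul_le_mul_of_nonneg_left h1 (mul_pos hp hp').le
    have e1 : a * a' * a'⁻¹ = a := by field_simp
    have e2 : a * a' * (a⁻¹ * (1 + z)) = a' * (1 + z) := by field_simp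
    linarith
  by_cases hz1 : z ≤ 1
  · calc a * (1 - z) ≤ a' * (1 + z) * (1 - z) := by
          exact mul_le_mul_of_nonneg_right h2 (by linarith)
      _ = a' * (1 - z ^ 2) := by ring
      _ ≤ a' := by nlinarith [sq_nonneg z]
  · nlinarith

theorem stepSize_sub_succ_le (hβ₀ : 0 ≤ β) (hβ₁ : β ≤ 1) (t : ℕ) :
    stepSize β t - stepSize β (t + 1) ≤ stepSize β t ^ 2 := by
  have h1 := stepSize_succ_ge hβ₀ hβ₁ t
  have h2 := mul_le_mul_of_nonneg_left (one_div_le_stepSize hβ₁ t) (stepSize_pos β t).le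
  nlinarith

theorem tendsto_natCast_add_one_rpow_neg {p : ℝ} (hp : 0 < p) :
    Tendsto (fun t : ℕ => ((t : ℝ) + 1) ^ (-p)) atTop (𝓝 0) :=
  (tendsto_rpow_neg_atTop hp).comp
    (tendsto_atTop_add_const_right _ _ tendsto_natCast_atTop_atTop)

theorem eventually_stepSize_le (hβ : 0 < β) {κ : ℝ} (hκ : 0 < κ) :
    ∀ᶠ t in atTop, stepSize β t ≤ κ := by
  have := tendsto_natCast_add_one_rpow_neg hβ
  filter_upwards [this.eventually_le_const hκ] with t ht
  rwa [stepSize, one_div, ← Real.rpow_neg (by positivity)]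

/-- This is where `β < 1` matters: the relative decrease of the step size, of order `1/(t+1)`,
becomes negligible against a contraction of order `b_t`. -/
theorem eventually_one_div_le_stepSize (hβ : β < 1) {κ : ℝ} (hκ : 0 < κ) :
    ∀ᶠ t in atTop, 1 / ((t : ℕ) + 1 : ℝ) ≤ κ * stepSize β t := by
  have := tendsto_natCast_add_one_rpow_neg (sub_pos.mpr hβ)
  filter_upwards [this.eventually_le_const hκ] with t ht
  have h1 : (0 : ℝ) < (t : ℝ) + 1 := by positivity
  rw [neg_sub, Real.rpow_sub h1, Real.rpow_one] at ht
  rw [stepSize]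
  calc 1 / ((t : ℝ) + 1) = ((t : ℝ) + 1) ^ β / ((t : ℝ) + 1) * (1 / ((t : ℝ) + 1) ^ β) := by
        field_simp
    _ ≤ _ := by gcongr

/-- Sums of powers. -/
theorem sum_rpow_le {r : ℝ} (hr₀ : 0 < r) (hr₁ : r ≤ 1) (T : ℕ) :
    ∑ t ∈ Finset.range T, ((t : ℝ) + 1) ^ (r - 1) ≤ (T : ℝ) ^ r / r := by
  induction T with
  | zero => simp [Real.zero_rpow hr₀.ne']
  | succ T ih =>
    rw [Finset.sum_range_succ]
    have hT : (0 : ℝ) < (T : ℝ) + 1 := by positivity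
    have e : (T : ℝ) = ((T : ℝ) + 1) * (1 + (-(1 / ((T : ℝ) + 1)))) := by field_simp; ring
    have hle : 1 / ((T : ℝ) + 1) ≤ 1 := by
      rw [div_le_one hT]; linarith [T.cast_nonneg (α := ℝ)]
    have h1 : (1 + (-(1 / ((T : ℝ) + 1)))) ^ r ≤ 1 + r * (-(1 / ((T : ℝ) + 1))) :=
      rpow_one_add_le_one_add_mul_self (by linarith) hr₀.le hr₁
    -- Discrete form of the integral comparison: concavity of the power, applied at `1 - 1/(T+1)`.
    have h2 : (T : ℝ) ^ r ≤ ((T : ℝ) + 1) ^ r - r * ((T : ℝ) + 1) ^ (r - 1) := by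
      calc (T : ℝ) ^ r = ((T : ℝ) + 1) ^ r * (1 + (-(1 / ((T : ℝ) + 1)))) ^ r := by
            rw [← Real.mul_rpow hT.le (by linarith), ← e]
        _ ≤ ((T : ℝ) + 1) ^ r * (1 + r * (-(1 / ((T : ℝ) + 1)))) := by gcongr
        _ = _ := by rw [Real.rpow_sub hT, Real.rpow_one]; ring
    calc _ ≤ (T : ℝ) ^ r / r + ((T : ℝ) + 1) ^ (r - 1) := by gcongr
      _ ≤ (((T : ℝ) + 1) ^ r - r * ((T : ℝ) + 1) ^ (r - 1)) / r + ((T : ℝ) + 1) ^ (r - 1) := by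
          gcongr
      _ = ((T + 1 : ℕ) : ℝ) ^ r / r := by push_cast; field_simp; ring

/-- Half of the drift absorbs the term `L b² δ`; rewritten through `w`, the rest contracts by `1 - κ
b / 2`. Of this, `κ b / 4` pays for the noise and `κ b / 4` for the decrease of the target from `b
(r + b)` to `b' (r + b')`, which costs at most `(1 - y)²` with `y ≤ κ b / 8`. -/
theorem lyapunov_step {b b' y r δ w w' κ L K : ℝ} (hbp : 0 < b) (hb1 : b ≤ 1) (hκ : 0 < κ)
    (hL : 0 ≤ L) (hr : 0 ≤ r) (hδ : 0 ≤ δ) (hK : 0 ≤ K) (hy0 : 0 < y)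
    (hLb : L * b ≤ κ) (hκb : κ * b ≤ 2) (hyb : y ≤ κ / 8 * b)
    (hge : b * (1 - y) ≤ b') (hKL : L + κ * L / 2 ≤ κ * K / 4)
    (hw' : w' ≤ w - 2 * κ * b * δ + L * b ^ 2 * (δ + (r + b)))
    (hwδ : w ≤ 2 * δ + L * b ^ 2 * (r + b)) (hw : w ≤ K * (b * (r + b))) :
    w' ≤ K * (b' * (r + b')) := by
  have hη : 0 ≤ r + b := by linarith
  have hX : 0 ≤ b ^ 2 * (r + b) := by positivity
  have hy1 : 0 ≤ 1 - y := by linarith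
  have hb'p : 0 ≤ b' := le_trans (mul_nonneg hbp.le hy1) hge
  have e1 : w' ≤ w - κ * b * δ + L * (b ^ 2 * (r + b)) := by
    have h5 := mul_le_mul_of_nonneg_right hLb (mul_nonneg hbp.le hδ)
    linarith
  have e2 : w' ≤ (1 - κ * b / 2) * w + (L + κ * L / 2) * (b ^ 2 * (r + b)) := by
    have h5 := mul_le_mul_of_nonneg_left hwδ (show 0 ≤ κ * b / 2 by positivity)
    have h6 := mul_le_of_le_one_left (show 0 ≤ κ * L / 2 * (b ^ 2 * (r + b)) by positivity) hb1
    linarith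
  have e3 : w' ≤ (1 - κ * b / 2) * (K * (b * (r + b))) + κ * K / 4 * (b ^ 2 * (r + b)) := by
    have h5 := mul_le_mul_of_nonneg_left hw (show 0 ≤ 1 - κ * b / 2 by linarith)
    have h6 := mul_le_mul_of_nonneg_right hKL hX
    linarith
  have e5 : (r + b) * (1 - y) ≤ r + b' := by
    have := mul_nonneg hr hy0.le
    linarith
  have e6 : b * (r + b) * (1 - κ * b / 4) ≤ b' * (r + b') := by
    calc b * (r + b) * (1 - κ * b / 4) ≤ b * (r + b) * ((1 - y) * (1 - y)) := by
          refine mul_le_mul_of_nonneg_left ?_ (by positivity)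
          nlinarith [sq_nonneg y]
      _ = (b * (1 - y)) * ((r + b) * (1 - y)) := by ring
      _ ≤ b' * (r + b') := by gcongr
  have e7 := mul_le_mul_of_nonneg_left e6 hK
  linarith

/-- Solution of the recursion that a Lyapunov function of stochastic approximation satisfies. -/
theorem lyapunov_recursion (hβ₀ : 0 < β) (hβ₁ : β < 1) {κ L : ℝ} (hκ : 0 < κ) (hL : 0 ≤ L) :
    ∃ K > 0, ∀ r : ℝ, 0 ≤ r → r ≤ 1 → ∀ δ w : ℕ → ℝ, (∀ t, 0 ≤ δ t) → δ 0 ≤ L →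
      (∀ t, δ (t + 1) ≤ L * δ t + L) →
      (∀ t, w (t + 1) ≤ w t - 2 * κ * stepSize β t * δ t +
        L * stepSize β t ^ 2 * (δ t + (r + stepSize β t))) →
      (∀ t, |w t - δ t| ≤ (1 / 2 + L * stepSize β t) * δ t +
        L * stepSize β t ^ 2 * (r + stepSize β t)) →
      ∀ t, δ t ≤ K * (stepSize β t * (r + stepSize β t)) := by
  -- From `t₀` on, the step sizes satisfy the smallness conditions of `lyapunov_step`, and `w` is
  -- comparable to `δ`. Earlier times are covered by crude exponential growth, at the price of a
  -- constant.
  obtain ⟨t₀, ht₀⟩ : ∃ t₀ : ℕ, ∀ t ≥ t₀, (stepSize β t ≤ 1 / (4 * (L + 1)) ∧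
      stepSize β t ≤ κ / (L + 1)) ∧ (stepSize β t ≤ 2 / κ ∧
      1 / ((t : ℕ) + 1 : ℝ) ≤ (κ / 8) * stepSize β t) := by
    rw [← eventually_atTop]
    exact ((eventually_stepSize_le hβ₀ (by positivity)).and
      (eventually_stepSize_le hβ₀ (by positivity))).and
      ((eventually_stepSize_le hβ₀ (by positivity)).and
      (eventually_one_div_le_stepSize hβ₁ (by positivity)))
  have hs := stepSize_pos β
  have hs1 := stepSize_le_one hβ₀.le (β := β)
  set D : ℝ := (L + 1) ^ (t₀ + 1) with hD
  have hD0 : 0 < D := by positivity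
  set L' : ℝ := L + κ * L / 2 with hL'
  -- The first summand lets the drift dominate the noise in the induction step; the second makes the
  -- bound true at `t₀`.
  set K₁ : ℝ := 4 * L' / κ + (2 * D + 2 * L) / stepSize β t₀ ^ 2 with hK₁
  have hL'0 : 0 ≤ L' := by positivity
  have hK₁0 : 0 ≤ K₁ := by have := hs t₀; positivity
  refine ⟨4 * K₁ + 4 * L + D / stepSize β t₀ ^ 2, by have := hs t₀; positivity, ?_⟩
  intro r hr0 hr1 δ w hδ0 hδL hδs hw hwδ
  have hδD : ∀ t ≤ t₀, δ t ≤ D := by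
    have h1 : ∀ t, δ t ≤ (L + 1) ^ (t + 1) := by
      intro t
      induction t with
      | zero => simp; linarith
      | succ t ih =>
        have h2 : 1 ≤ (L + 1) ^ (t + 1) := one_le_pow₀ (by linarith)
        have h3 : (L + 1) ≤ (L + 1) ^ (t + 1) := le_self_pow₀ (by linarith) (by omega)
        calc δ (t + 1) ≤ L * δ t + L := hδs t
          _ ≤ L * (L + 1) ^ (t + 1) + (L + 1) ^ (t + 1) := by
            gcongr
            linarith
          _ = _ := by ring
    exact fun t ht => (h1 t).trans (pow_le_pow_right₀ (by linarith) (by omega))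
  have hb : ∀ t ≥ t₀, δ t ≤ 4 * w t + 4 * L * stepSize β t ^ 2 * (r + stepSize β t) ∧
      w t ≤ 2 * δ t + L * stepSize β t ^ 2 * (r + stepSize β t) := by
    intro t ht
    have h1 := (ht₀ t ht).1.1
    have h2 : L * stepSize β t ≤ 1 / 4 := by
      rw [le_div_iff₀ (by positivity)] at h1
      nlinarith [hs t]
    have h3 := abs_le.mp (hwδ t)
    have h4 := mul_le_mul_of_nonneg_right h2 (hδ0 t)
    have hδt := hδ0 t
    constructor <;> nlinarith [h3.1, h3.2]
  have hmain : ∀ t ≥ t₀, w t ≤ K₁ * (stepSize β t * (r + stepSize β t)) := by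
    intro t ht
    induction t, ht using Nat.le_induction with
    | base =>
      have h1 := (hb t₀ le_rfl).2
      have h2 := hδD t₀ le_rfl
      have h3 : stepSize β t₀ ^ 2 * (r + stepSize β t₀) ≤ 2 := by
        have : stepSize β t₀ ^ 2 ≤ 1 := pow_le_one₀ (hs t₀).le (hs1 t₀)
        nlinarith [hs t₀, hs1 t₀]
      have h4 := mul_le_mul_of_nonneg_left h3 hL
      calc w t₀ ≤ 2 * D + 2 * L := by linarith
        _ = (2 * D + 2 * L) / stepSize β t₀ ^ 2 * (stepSize β t₀ * stepSize β t₀) := by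
          have := (hs t₀).ne'
          field_simp
        _ ≤ K₁ * (stepSize β t₀ * (r + stepSize β t₀)) := by
          have := hs t₀
          gcongr
          · rw [hK₁]
            have : 0 ≤ 4 * L' / κ := by positivity
            linarith
          · linarith
    | succ t ht ih =>
      obtain ⟨⟨-, h2⟩, h3, h4⟩ := ht₀ t ht
      have hbp := hs t
      refine lyapunov_step hbp (hs1 t) hκ hL hr0 (hδ0 t) hK₁0 (by positivity) ?_ ?_ h4
        (stepSize_succ_ge hβ₀.le hβ₁.le t) ?_ (hw t) (hb t ht).2 ih
      · rw [le_div_iff₀ (by positivity)] at h2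
        nlinarith
      · rw [le_div_iff₀ hκ] at h3
        linarith
      · have h5 : 4 * L' / κ ≤ K₁ := by
          rw [hK₁]
          have : 0 ≤ (2 * D + 2 * L) / stepSize β t₀ ^ 2 := by have := hs t₀; positivity
          linarith
        rw [div_le_iff₀ hκ] at h5
        linarith
  intro t
  have hst := hs t
  rcases le_total t t₀ with ht | ht
  · have h1 : stepSize β t₀ ≤ stepSize β t := stepSize_anti hβ₀.le ht
    have h0 := hs t₀
    calc δ t ≤ D := hδD t ht
      _ = D / stepSize β t₀ ^ 2 * (stepSize β t₀ * stepSize β t₀) := by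
        have := h0.ne'
        field_simp
      _ ≤ D / stepSize β t₀ ^ 2 * (stepSize β t * (r + stepSize β t)) := by
        gcongr
        linarith
      _ ≤ _ := by
        refine mul_le_mul_of_nonneg_right ?_ (by positivity)
        linarith
  · have h1 := (hb t ht).1
    have h2 := hmain t ht
    have h3 : stepSize β t ^ 2 * (r + stepSize β t) ≤ stepSize β t * (r + stepSize β t) := by
      have := hs1 t
      have : 0 ≤ stepSize β t * (r + stepSize β t) := by positivity
      nlinarith
    have h4 : 0 ≤ D / stepSize β t₀ ^ 2 * (stepSize β t * (r + stepSize β t)) := by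
      have := hs t₀
      positivity
    have h5 := mul_le_mul_of_nonneg_left h3 hL
    calc δ t ≤ 4 * (K₁ * (stepSize β t * (r + stepSize β t))) +
          4 * (L * (stepSize β t * (r + stepSize β t))) := by linarith
      _ ≤ _ := by nlinarith

end StepSize

universe u w

/-! ### Linear stochastic approximation with Markov noise: the second moment. -/

section StochasticApproximation

variable {X O E : Type*} [Fintype X] [Fintype O] [NormedAddCommGroup E] [InnerProductSpace ℝ E]

/-- A linear stochastic approximation recursion `z ↦ z + b (e - A z)` driven by a Markov chain,
centered at its limit, with mean field `-U` and with the solution `v - V z` of the Poisson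
equation for the noise. -/
structure IsLinearSA (C : Sampler X O) (e : X → O → E) (A : X → O → E → E) (v : X → E)
    (V : X → E →ₗ[ℝ] E) (U : E →ₗ[ℝ] E) (κ L r : ℝ) : Prop where
  norm_A_le : ∀ x o z, ‖A x o z‖ ≤ L * ‖z‖
  norm_e_le : ∀ x o, ‖e x o‖ ≤ L
  norm_v_le : ∀ x, ‖v x‖ ≤ L
  norm_V_le : ∀ x z, ‖V x z‖ ≤ L * ‖z‖
  inner_ge : ∀ z, κ * ‖z‖ ^ 2 ≤ inner ℝ z (U z)
  poisson_eq : ∀ x z, C.mean x (fun o => (e x o - A x o z) + (v (C.next o) - V (C.next o) z)) =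
    -U z + (v x - V x z)
  variance_le : ∀ x z, C.mean x (fun o => ‖(e x o - A x o z) + (v (C.next o) - V (C.next o) z) -
    (-U z + (v x - V x z))‖ ^ 2) ≤ r * (L * (1 + ‖z‖ ^ 2))

/-- State of the averaging analysis: the centered iterate, the sum of the earlier ones, and the
remainder of the summation by parts. -/
noncomputable def saUpdate (β : ℝ) (C : Sampler X O) (e : X → O → E) (A : X → O → E → E)
    (V : X → E →ₗ[ℝ] E) (t : ℕ) (y : E × E × E) (x : X) (o : O) : E × E × E :=
  (y.1 + stepSize β t • (e x o - A x o y.1), y.2.1 + y.1,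
    y.2.2 + (((stepSize β (t + 1))⁻¹ - (stepSize β t)⁻¹) •
      (y.1 + stepSize β t • (e x o - A x o y.1)) -
      stepSize β t • V (C.next o) (e x o - A x o y.1)))

/-- Initial state of the averaging analysis. -/
def saInit (v : X → E) (V : X → E →ₗ[ℝ] E) (z₀ : E) (x : X) : E × E × E :=
  (z₀, 0, z₀ + (v x - V x z₀))

variable {C : Sampler X O} {e : X → O → E} {A : X → O → E → E} {v : X → E}
  {V : X → E →ₗ[ℝ] E} {U : E →ₗ[ℝ] E} {κ L r β : ℝ}

theorem norm_sq_add_le {E : Type*} [NormedAddCommGroup E] (x y : E) :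
    ‖x + y‖ ^ 2 ≤ 2 * ‖x‖ ^ 2 + 2 * ‖y‖ ^ 2 := by
  have h := norm_add_le x y
  have h0 := norm_nonneg (x + y)
  nlinarith [sq_nonneg (‖x‖ - ‖y‖)]

theorem norm_sq_add_le_of_pos {E : Type*} [NormedAddCommGroup E] (x y : E) {c : ℝ} (hc : 0 < c) :
    ‖x + y‖ ^ 2 ≤ (1 + c) * ‖x‖ ^ 2 + (1 + c⁻¹) * ‖y‖ ^ 2 := by
  have h := norm_add_le x y
  have h0 := norm_nonneg (x + y)
  have h1 : ‖x + y‖ ^ 2 ≤ (‖x‖ + ‖y‖) ^ 2 := pow_le_pow_left₀ h0 h 2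
  have h2 : 0 ≤ c⁻¹ * (c * ‖x‖ - ‖y‖) ^ 2 := by positivity
  have h3 : c⁻¹ * (c * ‖x‖ - ‖y‖) ^ 2 = c * ‖x‖ ^ 2 - 2 * ‖x‖ * ‖y‖ + c⁻¹ * ‖y‖ ^ 2 := by
    field_simp
    ring
  nlinarith

/-- The corrector `2 b ⟨z, v - V z⟩` is added to `‖z‖²` so that to first order only `g + (v' - V'
z)` is paired with `z`, whose conditional mean the Poisson equation supplies. The change of weight
`b - b' ≤ b²` and all other errors are quadratic in `b`. The remainder keeps `‖e‖²` and `‖v‖²`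
rather than their uniform bounds, because their expectations are of order `r + b`. -/
theorem IsLinearSA.lyapunov_pointwise (h : IsLinearSA C e A v V U κ L r) (hL : 0 ≤ L) {b b' : ℝ}
    (hb0 : 0 ≤ b) (hb1 : b ≤ 1) (hb' : b' ≤ b) (hbb : b - b' ≤ b ^ 2) (x : X) (o : O) (z : E) :
    ‖z + b • (e x o - A x o z)‖ ^ 2 + 2 * b' * inner ℝ (z + b • (e x o - A x o z))
        (v (C.next o) - V (C.next o) (z + b • (e x o - A x o z))) ≤
      ‖z‖ ^ 2 + 2 * b * inner ℝ z ((e x o - A x o z) + (v (C.next o) - V (C.next o) z)) +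
        27 * (1 + L) ^ 3 * b ^ 2 * (‖z‖ ^ 2 + ‖e x o‖ ^ 2 + ‖v (C.next o)‖ ^ 2) := by
  set g := e x o - A x o z with hg
  set v' := v (C.next o) with hv'
  set V' := V (C.next o) with hV'
  set z' := z + b • g with hz'
  set n := ‖z‖ + ‖e x o‖ + ‖v'‖ with hn
  have hz0 := norm_nonneg z
  have he0 := norm_nonneg (e x o)
  have hv0 := norm_nonneg v'
  have hn0 : 0 ≤ n := by positivity
  have hzn : ‖z‖ ≤ n := by linarith
  have hg1 : ‖g‖ ≤ (1 + L) * n := by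
    have h1 := norm_sub_le (e x o) (A x o z)
    have h2 := h.norm_A_le x o z
    nlinarith
  have hz'1 : ‖z'‖ ≤ (2 + L) * n := by
    have h1 := norm_add_le z (b • g)
    rw [norm_smul, Real.norm_of_nonneg hb0] at h1
    have h2 := mul_le_of_le_one_left (norm_nonneg g) hb1
    linarith
  have hq1 : ‖v' - V' z'‖ ≤ (1 + L) ^ 2 * n := by
    have h1 := norm_sub_le v' (V' z')
    have h2 := h.norm_V_le (C.next o) z'
    have h3 := mul_le_mul_of_nonneg_left hz'1 hL
    have h4 : ‖v'‖ ≤ n := by linarith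
    calc ‖v' - V' z'‖ ≤ n + L * ((2 + L) * n) := by linarith
      _ = _ := by ring
  have hVg : ‖V' g‖ ≤ L * ((1 + L) * n) :=
    (h.norm_V_le _ g).trans (mul_le_mul_of_nonneg_left hg1 hL)
  have hbilin : inner ℝ z' (v' - V' z') =
      inner ℝ z (v' - V' z) + b * (inner ℝ g (v' - V' z') - inner ℝ z (V' g)) := by
    have e1 : v' - V' z' = (v' - V' z) - b • V' g := by
      rw [hz', map_add, map_smul]
      abel
    have e2 : inner ℝ z' (v' - V' z') =
        inner ℝ z (v' - V' z') + b * inner ℝ g (v' - V' z') := by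
      conv_lhs => rw [hz', inner_add_left, real_inner_smul_left]
    rw [e2]
    have e3 : inner ℝ z (v' - V' z') = inner ℝ z (v' - V' z) - b * inner ℝ z (V' g) := by
      rw [e1, inner_sub_right, real_inner_smul_right]
    rw [e3]
    ring
  have hsq : ‖z'‖ ^ 2 = ‖z‖ ^ 2 + 2 * b * inner ℝ z g + b ^ 2 * ‖g‖ ^ 2 := by
    rw [hz', norm_add_sq_real, real_inner_smul_right, norm_smul, Real.norm_of_nonneg hb0]
    ring
  have i1 : inner ℝ g (v' - V' z') ≤ (1 + L) ^ 3 * n ^ 2 := by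
    calc inner ℝ g (v' - V' z') ≤ ‖g‖ * ‖v' - V' z'‖ := real_inner_le_norm _ _
      _ ≤ ((1 + L) * n) * ((1 + L) ^ 2 * n) := by gcongr
      _ = _ := by ring
  have i2 : -inner ℝ z (V' g) ≤ (1 + L) ^ 2 * n ^ 2 := by
    have h1 := (abs_le.mp (abs_real_inner_le_norm z (V' g))).1
    calc -inner ℝ z (V' g) ≤ ‖z‖ * ‖V' g‖ := by linarith
      _ ≤ n * (L * ((1 + L) * n)) := by gcongr
      _ = (L * (1 + L)) * n ^ 2 := by ring
      _ ≤ (1 + L) ^ 2 * n ^ 2 := by gcongr; nlinarith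
  have i3 : -inner ℝ z' (v' - V' z') ≤ (2 + L) * (1 + L) ^ 2 * n ^ 2 := by
    have h1 := (abs_le.mp (abs_real_inner_le_norm z' (v' - V' z'))).1
    calc -inner ℝ z' (v' - V' z') ≤ ‖z'‖ * ‖v' - V' z'‖ := by linarith
      _ ≤ ((2 + L) * n) * ((1 + L) ^ 2 * n) := by gcongr
      _ = _ := by ring
  have i4 : ‖g‖ ^ 2 ≤ (1 + L) ^ 2 * n ^ 2 := by
    rw [← mul_pow]
    exact pow_le_pow_left₀ (norm_nonneg _) hg1 2
  have hn2 : n ^ 2 ≤ 3 * (‖z‖ ^ 2 + ‖e x o‖ ^ 2 + ‖v'‖ ^ 2) := by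
    rw [hn]
    nlinarith [sq_nonneg (‖z‖ - ‖e x o‖), sq_nonneg (‖z‖ - ‖v'‖), sq_nonneg (‖e x o‖ - ‖v'‖)]
  have i5 : (b - b') * (-inner ℝ z' (v' - V' z')) ≤ b ^ 2 * ((2 + L) * (1 + L) ^ 2 * n ^ 2) :=
    (mul_le_mul_of_nonneg_left i3 (by linarith)).trans
      (mul_le_mul_of_nonneg_right hbb (by positivity))
  have e0 : ‖z'‖ ^ 2 + 2 * b' * inner ℝ z' (v' - V' z') =
      ‖z‖ ^ 2 + 2 * b * inner ℝ z (g + (v' - V' z)) + b ^ 2 * ‖g‖ ^ 2 +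
      2 * ((b - b') * (-inner ℝ z' (v' - V' z'))) +
      2 * b ^ 2 * (inner ℝ g (v' - V' z') + -inner ℝ z (V' g)) := by
    rw [hsq, inner_add_right]
    linear_combination 2 * b * hbilin
  have i6 := mul_le_mul_of_nonneg_left i4 (sq_nonneg b)
  have i7 := mul_le_mul_of_nonneg_left (add_le_add i1 i2) (show 0 ≤ 2 * b ^ 2 by positivity)
  have i8 : (1 + L) ^ 2 + 2 * ((2 + L) * (1 + L) ^ 2) + 2 * ((1 + L) ^ 3 + (1 + L) ^ 2) ≤
      9 * (1 + L) ^ 3 := by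
    have : 0 ≤ (1 + L) ^ 2 * L := by positivity
    linarith
  have i9 := mul_le_mul_of_nonneg_right i8 (show 0 ≤ b ^ 2 * n ^ 2 by positivity)
  have i10 := mul_le_mul_of_nonneg_left hn2 (show 0 ≤ 9 * (1 + L) ^ 3 * b ^ 2 by positivity)
  linarith

/-- The second moment of a linear stochastic approximation recursion. -/
theorem exists_secondMoment_bound {E : Type*} [NormedAddCommGroup E] [InnerProductSpace ℝ E]
    (hβ₀ : 0 < β) (hβ₁ : β < 1) (hκ : 0 < κ) (hL : 0 ≤ L) :
    ∃ K > 0, ∀ (X : Type u) (O : Type w) [Fintype X] [Fintype O] (C : Sampler X O)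
      (e : X → O → E) (A : X → O → E → E) (v : X → E) (V : X → E →ₗ[ℝ] E) (U : E →ₗ[ℝ] E) (r : ℝ)
      (z₀ : E), 0 ≤ r → r ≤ 1 → ‖z₀‖ ≤ L → IsLinearSA C e A v V U κ L r →
      (∀ t, C.ex (saInit v V z₀) (saUpdate β C e A V) t (fun _ x => C.mean x fun o => ‖e x o‖ ^ 2) ≤
        L * (r + stepSize β t)) →
      (∀ t, C.ex (saInit v V z₀) (saUpdate β C e A V) t (fun _ x => ‖v x‖ ^ 2) ≤
        L * (r + stepSize β t)) →
      ∀ t, C.ex (saInit v V z₀) (saUpdate β C e A V) t (fun y _ => ‖y.1‖ ^ 2) ≤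
        K * (stepSize β t * (r + stepSize β t)) := by
  have hL'0 : 0 ≤ L ^ 2 + 2 * (1 + L) ^ 2 + 27 * (1 + L) ^ 3 * (1 + 2 * L) + 2 * L := by positivity
  obtain ⟨K, hK, hrec⟩ := lyapunov_recursion hβ₀ hβ₁ hκ hL'0
  -- The summands cover, in turn, the initial value, the growth in one step, the quadratic remainder
  -- of the Lyapunov estimate and the corrector.
  set L' : ℝ := L ^ 2 + 2 * (1 + L) ^ 2 + 27 * (1 + L) ^ 3 * (1 + 2 * L) + 2 * L with hL'
  have hP1 : 0 ≤ 2 * (1 + L) ^ 2 := by positivity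
  have hP2 : 0 ≤ 27 * (1 + L) ^ 3 := by positivity
  have hP3 : 0 ≤ 27 * (1 + L) ^ 3 * (2 * L) := by positivity
  refine ⟨K, hK, ?_⟩
  intro X O _ _ C e A v V U r z₀ hr0 hr1 hz₀ h he hv
  set ex := C.ex (saInit v V z₀) (saUpdate β C e A V) with hex
  have hb := stepSize_pos β
  have hb1 := stepSize_le_one hβ₀.le (β := β)
  refine hrec r hr0 hr1 (fun t => ex t fun y _ => ‖y.1‖ ^ 2)
    (fun t => ex t fun y x => ‖y.1‖ ^ 2 + 2 * stepSize β t * inner ℝ y.1 (v x - V x y.1))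
    (fun t => C.ex_nonneg _ _ t fun _ _ => by positivity) ?_ ?_ ?_ ?_
  · have e1 : ex 0 (fun y _ => ‖y.1‖ ^ 2) = ‖z₀‖ ^ 2 := by
      simp only [hex, Sampler.ex, saInit]
      rw [← Finset.sum_mul, C.init_sum, one_mul]
    have h2 : ‖z₀‖ ^ 2 ≤ L ^ 2 := pow_le_pow_left₀ (norm_nonneg _) hz₀ 2
    simp only [e1]
    linarith
  · intro t
    have h1 : ∀ (y : E × E × E) (x : X), C.mean x (fun o =>
        ‖(saUpdate β C e A V t y x o).1‖ ^ 2) ≤ 2 * (1 + L) ^ 2 * ‖y.1‖ ^ 2 + 2 * L ^ 2 := by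
      intro y x
      refine (C.mean_mono x (g := fun _ => 2 * (1 + L) ^ 2 * ‖y.1‖ ^ 2 + 2 * L ^ 2) ?_).trans_eq
        (C.mean_const x _)
      intro o
      have hn : ‖(saUpdate β C e A V t y x o).1‖ ≤ (1 + L) * ‖y.1‖ + L := by
        simp only [saUpdate]
        have h2 := norm_add_le y.1 (stepSize β t • (e x o - A x o y.1))
        rw [norm_smul, Real.norm_of_nonneg (hb t).le] at h2
        have h3 := mul_le_of_le_one_left (norm_nonneg (e x o - A x o y.1)) (hb1 t)
        have h4 := norm_sub_le (e x o) (A x o y.1)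
        linarith [h.norm_A_le x o y.1, h.norm_e_le x o]
      have h5 := pow_le_pow_left₀ (norm_nonneg _) hn 2
      linarith [sq_nonneg ((1 + L) * ‖y.1‖ - L)]
    have h2 := C.ex_mono (saInit v V z₀) (saUpdate β C e A V) t h1
    rw [C.ex_add, C.ex_mul, C.ex_const] at h2
    have h3 : 0 ≤ ex t fun y _ => ‖y.1‖ ^ 2 := C.ex_nonneg _ _ t fun _ _ => by positivity
    have h4 : 2 * (1 + L) ^ 2 ≤ L' := by linarith [sq_nonneg L]
    have h5 : 2 * L ^ 2 ≤ L' := by linarith [sq_nonneg L]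
    exact h2.trans (add_le_add (mul_le_mul_of_nonneg_right h4 h3) h5)
  · intro t
    set b := stepSize β t with hbdef
    set b' := stepSize β (t + 1) with hb'def
    have hpt : ∀ (y : E × E × E) (x : X), C.mean x (fun o =>
        ‖(saUpdate β C e A V t y x o).1‖ ^ 2 + 2 * b' *
          inner ℝ (saUpdate β C e A V t y x o).1 (v (C.next o) -
            V (C.next o) (saUpdate β C e A V t y x o).1)) ≤
        (((‖y.1‖ ^ 2 + 2 * b * inner ℝ y.1 (v x - V x y.1)) - 2 * κ * b * ‖y.1‖ ^ 2) +
          27 * (1 + L) ^ 3 * b ^ 2 * (‖y.1‖ ^ 2 + (C.mean x (fun o => ‖e x o‖ ^ 2) +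
            C.mean x (fun o => ‖v (C.next o)‖ ^ 2)))) := by
      intro y x
      refine (C.mean_mono x fun o => h.lyapunov_pointwise hL (hb t).le (hb1 t)
        (stepSize_anti hβ₀.le (Nat.le_succ t)) (stepSize_sub_succ_le hβ₀.le hβ₁.le t)
        x o y.1).trans ?_
      -- By the Poisson equation the mean of the first-order term is the old corrector minus `2 b
      -- ⟨z, U z⟩`, and coercivity of `U` gives the drift.
      rw [C.mean_add, C.mean_add, C.mean_const, C.mean_mul, C.mean_inner, C.mean_mul, h.poisson_eq,
        C.mean_add, C.mean_add, C.mean_const, inner_add_right, inner_neg_right]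
      have h6 := mul_le_mul_of_nonneg_left (h.inner_ge y.1) (show 0 ≤ 2 * b by
        have := hb t; positivity)
      linarith
    have h2 := C.ex_mono (saInit v V z₀) (saUpdate β C e A V) t hpt
    rw [C.ex_add, C.ex_sub, C.ex_mul _ _ _ (2 * κ * b), C.ex_mul _ _ _ (27 * (1 + L) ^ 3 * b ^ 2),
      C.ex_add _ _ _ (fun (y : E × E × E) _ => ‖y.1‖ ^ 2) (fun _ x =>
        C.mean x (fun o => ‖e x o‖ ^ 2) + C.mean x fun o => ‖v (C.next o)‖ ^ 2),
      C.ex_add _ _ _ (fun _ x => C.mean x fun o => ‖e x o‖ ^ 2)] at h2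
    have h3 := he t
    have h4 := hv (t + 1)
    rw [hex, Sampler.ex_succ] at h4
    have h5 : b' ≤ b := stepSize_anti hβ₀.le (Nat.le_succ t)
    have hbp := hb t
    have hδ : 0 ≤ ex t fun y _ => ‖y.1‖ ^ 2 := C.ex_nonneg _ _ t fun _ _ => by positivity
    have h4' : C.ex (saInit v V z₀) (saUpdate β C e A V) t
        (fun _ x => C.mean x fun o => ‖v (C.next o)‖ ^ 2) ≤ L * (r + b) :=
      h4.trans (mul_le_mul_of_nonneg_left (by linarith) hL)
    have h6 : 27 * (1 + L) ^ 3 * b ^ 2 * ((ex t fun y _ => ‖y.1‖ ^ 2) +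
        ((C.ex (saInit v V z₀) (saUpdate β C e A V) t fun _ x => C.mean x fun o => ‖e x o‖ ^ 2) +
        C.ex (saInit v V z₀) (saUpdate β C e A V) t
          fun _ x => C.mean x fun o => ‖v (C.next o)‖ ^ 2)) ≤
        27 * (1 + L) ^ 3 * b ^ 2 * ((1 + 2 * L) * ((ex t fun y _ => ‖y.1‖ ^ 2) + (r + b))) := by
      refine mul_le_mul_of_nonneg_left ?_ (by positivity)
      have : 0 ≤ 2 * L * (ex t fun y _ => ‖y.1‖ ^ 2) := by positivity
      linarith
    have h7 : 27 * (1 + L) ^ 3 * b ^ 2 * ((1 + 2 * L) *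
        ((ex t fun y _ => ‖y.1‖ ^ 2) + (r + b))) ≤
        L' * b ^ 2 * ((ex t fun y _ => ‖y.1‖ ^ 2) + (r + b)) := by
      have e1 : 27 * (1 + L) ^ 3 * b ^ 2 * ((1 + 2 * L) *
        ((ex t fun y _ => ‖y.1‖ ^ 2) + (r + b))) = 27 * (1 + L) ^ 3 * (1 + 2 * L) *
        (b ^ 2 * ((ex t fun y _ => ‖y.1‖ ^ 2) + (r + b))) := by ring
      rw [e1, mul_assoc L']
      refine mul_le_mul_of_nonneg_right ?_ (by positivity)
      linarith [sq_nonneg L]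
    exact h2.trans (add_le_add le_rfl (h6.trans h7))
  · intro t
    set b := stepSize β t with hbdef
    have hbp := hb t
    rw [← C.ex_sub]
    -- Young's inequality with the coefficient `1 / 2` on `‖y.1‖²`, so that the corrected function
    -- remains comparable to the second moment once `b` is small.
    have hpt : ∀ (y : E × E × E) (x : X), |2 * b * inner ℝ y.1 (v x - V x y.1)| ≤
        (1 / 2 + 2 * L * b) * ‖y.1‖ ^ 2 + 2 * b ^ 2 * ‖v x‖ ^ 2 := by
      intro y x
      rw [abs_mul, abs_of_nonneg (show 0 ≤ 2 * b by positivity)]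
      have h1 : |inner ℝ y.1 (v x - V x y.1)| ≤ ‖y.1‖ * (‖v x‖ + L * ‖y.1‖) := by
        refine (abs_real_inner_le_norm _ _).trans ?_
        have h2 := norm_sub_le (v x) (V x y.1)
        have h3 := h.norm_V_le x y.1
        gcongr
        linarith
      have h2 := mul_le_mul_of_nonneg_left h1 (show 0 ≤ 2 * b by positivity)
      linarith [sq_nonneg (‖y.1‖ - 2 * (b * ‖v x‖))]
    have hle : ex t (fun y x => (1 / 2 + 2 * L * b) * ‖y.1‖ ^ 2 + 2 * b ^ 2 * ‖v x‖ ^ 2) ≤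
        (1 / 2 + L' * b) * (ex t fun y _ => ‖y.1‖ ^ 2) + L' * b ^ 2 * (r + b) := by
      rw [hex, C.ex_add, C.ex_mul, C.ex_mul]
      have hδ : 0 ≤ ex t fun y _ => ‖y.1‖ ^ 2 := C.ex_nonneg _ _ t fun _ _ => by positivity
      have h1 := mul_le_mul_of_nonneg_left (hv t) (show 0 ≤ 2 * b ^ 2 by positivity)
      have h2 : 2 * L ≤ L' := by linarith [sq_nonneg L]
      refine add_le_add (mul_le_mul_of_nonneg_right ?_ hδ) (h1.trans ?_)
      · gcongr
      · calc 2 * b ^ 2 * (L * (r + b)) = (2 * L) * (b ^ 2 * (r + b)) := by ring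
          _ ≤ L' * (b ^ 2 * (r + b)) := by
            have := hb t
            gcongr
          _ = _ := by ring
    rw [abs_le]
    constructor
    · rw [neg_le, neg_eq_neg_one_mul, ← C.ex_mul]
      refine (C.ex_mono _ _ t fun y x => ?_).trans hle
      linarith [(abs_le.mp (hpt y x)).1]
    · refine (C.ex_mono _ _ t fun y x => ?_).trans hle
      linarith [(abs_le.mp (hpt y x)).2]

end StochasticApproximation

/-! ### Polyak-Ruppert averaging by summation by parts. -/

section Averaging

variable {X O E : Type*} [Fintype X] [Fintype O] [NormedAddCommGroup E] [InnerProductSpace ℝ E]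
  {C : Sampler X O} {e : X → O → E} {A : X → O → E → E} {v : X → E}
  {V : X → E →ₗ[ℝ] E} {U : E →ₗ[ℝ] E} {κ L r β : ℝ}

/-- The martingale part of the sum of the iterates. -/
noncomputable def saMart (β : ℝ) (v : X → E) (V : X → E →ₗ[ℝ] E) (U : E →ₗ[ℝ] E) (t : ℕ)
    (y : E × E × E) (x : X) : E :=
  U y.2.1 - y.2.2 + (stepSize β t)⁻¹ • y.1 + (v x - V x y.1)

/-- The remainder `y.2.2` is designed for this identity: it collects the increments of `1/b_t`
multiplying the iterate and the part of the corrector due to the motion of the iterate. What is left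
is the noise plus corrector minus its conditional mean, a martingale difference. -/
theorem saMart_update (t : ℕ) (y : E × E × E) (x : X) (o : O) :
    saMart β v V U (t + 1) (saUpdate β C e A V t y x o) (C.next o) =
      saMart β v V U t y x + ((e x o - A x o y.1) + (v (C.next o) - V (C.next o) y.1) -
        (-U y.1 + (v x - V x y.1))) := by
  have hb := (stepSize_pos β t).ne'
  simp only [saMart, saUpdate]
  generalize e x o - A x o y.1 = g
  have h1 : (stepSize β t)⁻¹ • (y.1 + stepSize β t • g) = (stepSize β t)⁻¹ • y.1 + g := by
    rw [smul_add, smul_smul, inv_mul_cancel₀ hb, one_smul]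
  rw [sub_smul, h1, map_add, map_add, map_smul]
  abel

/-- Orthogonality of martingale increments: the cross term vanishes by the Poisson equation, so the
conditional variances, each of order `r`, simply add up. -/
theorem IsLinearSA.ex_saMart_le (h : IsLinearSA C e A v V U κ L r) (z₀ : E) {B : ℝ}
    (hδ : ∀ t, C.ex (saInit v V z₀) (saUpdate β C e A V) t (fun y _ => ‖y.1‖ ^ 2) ≤ B)
    (hr : 0 ≤ r) (hL : 0 ≤ L) (T : ℕ) :
    C.ex (saInit v V z₀) (saUpdate β C e A V) T (fun y x => ‖saMart β v V U T y x‖ ^ 2) ≤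
      r * (L * (1 + B)) * T := by
  induction T with
  -- The remainder starts at `z₀ + (v - V z₀)` precisely so that the martingale starts at zero, the
  -- first step size being `1`.
  | zero => simp [Sampler.ex, saMart, saInit, stepSize_zero]
  | succ T ih =>
    have hpt : ∀ (y : E × E × E) (x : X), C.mean x (fun o =>
        ‖saMart β v V U (T + 1) (saUpdate β C e A V T y x o) (C.next o)‖ ^ 2) ≤
        ‖saMart β v V U T y x‖ ^ 2 + r * L * (1 + ‖y.1‖ ^ 2) := by
      intro y x
      simp only [saMart_update, norm_add_sq_real (saMart β v V U T y x)]
      rw [C.mean_add, C.mean_add, C.mean_const, C.mean_mul, C.mean_inner, C.mean_sub, C.mean_const,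
        h.poisson_eq, sub_self, inner_zero_right, mul_zero, add_zero]
      have := h.variance_le x y.1
      linarith
    rw [C.ex_succ]
    refine (C.ex_mono _ _ T hpt).trans ?_
    rw [C.ex_add, C.ex_mul, C.ex_add, C.ex_const]
    have h1 := mul_le_mul_of_nonneg_left (hδ T) (mul_nonneg hr hL)
    push_cast
    linarith

/-- The two quantities are the orders of the second moments of the two pieces of a remainder
increment. With `d` the increment of `1/b`, one has `d b ≤ 1/(t+1)`, hence `d² b ≤ (t+1)^(β-2)`; the
weight is a sum of square roots of such bounds. -/
theorem summationByParts_weight_le (hβ₀ : 0 < β) (hβ₁ : β < 1) (hr0 : 0 ≤ r) (T : ℕ) :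
    stepSize β T ^ 2 ≤ (Real.sqrt r * ((T : ℝ) + 1) ^ (β / 2 - 1) + stepSize β T) ^ 2 ∧
    ((stepSize β (T + 1))⁻¹ - (stepSize β T)⁻¹) ^ 2 * (stepSize β T * (r + stepSize β T)) ≤
      (Real.sqrt r * ((T : ℝ) + 1) ^ (β / 2 - 1) + stepSize β T) ^ 2 := by
  have hbT := stepSize_pos β T
  set d : ℝ := (stepSize β (T + 1))⁻¹ - (stepSize β T)⁻¹ with hd
  have hb' : stepSize β (T + 1) ≤ stepSize β T := stepSize_anti hβ₀.le (Nat.le_succ T)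
  have hd0 : 0 ≤ d := sub_nonneg.mpr (inv_anti₀ (stepSize_pos β (T + 1)) hb')
  have hd1 : d * stepSize β T ≤ 1 / ((T : ℝ) + 1) := by
    have h1 := mul_le_mul_of_nonneg_right (inv_stepSize_succ_le hβ₀.le hβ₁.le T) hbT.le
    refine h1.trans_eq ?_
    field_simp
  have hsq : ((Real.sqrt r * ((T : ℝ) + 1) ^ (β / 2 - 1)) ^ 2) = r * ((T : ℝ) + 1) ^ (β - 2) := by
    rw [mul_pow, Real.sq_sqrt hr0, ← Real.rpow_natCast (((T : ℝ) + 1) ^ (β / 2 - 1)) 2,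
      ← Real.rpow_mul (by positivity)]
    congr 2
    push_cast
    ring
  have hT : (0 : ℝ) < (T : ℝ) + 1 := by positivity
  have h4 : d ^ 2 * stepSize β T ≤ ((T : ℝ) + 1) ^ (β - 2) := by
    have e1 : ((T : ℝ) + 1) ^ (β - 2) = (1 / ((T : ℝ) + 1)) ^ 2 * (stepSize β T)⁻¹ := by
      rw [inv_stepSize, Real.rpow_sub hT, Real.rpow_two]
      field_simp
    rw [e1, le_mul_inv_iff₀ hbT]
    calc d ^ 2 * stepSize β T * stepSize β T = (d * stepSize β T) ^ 2 := by ring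
      _ ≤ _ := pow_le_pow_left₀ (by positivity) hd1 2
  have h5 : d ^ 2 * stepSize β T ^ 2 ≤ stepSize β T ^ 2 := by
    rw [← mul_pow]
    exact pow_le_pow_left₀ (by positivity) (hd1.trans (one_div_le_stepSize hβ₁.le T)) 2
  have hpos : 0 ≤ r * ((T : ℝ) + 1) ^ (β - 2) := by positivity
  have hc2 : r * ((T : ℝ) + 1) ^ (β - 2) + stepSize β T ^ 2 ≤
      (Real.sqrt r * ((T : ℝ) + 1) ^ (β / 2 - 1) + stepSize β T) ^ 2 := by
    rw [← hsq]
    have : 0 ≤ (Real.sqrt r * ((T : ℝ) + 1) ^ (β / 2 - 1)) * stepSize β T := by positivity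
    linarith
  refine ⟨by linarith, le_trans ?_ hc2⟩
  calc d ^ 2 * (stepSize β T * (r + stepSize β T))
      = r * (d ^ 2 * stepSize β T) + d ^ 2 * stepSize β T ^ 2 := by ring
    _ ≤ r * ((T : ℝ) + 1) ^ (β - 2) + stepSize β T ^ 2 := by gcongr

set_option maxHeartbeats 400000 in
/-- Bound for the remainder of the summation by parts. -/
theorem IsLinearSA.ex_remainder_le (h : IsLinearSA C e A v V U κ L r) (hβ₀ : 0 < β) (hβ₁ : β < 1)
    {z₀ : E} (hz₀ : ‖z₀‖ ≤ L) {K : ℝ} (hK : 0 < K) (hr0 : 0 ≤ r) (hr1 : r ≤ 1) (hL : 0 ≤ L)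
    (hδ : ∀ t, C.ex (saInit v V z₀) (saUpdate β C e A V) t (fun y _ => ‖y.1‖ ^ 2) ≤
      K * (stepSize β t * (r + stepSize β t))) (T : ℕ) :
    C.ex (saInit v V z₀) (saUpdate β C e A V) T (fun y _ => ‖y.2.2‖ ^ 2) ≤
      (2 * K + 4 * L ^ 4 * (1 + 2 * K) + (2 * L + L ^ 2) ^ 2) *
      (1 + ∑ t ∈ Finset.range T, (Real.sqrt r * ((t : ℝ) + 1) ^ (β / 2 - 1) +
        stepSize β t)) ^ 2 := by
  set K₂ : ℝ := 2 * K + 4 * L ^ 4 * (1 + 2 * K) + (2 * L + L ^ 2) ^ 2 with hK₂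
  have hK₂0 : 0 ≤ K₂ := by positivity
  have hb := stepSize_pos β
  have hb1 := stepSize_le_one hβ₀.le (β := β)
  set c : ℕ → ℝ := fun t => Real.sqrt r * ((t : ℝ) + 1) ^ (β / 2 - 1) + stepSize β t with hc
  have hcp : ∀ t, 0 < c t := fun t => by
    have := hb t
    simp only [hc]
    positivity
  induction T with
  | zero =>
    simp only [Finset.range_zero, Finset.sum_empty, add_zero, one_pow, mul_one]
    refine (C.ex_mono (saInit v V z₀) (saUpdate β C e A V) 0 (g := fun y _ => ‖y.2.2‖ ^ 2)
      fun _ _ => le_rfl).trans ?_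
    have hpt : ∀ x, ‖(saInit v V z₀ x).2.2‖ ^ 2 ≤ K₂ := by
      intro x
      have h1 : ‖(saInit v V z₀ x).2.2‖ ≤ 2 * L + L ^ 2 := by
        simp only [saInit]
        have h2 := norm_add_le z₀ (v x - V x z₀)
        have h3 := norm_sub_le (v x) (V x z₀)
        have h4 := mul_le_mul_of_nonneg_left hz₀ hL
        linarith [h.norm_V_le x z₀, h.norm_v_le x]
      have h5 := pow_le_pow_left₀ (norm_nonneg _) h1 2
      have h6 : 0 ≤ 2 * K + 4 * L ^ 4 * (1 + 2 * K) := by positivity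
      linarith
    simp only [Sampler.ex]
    calc ∑ x, C.init x * ‖(saInit v V z₀ x).2.2‖ ^ 2 ≤ ∑ x, C.init x * K₂ :=
          Finset.sum_le_sum fun x _ => mul_le_mul_of_nonneg_left (hpt x) (C.init_nonneg x)
      _ = K₂ := by rw [← Finset.sum_mul, C.init_sum, one_mul]
  | succ T ih =>
    set a : ℝ := 1 + ∑ t ∈ Finset.range T, c t with ha
    have hap : 0 < a := by
      have : 0 ≤ ∑ t ∈ Finset.range T, c t := Finset.sum_nonneg fun t _ => (hcp t).le
      linarith
    set d : ℝ := (stepSize β (T + 1))⁻¹ - (stepSize β T)⁻¹ with hd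
    have hb' : stepSize β (T + 1) ≤ stepSize β T := stepSize_anti hβ₀.le (Nat.le_succ T)
    have hd0 : 0 ≤ d := sub_nonneg.mpr (inv_anti₀ (hb (T + 1)) hb')
    have hpt : ∀ (y : E × E × E) (x : X), C.mean x (fun o =>
        ‖(saUpdate β C e A V T y x o).2.2‖ ^ 2) ≤
        (1 + c T / a) * ‖y.2.2‖ ^ 2 + (1 + (c T / a)⁻¹) * (2 * d ^ 2 *
          (C.mean x fun o => ‖(saUpdate β C e A V T y x o).1‖ ^ 2) +

            4 * L ^ 4 * stepSize β T ^ 2 * (1 + ‖y.1‖ ^ 2)) := by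
      intro y x
      have hpo : ∀ o, ‖(saUpdate β C e A V T y x o).2.2‖ ^ 2 ≤
          (1 + c T / a) * ‖y.2.2‖ ^ 2 + (1 + (c T / a)⁻¹) * (2 * d ^ 2 *
          ‖(saUpdate β C e A V T y x o).1‖ ^ 2 +
            4 * L ^ 4 * stepSize β T ^ 2 * (1 + ‖y.1‖ ^ 2)) := by
        intro o
        have hcT := hcp T
        -- Minkowski's inequality in `L²` without square roots: with `a` the accumulated weight and
        -- `c` the new one, Young's inequality with parameter `c / a` turns `k a²` and `k c²` into
        -- exactly `k (a + c)²`.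
        refine (norm_sq_add_le_of_pos _ _ (div_pos hcT hap)).trans ?_
        refine add_le_add le_rfl (mul_le_mul_of_nonneg_left ?_ (by positivity))
        rw [sub_eq_add_neg]
        refine (norm_sq_add_le _ _).trans ?_
        rw [norm_neg, norm_smul, norm_smul, mul_pow, mul_pow, Real.norm_of_nonneg hd0,
          Real.norm_of_nonneg (hb T).le]
        have h1 : ‖V (C.next o) (e x o - A x o y.1)‖ ≤ L * (L * (1 + ‖y.1‖)) := by
          refine (h.norm_V_le _ _).trans (mul_le_mul_of_nonneg_left ?_ hL)
          linarith [norm_sub_le (e x o) (A x o y.1), h.norm_A_le x o y.1, h.norm_e_le x o]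
        have h2 := pow_le_pow_left₀ (norm_nonneg _) h1 2
        have h3 : (L * (L * (1 + ‖y.1‖))) ^ 2 ≤ 2 * L ^ 4 * (1 + ‖y.1‖ ^ 2) := by
          have : 0 ≤ L ^ 4 * (1 - ‖y.1‖) ^ 2 := by positivity
          linarith
        have h4 := mul_le_mul_of_nonneg_left (h2.trans h3)
          (show 0 ≤ 2 * stepSize β T ^ 2 by positivity)
        simp only [saUpdate]
        linarith
      refine (C.mean_mono x hpo).trans_eq ?_
      rw [C.mean_add, C.mean_const, C.mean_mul, C.mean_add, C.mean_mul, C.mean_const]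
    have h1 := C.ex_mono (saInit v V z₀) (saUpdate β C e A V) T hpt
    rw [C.ex_add, C.ex_mul, C.ex_mul, C.ex_add, C.ex_mul _ _ _ (2 * d ^ 2),
      C.ex_mul _ _ _ (4 * L ^ 4 * stepSize β T ^ 2), C.ex_add, C.ex_const] at h1
    have h2 := hδ (T + 1)
    rw [C.ex_succ] at h2
    rw [C.ex_succ, Finset.sum_range_succ]
    refine h1.trans ?_
    have hbT := hb T
    have hbT1 := hb1 T
    have h3 : K * (stepSize β (T + 1) * (r + stepSize β (T + 1))) ≤
        K * (stepSize β T * (r + stepSize β T)) := by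
      have := hb (T + 1)
      gcongr
    obtain ⟨h9, h6⟩ : stepSize β T ^ 2 ≤ c T ^ 2 ∧
        d ^ 2 * (stepSize β T * (r + stepSize β T)) ≤ c T ^ 2 :=
      summationByParts_weight_le hβ₀ hβ₁ hr0 T
    have h6 := mul_le_mul_of_nonneg_left h6 (show 0 ≤ 2 * K by positivity)
    have h7 : C.ex (saInit v V z₀) (saUpdate β C e A V) T (fun y _ => ‖y.1‖ ^ 2) ≤ 2 * K := by
      refine (hδ T).trans ?_
      have h12 : stepSize β T * (r + stepSize β T) ≤ 1 * 2 := by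
        gcongr
        linarith
      linarith [mul_le_mul_of_nonneg_left h12 hK.le]
    have hinc : 2 * d ^ 2 * (C.ex (saInit v V z₀) (saUpdate β C e A V) T fun y x =>
        C.mean x fun o => ‖(saUpdate β C e A V T y x o).1‖ ^ 2) + 4 * L ^ 4 * stepSize β T ^ 2 *
        (1 + C.ex (saInit v V z₀) (saUpdate β C e A V) T fun y _ => ‖y.1‖ ^ 2) ≤ K₂ * c T ^ 2 := by
      have h8 := mul_le_mul_of_nonneg_left (h2.trans h3) (show 0 ≤ 2 * d ^ 2 by positivity)
      have h10 : 4 * L ^ 4 * stepSize β T ^ 2 *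
          (1 + C.ex (saInit v V z₀) (saUpdate β C e A V) T fun y _ => ‖y.1‖ ^ 2) ≤
          4 * L ^ 4 * c T ^ 2 * (1 + 2 * K) := by
        have : 0 ≤ C.ex (saInit v V z₀) (saUpdate β C e A V) T fun y _ => ‖y.1‖ ^ 2 :=
          C.ex_nonneg _ _ _ fun _ _ => by positivity
        gcongr
      have h11 : 0 ≤ (2 * L + L ^ 2) ^ 2 * c T ^ 2 := by positivity
      rw [hK₂]
      linarith
    have hcT := hcp T
    refine (add_le_add (mul_le_mul_of_nonneg_left ih ?_)
      (mul_le_mul_of_nonneg_left hinc ?_)).trans_eq ?_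
    · positivity
    · positivity
    · have key : ∀ a c k : ℝ, 0 < a → 0 < c →
          (1 + c / a) * (k * a ^ 2) + (1 + (c / a)⁻¹) * (k * c ^ 2) = k * (a + c) ^ 2 := by
        intro a c k ha hc
        field_simp
        ring
      rw [← add_assoc]
      exact key a (c T) K₂ hap hcT

/-- The rate of Polyak-Ruppert averaging for a linear stochastic approximation recursion. -/
theorem exists_averaging_bound {E : Type*} [NormedAddCommGroup E] [InnerProductSpace ℝ E]
    (hβ₀ : 0 < β) (hβ₁ : β < 1) (hκ : 0 < κ) (hL : 0 ≤ L) :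
    ∃ K > 0, ∀ (X : Type u) (O : Type w) [Fintype X] [Fintype O] (C : Sampler X O)
      (e : X → O → E) (A : X → O → E → E) (v : X → E) (V : X → E →ₗ[ℝ] E) (U : E →ₗ[ℝ] E) (r : ℝ)
      (z₀ : E), 0 ≤ r → r ≤ 1 → ‖z₀‖ ≤ L → IsLinearSA C e A v V U κ L r →
      (∀ t, C.ex (saInit v V z₀) (saUpdate β C e A V) t (fun _ x => C.mean x fun o => ‖e x o‖ ^ 2) ≤
        L * (r + stepSize β t)) →
      (∀ t, C.ex (saInit v V z₀) (saUpdate β C e A V) t (fun _ x => ‖v x‖ ^ 2) ≤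
        L * (r + stepSize β t)) →
      ∀ T : ℕ, 1 ≤ T → C.ex (saInit v V z₀) (saUpdate β C e A V) T (fun y _ => ‖y.2.1‖ ^ 2) ≤
        K * (r * T + (T : ℝ) ^ (2 - 2 * β)) := by
  obtain ⟨K₁, hK₁, hsecond⟩ := exists_secondMoment_bound.{u, w} (E := E) hβ₀ hβ₁ hκ hL
  set K₂ : ℝ := 2 * K₁ + 4 * L ^ 4 * (1 + 2 * K₁) + (2 * L + L ^ 2) ^ 2 with hK₂
  have hK₂0 : 0 ≤ K₂ := by positivity
  -- The constant comes from squaring `1 + s₁ + s₂`, where `s₁ ≤ √r T^(β/2) / (β/2)` and `s₂ ≤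
  -- T^(1-β) / (1-β)`.
  set a : ℝ := 3 * (1 + 4 / β ^ 2 + 1 / (1 - β) ^ 2) with ha
  have ha0 : 0 ≤ a := by positivity
  refine ⟨4 / κ ^ 2 * (L * (1 + 2 * K₁) + K₂ * a + 2 * K₁ + 2 * L ^ 2 * (1 + 2 * K₁)) + 1,
    by positivity, ?_⟩
  intro X O _ _ C e A v V U r z₀ hr0 hr1 hz₀ h he hv T hT
  have hδ := hsecond X O C e A v V U r z₀ hr0 hr1 hz₀ h he hv
  set ex := C.ex (saInit v V z₀) (saUpdate β C e A V) with hex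
  have hb := stepSize_pos β
  have hb1 := stepSize_le_one hβ₀.le (β := β)
  have hδ2 : ∀ t, ex t (fun y _ => ‖y.1‖ ^ 2) ≤ 2 * K₁ := by
    intro t
    have h12 : stepSize β t * (r + stepSize β t) ≤ 1 * 2 := by
      have := hb t
      have := hb1 t
      gcongr
      linarith
    linarith [hδ t, mul_le_mul_of_nonneg_left h12 hK₁.le]
  have hM := h.ex_saMart_le z₀ hδ2 hr0 hL T
  have hD := h.ex_remainder_le hβ₀ hβ₁ hz₀ hK₁ hr0 hr1 hL hδ T
  rw [← hex] at hM hD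
  have hT1 : (1 : ℝ) ≤ T := by exact_mod_cast hT
  set p : ℝ := (T : ℝ) ^ (2 - 2 * β) with hp
  have hp1 : 1 ≤ p := Real.one_le_rpow hT1 (by linarith)
  have hsum : (1 + ∑ t ∈ Finset.range T,
      (Real.sqrt r * ((t : ℝ) + 1) ^ (β / 2 - 1) + stepSize β t)) ^ 2 ≤ a * (r * T + p) := by
    have h1 : ∑ t ∈ Finset.range T, stepSize β t ≤ (T : ℝ) ^ (1 - β) / (1 - β) := by
      refine le_trans (le_of_eq (Finset.sum_congr rfl fun t _ => ?_))
        (sum_rpow_le (r := 1 - β) (by linarith) (by linarith) T)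
      rw [show 1 - β - 1 = -β by ring, stepSize, Real.rpow_neg (by positivity), one_div]
    have h2 : ∑ t ∈ Finset.range T, Real.sqrt r * ((t : ℝ) + 1) ^ (β / 2 - 1) ≤
        Real.sqrt r * ((T : ℝ) ^ (β / 2) / (β / 2)) := by
      rw [← Finset.mul_sum]
      exact mul_le_mul_of_nonneg_left
        (sum_rpow_le (r := β / 2) (by linarith) (by linarith) T) (Real.sqrt_nonneg r)
    rw [Finset.sum_add_distrib]
    have h3 : (Real.sqrt r * ((T : ℝ) ^ (β / 2) / (β / 2))) ^ 2 ≤ 4 / β ^ 2 * (r * T) := by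
      have e1 : ((T : ℝ) ^ (β / 2)) ^ 2 = (T : ℝ) ^ β := by
        rw [← Real.rpow_natCast, ← Real.rpow_mul (by positivity)]
        congr 1
        push_cast
        ring
      have e2 : (T : ℝ) ^ β ≤ T := by
        calc (T : ℝ) ^ β ≤ (T : ℝ) ^ (1 : ℝ) := Real.rpow_le_rpow_of_exponent_le hT1 hβ₁.le
          _ = T := Real.rpow_one _
      rw [mul_pow, div_pow, Real.sq_sqrt hr0, e1]
      calc r * ((T : ℝ) ^ β / (β / 2) ^ 2) = 4 / β ^ 2 * (r * (T : ℝ) ^ β) := by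
            field_simp
            norm_num
        _ ≤ _ := by gcongr
    have h4 : ((T : ℝ) ^ (1 - β) / (1 - β)) ^ 2 = 1 / (1 - β) ^ 2 * p := by
      have e1 : ((T : ℝ) ^ (1 - β)) ^ 2 = p := by
        rw [← Real.rpow_natCast, ← Real.rpow_mul (by positivity), hp]
        congr 1
        push_cast
        ring
      rw [div_pow, e1]
      ring
    set s₁ := ∑ t ∈ Finset.range T, Real.sqrt r * ((t : ℝ) + 1) ^ (β / 2 - 1) with hs₁
    set s₂ := ∑ t ∈ Finset.range T, stepSize β t with hs₂
    have hs₁0 : 0 ≤ s₁ := Finset.sum_nonneg fun t _ => by positivity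
    have hs₂0 : 0 ≤ s₂ := Finset.sum_nonneg fun t _ => (hb t).le
    have h5 := (pow_le_pow_left₀ hs₁0 h2 2).trans h3
    have h6 := (pow_le_pow_left₀ hs₂0 h1 2).trans h4.le
    have h7 : (1 + (s₁ + s₂)) ^ 2 ≤ 3 * (1 + s₁ ^ 2 + s₂ ^ 2) := by
      linarith [sq_nonneg (1 - s₁), sq_nonneg (1 - s₂), sq_nonneg (s₁ - s₂)]
    have hrT : 0 ≤ r * T := by positivity
    have h8 : 0 ≤ 4 / β ^ 2 * p := by positivity
    have h9 : 0 ≤ 1 / (1 - β) ^ 2 * (r * T) := by positivity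
    rw [ha]
    linarith
  have hpt : ∀ (y : E × E × E) (x : X), ‖y.2.1‖ ^ 2 ≤ 4 / κ ^ 2 *
      (‖saMart β v V U T y x‖ ^ 2 + ‖y.2.2‖ ^ 2 + ((stepSize β T)⁻¹ ^ 2 * ‖y.1‖ ^ 2 +
        2 * L ^ 2 * (1 + ‖y.1‖ ^ 2))) := by
    intro y x
    have h1 : κ * ‖y.2.1‖ ≤ ‖U y.2.1‖ := by
      have h2 := h.inner_ge y.2.1
      have h3 := real_inner_le_norm y.2.1 (U y.2.1)
      rcases (norm_nonneg y.2.1).eq_or_lt with h0 | h0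
      · rw [← h0, mul_zero]
        exact norm_nonneg _
      · have : ‖y.2.1‖ * (κ * ‖y.2.1‖) ≤ ‖y.2.1‖ * ‖U y.2.1‖ := by linarith
        exact le_of_mul_le_mul_left this h0
    -- Solving the definition of the martingale for `U` of the sum gives four terms; coercivity lets
    -- `U` be inverted at the cost of `1/κ`.
    have h2 : U y.2.1 = (saMart β v V U T y x + y.2.2) +
        (-((stepSize β T)⁻¹ • y.1) + -(v x - V x y.1)) := by
      simp only [saMart]
      abel
    have h3 : ‖U y.2.1‖ ^ 2 ≤ 4 * (‖saMart β v V U T y x‖ ^ 2 + ‖y.2.2‖ ^ 2 +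
        ((stepSize β T)⁻¹ ^ 2 * ‖y.1‖ ^ 2 + ‖v x - V x y.1‖ ^ 2)) := by
      rw [h2]
      have i1 := norm_sq_add_le (saMart β v V U T y x + y.2.2)
        (-((stepSize β T)⁻¹ • y.1) + -(v x - V x y.1))
      have i2 := norm_sq_add_le (saMart β v V U T y x) y.2.2
      have i3 := norm_sq_add_le (-((stepSize β T)⁻¹ • y.1)) (-(v x - V x y.1))
      rw [norm_neg, norm_neg, norm_smul, mul_pow, Real.norm_of_nonneg (inv_pos.mpr (hb T)).le] at i3
      linarith
    have h4 : ‖v x - V x y.1‖ ^ 2 ≤ 2 * L ^ 2 * (1 + ‖y.1‖ ^ 2) := by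
      have i1 : ‖v x - V x y.1‖ ≤ L + L * ‖y.1‖ := by
        linarith [norm_sub_le (v x) (V x y.1), h.norm_V_le x y.1, h.norm_v_le x]
      have i2 := pow_le_pow_left₀ (norm_nonneg _) i1 2
      linarith [sq_nonneg (L - L * ‖y.1‖)]
    have h5 := pow_le_pow_left₀ (by positivity) h1 2
    rw [mul_pow] at h5
    rw [div_mul_eq_mul_div, le_div_iff₀ (by positivity)]
    linarith
  have h1 := C.ex_mono (saInit v V z₀) (saUpdate β C e A V) T hpt
  rw [← hex] at h1
  refine h1.trans ?_
  rw [hex, C.ex_mul, C.ex_add, C.ex_add, C.ex_add, C.ex_mul, C.ex_mul, C.ex_add, C.ex_const, ← hex]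
  have h2 : (stepSize β T)⁻¹ ^ 2 * (ex T fun y _ => ‖y.1‖ ^ 2) ≤ 2 * K₁ * (r * T + p) := by
    have hbT := hb T
    have h3 : (stepSize β T)⁻¹ ≤ 2 * T := by
      rw [inv_stepSize]
      calc ((T : ℝ) + 1) ^ β ≤ ((T : ℝ) + 1) ^ (1 : ℝ) :=
            Real.rpow_le_rpow_of_exponent_le (by linarith) hβ₁.le
        _ = (T : ℝ) + 1 := Real.rpow_one _
        _ ≤ 2 * T := by linarith
    calc (stepSize β T)⁻¹ ^ 2 * (ex T fun y _ => ‖y.1‖ ^ 2)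
        ≤ (stepSize β T)⁻¹ ^ 2 * (K₁ * (stepSize β T * (r + stepSize β T))) := by
          gcongr
          exact hδ T
      _ = K₁ * (r * (stepSize β T)⁻¹ + 1) := by field_simp
      _ ≤ K₁ * (r * (2 * T) + 2 * p) := by
          gcongr
          linarith
      _ = _ := by ring
  have hrT : 0 ≤ r * T := by positivity
  have h3 : 2 * L ^ 2 * (1 + ex T fun y _ => ‖y.1‖ ^ 2) ≤
      2 * L ^ 2 * (1 + 2 * K₁) * (r * T + p) := by
    have i1 : 2 * L ^ 2 * (1 + ex T fun y _ => ‖y.1‖ ^ 2) ≤ 2 * L ^ 2 * (1 + 2 * K₁) := by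
      gcongr
      exact hδ2 T
    exact i1.trans (le_mul_of_one_le_right (by positivity) (by linarith))
  have h4 : r * (L * (1 + 2 * K₁)) * T ≤ L * (1 + 2 * K₁) * (r * T + p) := by
    have : 0 ≤ L * (1 + 2 * K₁) * p := by positivity
    linarith
  have h5 := hD.trans (mul_le_mul_of_nonneg_left hsum hK₂0)
  have h6 : (ex T fun y x => ‖saMart β v V U T y x‖ ^ 2) + (ex T fun y _ => ‖y.2.2‖ ^ 2) +
      ((stepSize β T)⁻¹ ^ 2 * (ex T fun y _ => ‖y.1‖ ^ 2) +
        2 * L ^ 2 * (1 + ex T fun y _ => ‖y.1‖ ^ 2)) ≤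
      (L * (1 + 2 * K₁) + K₂ * a + 2 * K₁ + 2 * L ^ 2 * (1 + 2 * K₁)) * (r * T + p) := by
    linarith
  have h7 := mul_le_mul_of_nonneg_left h6 (show 0 ≤ 4 / κ ^ 2 by positivity)
  linarith

end Averaging

/-! ### Expectations as finite sums over outcome sequences. -/

section Paths

/-- Extension of a finite sequence by a constant. -/
def extendSeq {O : Type*} (o₀ : O) {T : ℕ} (h : Fin T → O) (t : ℕ) : O :=
  if ht : t < T then h ⟨t, ht⟩ else o₀

theorem extendSeq_snoc {O : Type*} (o₀ : O) {T : ℕ} (h : Fin T → O) (p : O) :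
    (∀ t < T, extendSeq o₀ (Fin.snoc (α := fun _ => O) h p : Fin (T + 1) → O) t =
      extendSeq o₀ h t) ∧
    extendSeq o₀ (Fin.snoc (α := fun _ => O) h p : Fin (T + 1) → O) T = p := by
  constructor
  · intro t ht
    have ht' : t < T + 1 := by omega
    simp only [extendSeq, ht, ht', dif_pos]
    exact Fin.snoc_castSucc (α := fun _ => O) p h ⟨t, ht⟩
  · simp only [extendSeq, Nat.lt_succ_self, dif_pos]
    exact Fin.snoc_last (α := fun _ => O) p h

variable {X O Y : Type*} [Fintype X] [Fintype O] (C : Sampler X O)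

/-- Chain states along a sequence of outcomes. -/
def Sampler.statePath (x₀ : X) (o : ℕ → O) : ℕ → X
  | 0 => x₀
  | t + 1 => C.next (o t)

/-- Algorithm states along a sequence of outcomes. -/
def Sampler.algPath (y₀ : X → Y) (G : ℕ → Y → X → O → Y) (x₀ : X) (o : ℕ → O) : ℕ → Y
  | 0 => y₀ x₀
  | t + 1 => G t (algPath y₀ G x₀ o t) (C.statePath x₀ o t) (o t)

/-- Paths are driven by total sequences, but up to time `T` they read only the outcomes before `T`;
hence the filler value used by `extendSeq` is irrelevant. -/
theorem Sampler.statePath_congr (x₀ : X) {o o' : ℕ → O} {T : ℕ} (h : ∀ t < T, o t = o' t)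
    {t : ℕ} (ht : t ≤ T) : C.statePath x₀ o t = C.statePath x₀ o' t := by
  cases t with
  | zero => rfl
  | succ t => simp only [statePath, h t (by omega)]

theorem Sampler.algPath_congr (y₀ : X → Y) (G : ℕ → Y → X → O → Y) (x₀ : X) {o o' : ℕ → O}
    {T : ℕ} (h : ∀ t < T, o t = o' t) {t : ℕ} (ht : t ≤ T) :
    C.algPath y₀ G x₀ o t = C.algPath y₀ G x₀ o' t := by
  induction t with
  | zero => rfl
  | succ t ih =>
    simp only [algPath, ih (by omega), h t (by omega),
      C.statePath_congr x₀ h (show t ≤ T by omega)]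

/-- Expectations as sums over paths. -/
theorem Sampler.ex_eq_sum (o₀ : O) (y₀ : X → Y) (G : ℕ → Y → X → O → Y) (T : ℕ)
    (f : Y → X → ℝ) : C.ex y₀ G T f = ∑ x₀, ∑ h : Fin T → O,
      (C.init x₀ * ∏ t ∈ Finset.range T,
        C.weight (C.statePath x₀ (extendSeq o₀ h) t) (extendSeq o₀ h t)) *
      f (C.algPath y₀ G x₀ (extendSeq o₀ h) T) (C.statePath x₀ (extendSeq o₀ h) T) := by
  induction T generalizing f with
  | zero => simp [ex, algPath, statePath]
  | succ T ih =>
    rw [ex_succ, ih]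
    refine Finset.sum_congr rfl fun x₀ _ => ?_
    rw [← (Fin.snocEquiv fun _ : Fin (T + 1) => O).sum_comp, Fintype.sum_prod_type,
      Finset.sum_comm]
    refine Finset.sum_congr rfl fun h _ => ?_
    rw [mean, Finset.mul_sum]
    refine Finset.sum_congr rfl fun p _ => ?_
    obtain ⟨h1, h2⟩ := extendSeq_snoc o₀ h p
    change _ = (_ * ∏ t ∈ Finset.range (T + 1),
      C.weight (C.statePath x₀ (extendSeq o₀ (Fin.snoc (α := fun _ => O) h p)) t)
        (extendSeq o₀ (Fin.snoc (α := fun _ => O) h p) t)) * f (C.algPath y₀ G x₀ (extendSeq o₀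
        (Fin.snoc (α := fun _ => O) h p)) (T + 1)) (C.statePath x₀ (extendSeq o₀
        (Fin.snoc (α := fun _ => O) h p)) (T + 1))
    have hprod : ∏ t ∈ Finset.range T,
        C.weight (C.statePath x₀ (extendSeq o₀ (Fin.snoc (α := fun _ => O) h p)) t)
          (extendSeq o₀ (Fin.snoc (α := fun _ => O) h p) t) = ∏ t ∈ Finset.range T,
        C.weight (C.statePath x₀ (extendSeq o₀ h) t) (extendSeq o₀ h t) :=
      Finset.prod_congr rfl fun t ht => by
        rw [C.statePath_congr x₀ h1 (Finset.mem_range.mp ht).le, h1 t (Finset.mem_range.mp ht)]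
    rw [Finset.prod_range_succ, hprod, algPath, statePath, h2, C.statePath_congr x₀ h1 le_rfl,
      C.algPath_congr y₀ G x₀ h1 le_rfl,
      smul_eq_mul]
    ring

end Paths

/-! ### From integrals over the sample space to the finite calculus. -/

theorem integral_comp_fintype {Ω H : Type*} [MeasurableSpace Ω] (ℙ : Measure Ω)
    [IsProbabilityMeasure ℙ] [Fintype H] (hist : Ω → H)
    (hm : ∀ h, MeasurableSet {ω | hist ω = h}) (F : H → ℝ) :
    ∫ ω, F (hist ω) ∂ℙ = ∑ h, ℙ.real {ω | hist ω = h} * F h := by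
  -- For a finite target with the discrete σ-algebra, measurability of the fibres of `hist` is
  -- measurability.
  let _ : MeasurableSpace H := ⊤
  have hmeas : Measurable hist := measurable_to_countable' fun h => hm h
  have : IsProbabilityMeasure (ℙ.map hist) := Measure.isProbabilityMeasure_map hmeas.aemeasurable
  rw [← integral_map (f := F) hmeas.aemeasurable (Measurable.of_discrete.aestronglyMeasurable),
    integral_fintype .of_finite]
  refine Finset.sum_congr rfl fun h _ => ?_
  rw [map_measureReal_apply hmeas (MeasurableSet.singleton h), smul_eq_mul]
  rfl

section Link

variable {S A : Type*} [Fintype S] [Fintype A] {N : ℕ}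

/-- Joint one-step law of the action and of the next state of an agent. -/
def MDPs.agentWeight (M : MDPs S A N) (μ : S → stdSimplex ℝ A) (i : Fin N) (x : S)
    (p : A × S) : ℝ := μ x p.1 * M.P i x p.1 p.2

theorem MDPs.agentWeight_nonneg (M : MDPs S A N) (μ : S → stdSimplex ℝ A) (i : Fin N) (x : S)
    (p : A × S) : 0 ≤ M.agentWeight μ i x p :=
  mul_nonneg (stdSimplex.zero_le _ _) (stdSimplex.zero_le _ _)

theorem MDPs.agentWeight_sum (M : MDPs S A N) (μ : S → stdSimplex ℝ A) (i : Fin N) (x : S) :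
    ∑ p, M.agentWeight μ i x p = 1 := by
  simp only [agentWeight, Fintype.sum_prod_type, ← Finset.mul_sum, stdSimplex.sum_eq_one, mul_one]

/-- The joint chain of the agents. -/
def MDPs.sampler (M : MDPs S A N) (μ : S → stdSimplex ℝ A) (ν : stdSimplex ℝ (Fin N → S)) :
    Sampler (Fin N → S) (Fin N → A × S) where
  init := ν
  weight x o := ∏ i, M.agentWeight μ i (x i) (o i)
  next o i := (o i).2
  init_nonneg x := stdSimplex.zero_le _ _
  init_sum := stdSimplex.sum_eq_one _
  weight_nonneg x o := Finset.prod_nonneg fun i _ => M.agentWeight_nonneg μ i _ _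
  weight_sum x := by
    rw [sum_prod_pi fun i p => M.agentWeight μ i (x i) p]
    simp [M.agentWeight_sum]

/-- Up to time `T` everything is a function of the initial states and of finitely many actions and
successors. This history takes finitely many values, whose probabilities are the prescribed
finite-dimensional laws. -/
theorem IsMarkovSample.integral_eq {Ω : Type*} [MeasurableSpace Ω] {ℙ : Measure Ω}
    [IsProbabilityMeasure ℙ] {M : MDPs S A N} {μ : S → stdSimplex ℝ A}
    {ν : stdSimplex ℝ (Fin N → S)} {s : ℕ → Fin N → Ω → S} {a : ℕ → Fin N → Ω → A}
    (h : IsMarkovSample ℙ M μ ν s a) {Y : Type*} (y₀ : (Fin N → S) → Y)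
    (G : ℕ → Y → (Fin N → S) → (Fin N → A × S) → Y) (y : ℕ → Ω → Y)
    (hy₀ : ∀ ω, y 0 ω = y₀ fun i => s 0 i ω)
    (hy : ∀ t ω, y (t + 1) ω = G t (y t ω) (fun i => s t i ω) fun i => (a t i ω, s (t + 1) i ω))
    (f : Y → (Fin N → S) → ℝ) (T : ℕ) :
    ∫ ω, f (y T ω) (fun i => s T i ω) ∂ℙ = (M.sampler μ ν).ex y₀ G T f := by
  have hΩ : Nonempty Ω := by
    by_contra hcon
    rw [not_nonempty_iff] at hcon
    have h1 : ℙ Set.univ = 1 := measure_univ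
    rw [Set.univ_eq_empty_iff.mpr hcon, measure_empty] at h1
    exact zero_ne_one h1
  obtain ⟨ω₀⟩ := hΩ
  set C := M.sampler μ ν with hC
  set o₀ : Fin N → A × S := fun i => (a 0 i ω₀, s 0 i ω₀) with ho₀
  set hist : Ω → (Fin N → S) × (Fin T → Fin N → A × S) := fun ω =>
    (fun i => s 0 i ω, fun t i => (a t i ω, s (t + 1) i ω)) with hhist
  set F : (Fin N → S) × (Fin T → Fin N → A × S) → ℝ := fun p =>
    f (C.algPath y₀ G p.1 (extendSeq o₀ p.2) T) (C.statePath p.1 (extendSeq o₀ p.2) T) with hF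
  have hseq : ∀ ω, ∀ t < T, extendSeq o₀ (hist ω).2 t = fun i => (a t i ω, s (t + 1) i ω) := by
    intro ω t ht
    simp [extendSeq, ht, hhist]
  have hstate : ∀ ω, ∀ t ≤ T, C.statePath (hist ω).1 (extendSeq o₀ (hist ω).2) t =
      fun i => s t i ω := by
    intro ω t ht
    cases t with
    | zero => rfl
    | succ t =>
      simp only [Sampler.statePath, hseq ω t (by omega)]
      rfl
  have halg : ∀ ω, ∀ t ≤ T, C.algPath y₀ G (hist ω).1 (extendSeq o₀ (hist ω).2) t = y t ω := by
    intro ω t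
    induction t with
    | zero => intro _; exact (hy₀ ω).symm
    | succ t ih =>
      intro ht
      rw [Sampler.algPath, ih (by omega), hstate ω t (by omega), hseq ω t (by omega), hy]
  have hint : ∀ ω, f (y T ω) (fun i => s T i ω) = F (hist ω) := by
    intro ω
    simp only [hF]
    rw [hstate ω T le_rfl, halg ω T le_rfl]
  have hset : ∀ p : (Fin N → S) × (Fin T → Fin N → A × S), {ω | hist ω = p} =
      {ω | (∀ t ≤ T, ∀ i, s t i ω = C.statePath p.1 (extendSeq o₀ p.2) t i) ∧
        (∀ t < T, ∀ i, a t i ω = (extendSeq o₀ p.2 t i).1)} := by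
    intro p
    ext ω
    simp only [Set.mem_ofPred_eq]
    constructor
    · rintro rfl
      exact ⟨fun t ht i => by rw [hstate ω t ht], fun t ht i => by rw [hseq ω t ht]⟩
    · rintro ⟨h1, h2⟩
      refine Prod.ext (funext fun i => h1 0 (Nat.zero_le _) i) (funext fun t => funext fun i => ?_)
      have e : extendSeq o₀ p.2 t = p.2 t := by simp [extendSeq]
      refine Prod.ext ?_ ?_
      · have := h2 t t.2 i
        rwa [e] at this
      · have := h1 (t + 1) t.2 i
        rw [Sampler.statePath, e] at this
        exact this
  have hmeas : ∀ p, MeasurableSet {ω | hist ω = p} := by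
    intro p
    rw [hset]
    refine MeasurableSet.inter ?_ ?_
    · have : {ω | ∀ t ≤ T, ∀ i, s t i ω = C.statePath p.1 (extendSeq o₀ p.2) t i} =
          ⋂ t, ⋂ (_ : t ≤ T), ⋂ i, {ω | s t i ω = C.statePath p.1 (extendSeq o₀ p.2) t i} := by
        ext ω; simp
      change MeasurableSet {ω | ∀ t ≤ T, ∀ i, s t i ω = C.statePath p.1 (extendSeq o₀ p.2) t i}
      rw [this]
      exact MeasurableSet.iInter fun t => MeasurableSet.iInter fun _ => MeasurableSet.iInter
        fun i => h.measurable_state t i _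
    · have : {ω | ∀ t < T, ∀ i, a t i ω = (extendSeq o₀ p.2 t i).1} =
          ⋂ t, ⋂ (_ : t < T), ⋂ i, {ω | a t i ω = (extendSeq o₀ p.2 t i).1} := by
        ext ω; simp
      change MeasurableSet {ω | ∀ t < T, ∀ i, a t i ω = (extendSeq o₀ p.2 t i).1}
      rw [this]
      exact MeasurableSet.iInter fun t => MeasurableSet.iInter fun _ => MeasurableSet.iInter
        fun i => h.measurable_action t i _
  simp_rw [hint]
  rw [integral_comp_fintype ℙ hist hmeas F, C.ex_eq_sum o₀, Fintype.sum_prod_type]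
  refine Finset.sum_congr rfl fun x₀ _ => Finset.sum_congr rfl fun p _ => ?_
  rw [hset, h.law T (C.statePath x₀ (extendSeq o₀ p)) fun t i => (extendSeq o₀ p t i).1]
  rfl

end Link

/-! ### The TD error of one agent and its stationary mean. -/

section Agents

variable {S A : Type*} {N d : ℕ} {Φ : Matrix S (Fin d) ℝ} {γ : ℝ}

/-- The linear part of the negative TD error. -/
noncomputable def tdLinear (Φ : Matrix S (Fin d) ℝ) (γ : ℝ) (x : S) (p : A × S)
    (z : EuclideanSpace ℝ (Fin d)) : EuclideanSpace ℝ (Fin d) :=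
  (inner ℝ (feature Φ x) z - γ * inner ℝ (feature Φ p.2) z) • feature Φ x

theorem tdError_add (Φ : Matrix S (Fin d) ℝ) (γ : ℝ) (R : S → A → ℝ) (x : S) (p : A × S)
    (w z : EuclideanSpace ℝ (Fin d)) :
    tdError Φ γ R x p.1 p.2 (w + z) = tdError Φ γ R x p.1 p.2 w - tdLinear Φ γ x p z := by
  simp only [tdError, tdLinear, inner_add_right, mul_add, ← add_smul, ← sub_smul]
  congr 1
  ring

theorem norm_tdLinear_le (hΦ : ∀ x, ‖feature Φ x‖ ≤ 1) (hγ₀ : 0 ≤ γ) (hγ₁ : γ ≤ 1) (x : S)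
    (p : A × S) (z : EuclideanSpace ℝ (Fin d)) : ‖tdLinear Φ γ x p z‖ ≤ 2 * ‖z‖ := by
  have h1 : ∀ y, |inner ℝ (feature Φ y) z| ≤ ‖z‖ := fun y =>
    (abs_real_inner_le_norm _ _).trans (mul_le_of_le_one_left (norm_nonneg z) (hΦ y))
  have h2 : |inner ℝ (feature Φ x) z - γ * inner ℝ (feature Φ p.2) z| ≤ 2 * ‖z‖ := by
    refine (abs_sub _ _).trans ?_
    rw [abs_mul, abs_of_nonneg hγ₀]
    linarith [h1 x, mul_le_mul hγ₁ (h1 p.2) (abs_nonneg _) zero_le_one]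
  rw [tdLinear, norm_smul, Real.norm_eq_abs]
  calc _ ≤ 2 * ‖z‖ * 1 := by
        gcongr
        exact hΦ x
    _ = _ := mul_one _

theorem norm_tdError_le (hΦ : ∀ x, ‖feature Φ x‖ ≤ 1) (hγ₀ : 0 ≤ γ) (hγ₁ : γ ≤ 1)
    {R : S → A → ℝ} {Rmax : ℝ} (hR : ∀ x a, |R x a| ≤ Rmax) (x : S) (p : A × S)
    (w : EuclideanSpace ℝ (Fin d)) : ‖tdError Φ γ R x p.1 p.2 w‖ ≤ Rmax + 2 * ‖w‖ := by
  have h0 := tdError_add Φ γ R x p 0 w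
  rw [zero_add] at h0
  rw [h0]
  refine (norm_sub_le _ _).trans (add_le_add ?_ (norm_tdLinear_le hΦ hγ₀ hγ₁ x p w))
  have h1 : tdError Φ γ R x p.1 p.2 0 = R x p.1 • feature Φ x := by simp [tdError]
  rw [h1, norm_smul, Real.norm_eq_abs]
  have h2 := hR x p.1
  calc |R x p.1| * ‖feature Φ x‖ ≤ |R x p.1| * 1 := by gcongr; exact hΦ x
    _ ≤ Rmax := by linarith

variable [Fintype S] [Fintype A]

theorem MDPs.sum_agentWeight_smul_next (M : MDPs S A N) (μ : S → stdSimplex ℝ A) (i : Fin N)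
    (x : S) {E : Type*} [NormedAddCommGroup E] [NormedSpace ℝ E] (f : S → E) :
    ∑ p, M.agentWeight μ i x p • f p.2 = act (M.Pμ μ i) f x := by
  simp only [agentWeight, act, Pμ, Matrix.of_apply, Fintype.sum_prod_type, Finset.sum_smul]
  rw [Finset.sum_comm]

theorem MDPs.Pμ_mem_rowStochastic [DecidableEq S] (M : MDPs S A N) (μ : S → stdSimplex ℝ A)
    (i : Fin N) : M.Pμ μ i ∈ Matrix.rowStochastic ℝ S := by
  rw [Matrix.mem_rowStochastic_iff_sum]
  constructor
  · intro x y
    exact Finset.sum_nonneg fun a _ => mul_nonneg (stdSimplex.zero_le _ _) (stdSimplex.zero_le _ _)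
  · intro x
    simp only [Pμ, Matrix.of_apply]
    rw [Finset.sum_comm]
    simp [← Finset.mul_sum]

theorem MDPs.sum_agentWeight_mul_reward (M : MDPs S A N) (μ : S → stdSimplex ℝ A) (i : Fin N)
    (x : S) : ∑ p, M.agentWeight μ i x p * M.R i x p.1 = M.Rμ μ i x := by
  simp only [agentWeight, Rμ, Fintype.sum_prod_type]
  refine Finset.sum_congr rfl fun a _ => ?_
  have := stdSimplex.sum_eq_one (M.P i x a)
  rw [← Finset.sum_mul, ← Finset.mul_sum, this, mul_one]

theorem MDPs.abs_Rμ_le (M : MDPs S A N) (μ : S → stdSimplex ℝ A) {Rmax : ℝ}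
    (hR : M.RewardBound Rmax) (i : Fin N) (x : S) : |M.Rμ μ i x| ≤ Rmax := by
  calc |M.Rμ μ i x| ≤ ∑ a, |μ x a * M.R i x a| := Finset.abs_sum_le_sum_abs _ _
    _ ≤ ∑ a, μ x a * Rmax := by
      refine Finset.sum_le_sum fun a _ => ?_
      rw [abs_mul, abs_of_nonneg (stdSimplex.zero_le _ _)]
      exact mul_le_mul_of_nonneg_left (hR i x a) (stdSimplex.zero_le _ _)
    _ = Rmax := by rw [← Finset.sum_mul, stdSimplex.sum_eq_one, one_mul]

theorem MDPs.sum_agentWeight_smul_tdLinear (M : MDPs S A N) (μ : S → stdSimplex ℝ A)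
    (i : Fin N) (x : S) (z : EuclideanSpace ℝ (Fin d)) :
    ∑ p, M.agentWeight μ i x p • tdLinear Φ γ x p z = (inner ℝ (feature Φ x) z -
        γ * ∑ y, M.Pμ μ i x y * inner ℝ (feature Φ y) z) • feature Φ x := by
  have h := M.sum_agentWeight_smul_next μ i x fun y => inner ℝ (feature Φ y) z
  simp only [act, smul_eq_mul] at h
  rw [← h]
  simp only [tdLinear, smul_smul]
  rw [← Finset.sum_smul]
  congr 1
  simp only [mul_sub, Finset.sum_sub_distrib]
  rw [← Finset.sum_mul, M.agentWeight_sum, one_mul, Finset.mul_sum]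
  congr 1
  exact Finset.sum_congr rfl fun p _ => by ring

theorem MDPs.sum_agentWeight_smul_tdError_zero (M : MDPs S A N) (μ : S → stdSimplex ℝ A)
    (i : Fin N) (x : S) :
    ∑ p, M.agentWeight μ i x p • tdError Φ γ (M.R i) x p.1 p.2 0 = M.Rμ μ i x • feature Φ x := by
  have h1 : ∀ p : A × S, tdError Φ γ (M.R i) x p.1 p.2 0 = M.R i x p.1 • feature Φ x := by
    intro p
    simp [tdError]
  simp only [h1, smul_smul]
  rw [← Finset.sum_smul, M.sum_agentWeight_mul_reward]

variable [DecidableEq S]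

/-- Action of `Υ_i`. -/
theorem MDPs.Ups_apply (M : MDPs S A N) (μ : S → stdSimplex ℝ A) (Φ : Matrix S (Fin d) ℝ) (γ : ℝ)
    (i : Fin N) (z : EuclideanSpace ℝ (Fin d)) :
    Matrix.toEuclideanCLM (n := Fin d) (𝕜 := ℝ) (M.Ups μ Φ γ i) z =
      ∑ x, stationaryDist (M.Pμ μ i) x • ((inner ℝ (feature Φ x) z -
        γ * ∑ y, M.Pμ μ i x y * inner ℝ (feature Φ y) z) • feature Φ x) := by
  have hin : ∀ x, inner ℝ (feature Φ x) z = (Φ *ᵥ z.ofLp) x := by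
    intro x
    simp [feature, Matrix.mulVec, dotProduct, PiLp.inner_apply, mul_comm]
  ext k
  rw [Matrix.ofLp_toEuclideanCLM]
  simp only [hin, Ups, ← Matrix.mulVec_mulVec]
  simp only [WithLp.ofLp_sum, WithLp.ofLp_smul, Finset.sum_apply, Pi.smul_apply, smul_eq_mul]
  rw [Matrix.mulVec, dotProduct]
  refine Finset.sum_congr rfl fun x _ => ?_
  rw [Matrix.transpose_apply, Matrix.mulVec_diagonal, Matrix.sub_mulVec, Matrix.one_mulVec,
    Matrix.smul_mulVec, Pi.sub_apply, Pi.smul_apply, smul_eq_mul]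
  simp only [feature, Matrix.mulVec, dotProduct]
  ring

theorem MDPs.b_eq (M : MDPs S A N) (μ : S → stdSimplex ℝ A) (Φ : Matrix S (Fin d) ℝ) (i : Fin N) :
    M.b μ Φ i = ∑ x, stationaryDist (M.Pμ μ i) x • (M.Rμ μ i x • feature Φ x) := by
  ext k
  simp only [MDPs.b, WithLp.ofLp_sum, WithLp.ofLp_smul, Finset.sum_apply, Pi.smul_apply,
    smul_eq_mul]
  rw [Matrix.mulVec, dotProduct]
  refine Finset.sum_congr rfl fun x _ => ?_
  rw [Matrix.transpose_apply, Matrix.mulVec_diagonal]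
  simp only [feature]
  ring

/-- Stationary mean of the TD error. -/
theorem MDPs.sum_stationary_tdError (M : MDPs S A N) (μ : S → stdSimplex ℝ A) (i : Fin N)
    (w : EuclideanSpace ℝ (Fin d)) :
    ∑ x, stationaryDist (M.Pμ μ i) x •
        ∑ p, M.agentWeight μ i x p • tdError Φ γ (M.R i) x p.1 p.2 w =
      M.b μ Φ i - Matrix.toEuclideanCLM (n := Fin d) (𝕜 := ℝ) (M.Ups μ Φ γ i) w := by
  have h1 : ∀ x, ∑ p, M.agentWeight μ i x p • tdError Φ γ (M.R i) x p.1 p.2 w =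
      M.Rμ μ i x • feature Φ x - (inner ℝ (feature Φ x) w -
        γ * ∑ y, M.Pμ μ i x y * inner ℝ (feature Φ y) w) • feature Φ x := by
    intro x
    rw [← M.sum_agentWeight_smul_tdLinear μ, ← M.sum_agentWeight_smul_tdError_zero μ (γ := γ),
      ← Finset.sum_sub_distrib]
    refine Finset.sum_congr rfl fun p _ => ?_
    have h0 := tdError_add Φ γ (M.R i) x p 0 w
    rw [zero_add] at h0
    rw [h0, smul_sub]
  simp_rw [h1, smul_sub]
  rw [Finset.sum_sub_distrib, M.b_eq, M.Ups_apply]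

/-- Positive definiteness of `Υ_i`. -/
theorem MDPs.inner_Ups_ge [Nonempty S] (M : MDPs S A N) (μ : S → stdSimplex ℝ A) (hγ₀ : 0 ≤ γ)
    (i : Fin N) (z : EuclideanSpace ℝ (Fin d)) :
    (1 - γ) * ∑ x, stationaryDist (M.Pμ μ i) x * inner ℝ (feature Φ x) z ^ 2 ≤
      inner ℝ z (Matrix.toEuclideanCLM (n := Fin d) (𝕜 := ℝ) (M.Ups μ Φ γ i) z) := by
  have hP := M.Pμ_mem_rowStochastic μ i
  have hq := isStationary_stationaryDist hP
  rw [Matrix.mem_rowStochastic_iff_sum] at hP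
  set P := M.Pμ μ i with hPdef
  set q := stationaryDist P with hqdef
  set g : S → ℝ := fun x => inner ℝ (feature Φ x) z with hg
  have e1 : inner ℝ z (Matrix.toEuclideanCLM (n := Fin d) (𝕜 := ℝ) (M.Ups μ Φ γ i) z) =
      ∑ x, q x * g x ^ 2 - γ * ∑ x, ∑ y, q x * P x y * (g x * g y) := by
    rw [M.Ups_apply, inner_sum, Finset.mul_sum, ← Finset.sum_sub_distrib]
    refine Finset.sum_congr rfl fun x _ => ?_
    rw [real_inner_smul_right, real_inner_smul_right, real_inner_comm (feature Φ x) z]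
    have : ∑ y, q x * P x y * (g x * g y) = q x * g x * ∑ y, P x y * g y := by
      rw [Finset.mul_sum]
      exact Finset.sum_congr rfl fun y _ => by ring
    rw [this]
    simp only [hg, hqdef, hPdef]
    ring
  -- The weights `q x * P x y` have both marginals equal to `q`, so `2 g x g y ≤ g x² + g y²` bounds
  -- the correlation by the stationary second moment; hence the factor `1 - γ`.
  have e2 : ∑ x, ∑ y, q x * P x y * (g x * g y) ≤ ∑ x, q x * g x ^ 2 := by
    have h1 : ∑ x, ∑ y, q x * P x y * g x ^ 2 = ∑ x, q x * g x ^ 2 := by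
      refine Finset.sum_congr rfl fun x _ => ?_
      rw [← Finset.sum_mul, ← Finset.mul_sum, hP.2, mul_one]
    have h2 : ∑ x, ∑ y, q x * P x y * g y ^ 2 = ∑ x, q x * g x ^ 2 := by
      rw [Finset.sum_comm]
      refine Finset.sum_congr rfl fun y _ => ?_
      rw [← Finset.sum_mul, hq.sum_mul]
    have h3 : ∑ x, ∑ y, q x * P x y * (g x * g y) ≤
        ∑ x, ∑ y, (q x * P x y * g x ^ 2 + q x * P x y * g y ^ 2) / 2 := by
      refine Finset.sum_le_sum fun x _ => Finset.sum_le_sum fun y _ => ?_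
      have := mul_nonneg (mul_nonneg (hq.nonneg x) (hP.1 x y)) (sq_nonneg (g x - g y))
      linarith
    refine h3.trans_eq ?_
    simp_rw [add_div, Finset.sum_add_distrib, ← Finset.sum_div]
    rw [h1, h2]
    ring
  rw [e1]
  linarith [mul_le_mul_of_nonneg_left e2 hγ₀]

end Agents

/-! ### The joint chain: independence of the agents and mixing. -/

section JointChain

variable {S A : Type*} [Fintype S] [Fintype A] {N d : ℕ} {Φ : Matrix S (Fin d) ℝ} {γ : ℝ}
  (M : MDPs S A N) (μ : S → stdSimplex ℝ A) (ν : stdSimplex ℝ (Fin N → S))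
  {E : Type*} [NormedAddCommGroup E] [InnerProductSpace ℝ E]

theorem MDPs.mean_average (x : Fin N → S) (f : Fin N → A × S → E) :
    (M.sampler μ ν).mean x (fun o => (1 / (N : ℝ)) • ∑ i, f i (o i)) =
      (1 / (N : ℝ)) • ∑ i, ∑ p, M.agentWeight μ i (x i) p • f i p := by
  rw [Sampler.mean_smul, Sampler.mean_sum]
  congr 1
  refine Finset.sum_congr rfl fun i _ => ?_
  exact sum_prod_smul (w := fun k => M.agentWeight μ k (x k)) (fun k => M.agentWeight_sum μ k _) i
    (f i)

theorem norm_sq_average (f : Fin N → E) :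
    ‖(1 / (N : ℝ)) • ∑ i, f i‖ ^ 2 = 1 / (N : ℝ) ^ 2 * ‖∑ i, f i‖ ^ 2 := by
  rw [norm_smul, mul_pow, Real.norm_of_nonneg (by positivity), div_pow, one_pow]

/-- Independence of the agents: the variance of an average is small. -/
theorem MDPs.mean_norm_sq_average_le (hN : 0 < N) (x : Fin N → S) (f : Fin N → A × S → E) {B : ℝ}
    (hf : ∀ i p, ‖f i p‖ ≤ B) :
    (M.sampler μ ν).mean x (fun o => ‖(1 / (N : ℝ)) • ∑ i, f i (o i)‖ ^ 2) ≤
      1 / N * B ^ 2 + ‖(1 / (N : ℝ)) • ∑ i, ∑ p, M.agentWeight μ i (x i) p • f i p‖ ^ 2 := by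
  have hN' : (0 : ℝ) < N := by exact_mod_cast hN
  have h1 : (M.sampler μ ν).mean x (fun o => offDiag fun i => f i (o i)) =
      offDiag fun i => ∑ p, M.agentWeight μ i (x i) p • f i p :=
    sum_prod_offDiag (w := fun k => M.agentWeight μ k (x k)) (fun k => M.agentWeight_sum μ k _) f
  have h2 : ∀ o : Fin N → A × S, ‖(1 / (N : ℝ)) • ∑ i, f i (o i)‖ ^ 2 ≤
      1 / (N : ℝ) ^ 2 * (offDiag (fun i => f i (o i)) + N * B ^ 2) := by
    intro o
    rw [norm_sq_average]
    refine mul_le_mul_of_nonneg_left ?_ (by positivity)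
    have h3 : ∑ i, ‖f i (o i)‖ ^ 2 ≤ N * B ^ 2 := by
      refine (Finset.sum_le_sum fun i _ =>
        pow_le_pow_left₀ (norm_nonneg _) (hf i (o i)) 2).trans_eq ?_
      simp
    rw [offDiag]
    linarith
  refine ((M.sampler μ ν).mean_mono x h2).trans ?_
  rw [Sampler.mean_mul, Sampler.mean_add, Sampler.mean_const, h1, norm_sq_average, offDiag]
  have h4 : 0 ≤ ∑ i, ‖∑ p, M.agentWeight μ i (x i) p • f i p‖ ^ 2 :=
    Finset.sum_nonneg fun _ _ => by positivity
  have e1 : 1 / (N : ℝ) * B ^ 2 = 1 / (N : ℝ) ^ 2 * (N * B ^ 2) := by field_simp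
  rw [e1, ← mul_add]
  refine mul_le_mul_of_nonneg_left ?_ (by positivity)
  linarith

theorem MDPs.norm_sum_agentWeight_le (i : Fin N) (x : S) {f : A × S → E} {B : ℝ}
    (hf : ∀ p, ‖f p‖ ≤ B) : ‖∑ p, M.agentWeight μ i x p • f p‖ ≤ B := by
  calc _ ≤ ∑ p, ‖M.agentWeight μ i x p • f p‖ := norm_sum_le _ _
    _ ≤ ∑ p, M.agentWeight μ i x p * B := by
      refine Finset.sum_le_sum fun p _ => ?_
      rw [norm_smul, Real.norm_of_nonneg (M.agentWeight_nonneg μ i x p)]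
      exact mul_le_mul_of_nonneg_left (hf p) (M.agentWeight_nonneg μ i x p)
    _ = B := by rw [← Finset.sum_mul, M.agentWeight_sum, one_mul]

variable [DecidableEq S]

/-- Given the present joint state the agents move independently, so stepping back in time replaces
each `f i` by its image under the agent's own chain. The sum over `ν` stays, since initial states
may be dependent. -/
theorem MDPs.ex_offDiag {Y : Type*} (y₀ : (Fin N → S) → Y)
    (G : ℕ → Y → (Fin N → S) → (Fin N → A × S) → Y) (t : ℕ) (f : Fin N → S → E) :
    (M.sampler μ ν).ex y₀ G t (fun _ x => offDiag fun i => f i (x i)) =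
      ∑ x, ν x * offDiag fun i => act (M.Pμ μ i ^ t) (f i) (x i) := by
  induction t generalizing f with
  | zero => simp [Sampler.ex, act_one, MDPs.sampler]
  | succ t ih =>
    rw [Sampler.ex_succ]
    have h1 : ∀ x, (M.sampler μ ν).mean x (fun o => offDiag fun i =>
        f i ((M.sampler μ ν).next o i)) = offDiag fun i => act (M.Pμ μ i) (f i) (x i) := by
      intro x
      have := sum_prod_offDiag (w := fun k => M.agentWeight μ k (x k))
        (fun k => M.agentWeight_sum μ k _) fun i (p : A × S) => f i p.2
      simp only [M.sum_agentWeight_smul_next] at this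
      exact this
    simp only [h1]
    rw [ih]
    simp only [pow_succ, act_mul]

/-- Averages over the agents of centered functions of the states are small. -/
theorem MDPs.ex_norm_sq_average_le (hN : 0 < N) {Y : Type*} (y₀ : (Fin N → S) → Y)
    (G : ℕ → Y → (Fin N → S) → (Fin N → A × S) → Y) {m : ℕ} (hm : 0 < m) {c : ℝ} (hc₀ : 0 < c)
    (hc₁ : c < 1) (hc : ∀ i x y, c ≤ (M.Pμ μ i ^ m) x y) {q : Fin N → S → ℝ}
    (hq : ∀ i, IsStationary (M.Pμ μ i) (q i)) (f : Fin N → S → E)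
    (hqf : ∀ i, ∑ x, q i x • f i x = 0) {B : ℝ} (hB : 0 ≤ B) (hf : ∀ i x, ‖f i x‖ ≤ B) (t : ℕ) :
    (M.sampler μ ν).ex y₀ G t (fun _ x => ‖(1 / (N : ℝ)) • ∑ i, f i (x i)‖ ^ 2) ≤
      1 / N * B ^ 2 + (m / c / (t + 1) * B) ^ 2 := by
  have hN' : (0 : ℝ) < N := by exact_mod_cast hN
  have h1 : ∀ x : Fin N → S, ‖(1 / (N : ℝ)) • ∑ i, f i (x i)‖ ^ 2 ≤
      1 / (N : ℝ) ^ 2 * (offDiag (fun i => f i (x i)) + N * B ^ 2) := by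
    intro x
    rw [norm_sq_average]
    refine mul_le_mul_of_nonneg_left ?_ (by positivity)
    have h3 : ∑ i, ‖f i (x i)‖ ^ 2 ≤ N * B ^ 2 := by
      refine (Finset.sum_le_sum fun i _ =>
        pow_le_pow_left₀ (norm_nonneg _) (hf i (x i)) 2).trans_eq ?_
      simp
    rw [offDiag]
    linarith
  refine ((M.sampler μ ν).ex_mono y₀ G t fun _ x => h1 x).trans ?_
  rw [Sampler.ex_mul, Sampler.ex_add, Sampler.ex_const, M.ex_offDiag]
  -- For every joint initial state each factor has decayed like `1/(t+1)`, so correlations in the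
  -- initial law are harmless. The diagonal contributes the term `B² / N`.
  have h2 : ∀ x : Fin N → S, (offDiag fun i => act (M.Pμ μ i ^ t) (f i) (x i)) ≤
      (N : ℝ) ^ 2 * (m / c / (t + 1) * B) ^ 2 := by
    intro x
    have h3 : ‖∑ i, act (M.Pμ μ i ^ t) (f i) (x i)‖ ≤ N * (m / c / (t + 1) * B) := by
      refine (norm_sum_le _ _).trans ((Finset.sum_le_sum fun i _ =>
        norm_act_pow_le (M.Pμ_mem_rowStochastic μ i) (hq i) hm hc₀ hc₁ (hc i) (hqf i) hB (hf i)
          t (x i)).trans_eq ?_)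
      simp
    have h4 : 0 ≤ ∑ i, ‖act (M.Pμ μ i ^ t) (f i) (x i)‖ ^ 2 :=
      Finset.sum_nonneg fun _ _ => by positivity
    have h5 := pow_le_pow_left₀ (norm_nonneg _) h3 2
    rw [mul_pow] at h5
    rw [offDiag]
    linarith
  have h3 : ∑ x, ν x * (offDiag fun i => act (M.Pμ μ i ^ t) (f i) (x i)) ≤
      (N : ℝ) ^ 2 * (m / c / (t + 1) * B) ^ 2 := by
    calc _ ≤ ∑ x, ν x * ((N : ℝ) ^ 2 * (m / c / (t + 1) * B) ^ 2) :=
          Finset.sum_le_sum fun x _ => mul_le_mul_of_nonneg_left (h2 x) (stdSimplex.zero_le _ _)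
      _ = _ := by rw [← Finset.sum_mul, stdSimplex.sum_eq_one, one_mul]
  calc _ ≤ 1 / (N : ℝ) ^ 2 * ((N : ℝ) ^ 2 * (m / c / (t + 1) * B) ^ 2 + N * B ^ 2) := by
        gcongr
    _ = _ := by field_simp; ring

/-- Mean TD error of an agent, given its state. -/
noncomputable def MDPs.tdMean (Φ : Matrix S (Fin d) ℝ) (γ : ℝ) (w : EuclideanSpace ℝ (Fin d))
    (i : Fin N) (x : S) : EuclideanSpace ℝ (Fin d) :=
  ∑ p, M.agentWeight μ i x p • tdError Φ γ (M.R i) x p.1 p.2 w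

/-- Mean of the linear part of the TD error of an agent, given its state. -/
noncomputable def MDPs.tdLinearMean (Φ : Matrix S (Fin d) ℝ) (γ : ℝ)
    (i : Fin N) (z : EuclideanSpace ℝ (Fin d)) (x : S) : EuclideanSpace ℝ (Fin d) :=
  ∑ p, M.agentWeight μ i x p • tdLinear Φ γ x p z

/-- Poisson solution for the constant part of the noise of an agent. -/
noncomputable def MDPs.poissonConst (Φ : Matrix S (Fin d) ℝ) (γ : ℝ)
    (w : EuclideanSpace ℝ (Fin d)) (i : Fin N) : S → EuclideanSpace ℝ (Fin d) :=
  poisson (M.Pμ μ i) (stationaryDist (M.Pμ μ i)) (M.tdMean μ Φ γ w i)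

/-- Poisson solution for the linear part of the noise of an agent. -/
noncomputable def MDPs.poissonLin (Φ : Matrix S (Fin d) ℝ) (γ : ℝ) (i : Fin N) (x : S) :
    EuclideanSpace ℝ (Fin d) →ₗ[ℝ] EuclideanSpace ℝ (Fin d) where
  toFun z := poisson (M.Pμ μ i) (stationaryDist (M.Pμ μ i)) (M.tdLinearMean μ Φ γ i z) x
  map_add' z z' := by
    rw [← Pi.add_apply, ← poisson_add]
    congr 1
    funext y
    simp only [tdLinearMean, tdLinear, Pi.add_apply, inner_add_right, ← Finset.sum_add_distrib,
      ← smul_add, ← add_smul]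
    refine Finset.sum_congr rfl fun p _ => ?_
    congr 2
    ring
  map_smul' a z := by
    rw [RingHom.id_apply, ← Pi.smul_apply, ← poisson_smul]
    congr 1
    funext y
    simp only [tdLinearMean, tdLinear, Pi.smul_apply, real_inner_smul_right, Finset.smul_sum,
      smul_smul]
    refine Finset.sum_congr rfl fun p _ => ?_
    congr 1
    ring

variable {M μ} {m : ℕ} {c : ℝ} {w : EuclideanSpace ℝ (Fin d)}

/-- The Poisson equation for one agent. -/
theorem MDPs.sum_agentWeight_poisson [Nonempty S] (hc₀ : 0 < c)
    (hc : ∀ i x y, c ≤ (M.Pμ μ i ^ m) x y) (i : Fin N) (x : S)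
    (z : EuclideanSpace ℝ (Fin d)) :
    ∑ p, M.agentWeight μ i x p • ((tdError Φ γ (M.R i) x p.1 p.2 w - tdLinear Φ γ x p z) +
        (M.poissonConst μ Φ γ w i p.2 - M.poissonLin μ Φ γ i p.2 z)) =
      (M.b μ Φ i - Matrix.toEuclideanCLM (n := Fin d) (𝕜 := ℝ) (M.Ups μ Φ γ i) (w + z)) +
        (M.poissonConst μ Φ γ w i x - M.poissonLin μ Φ γ i x z) := by
  have hP := M.Pμ_mem_rowStochastic μ i
  have hq := isStationary_stationaryDist hP
  have h1 := (poisson_spec hP hq hc₀ (hc i) (M.tdMean μ Φ γ w i)).2 x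
  have h2 := (poisson_spec hP hq hc₀ (hc i) (M.tdLinearMean μ Φ γ i z)).2 x
  have h3 : ∑ y, stationaryDist (M.Pμ μ i) y • M.tdMean μ Φ γ w i y =
      M.b μ Φ i - Matrix.toEuclideanCLM (n := Fin d) (𝕜 := ℝ) (M.Ups μ Φ γ i) w :=
    M.sum_stationary_tdError μ i w
  have h4 : ∑ y, stationaryDist (M.Pμ μ i) y • M.tdLinearMean μ Φ γ i z y =
      Matrix.toEuclideanCLM (n := Fin d) (𝕜 := ℝ) (M.Ups μ Φ γ i) z := by
    rw [M.Ups_apply]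
    refine Finset.sum_congr rfl fun y _ => ?_
    rw [tdLinearMean, M.sum_agentWeight_smul_tdLinear]
  rw [h3] at h1
  rw [h4] at h2
  have h5 := M.sum_agentWeight_smul_next μ i x (M.poissonConst μ Φ γ w i)
  have h6 := M.sum_agentWeight_smul_next μ i x fun y => M.poissonLin μ Φ γ i y z
  simp only [smul_add, smul_sub, Finset.sum_add_distrib, Finset.sum_sub_distrib]
  rw [h5, h6]
  change _ = M.tdMean μ Φ γ w i x - _ at h1
  change M.tdMean μ Φ γ w i x - M.tdLinearMean μ Φ γ i z x + _ = _
  have e1 : act (M.Pμ μ i) (M.poissonConst μ Φ γ w i) x = M.poissonConst μ Φ γ w i x -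
      (M.tdMean μ Φ γ w i x -
        (M.b μ Φ i - Matrix.toEuclideanCLM (n := Fin d) (𝕜 := ℝ) (M.Ups μ Φ γ i) w)) := by
    rw [← h1, MDPs.poissonConst]
    abel
  have e2 : act (M.Pμ μ i) (fun y => M.poissonLin μ Φ γ i y z) x = M.poissonLin μ Φ γ i x z -
      (M.tdLinearMean μ Φ γ i z x -
        Matrix.toEuclideanCLM (n := Fin d) (𝕜 := ℝ) (M.Ups μ Φ γ i) z) := by
    rw [← h2]
    change act (M.Pμ μ i) (poisson (M.Pμ μ i) (stationaryDist (M.Pμ μ i))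
      (M.tdLinearMean μ Φ γ i z)) x = poisson (M.Pμ μ i) (stationaryDist (M.Pμ μ i))
      (M.tdLinearMean μ Φ γ i z) x - _
    abel
  rw [e1, e2, map_add]
  abel

theorem MDPs.norm_poissonConst_le [Nonempty S] (hc₀ : 0 < c)
    (hc : ∀ i x y, c ≤ (M.Pμ μ i ^ m) x y) (hΦ : ∀ x, ‖feature Φ x‖ ≤ 1) (hγ₀ : 0 ≤ γ)
    (hγ₁ : γ ≤ 1) {Rmax : ℝ} (hR : M.RewardBound Rmax) (i : Fin N) (x : S) :
    ‖M.poissonConst μ Φ γ w i x‖ ≤ m / c * (2 * (Rmax + 2 * ‖w‖)) :=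
  norm_poisson_le (M.Pμ_mem_rowStochastic μ i)
    (isStationary_stationaryDist (M.Pμ_mem_rowStochastic μ i)) hc₀ (hc i) (fun y =>
      M.norm_sum_agentWeight_le μ i y fun p => norm_tdError_le hΦ hγ₀ hγ₁ (hR i) y p w) x

theorem MDPs.norm_poissonLin_le [Nonempty S] (hc₀ : 0 < c)
    (hc : ∀ i x y, c ≤ (M.Pμ μ i ^ m) x y) (hΦ : ∀ x, ‖feature Φ x‖ ≤ 1) (hγ₀ : 0 ≤ γ)
    (hγ₁ : γ ≤ 1) (i : Fin N) (x : S) (z : EuclideanSpace ℝ (Fin d)) :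
    ‖M.poissonLin μ Φ γ i x z‖ ≤ m / c * (2 * (2 * ‖z‖)) :=
  norm_poisson_le (M.Pμ_mem_rowStochastic μ i)
    (isStationary_stationaryDist (M.Pμ_mem_rowStochastic μ i)) hc₀ (hc i) (fun y =>
      M.norm_sum_agentWeight_le μ i y fun p => norm_tdLinear_le hΦ hγ₀ hγ₁ y p z) x

end JointChain

/-! ### Federated TD as a linear stochastic approximation with variance `1 / N`. -/

section FederatedTD

variable {S A : Type*} [Fintype S] [Fintype A] {N d : ℕ}

theorem norm_average_le {E : Type*} [NormedAddCommGroup E] [NormedSpace ℝ E] (hN : 0 < N)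
    {f : Fin N → E} {B : ℝ} (hf : ∀ i, ‖f i‖ ≤ B) : ‖(1 / (N : ℝ)) • ∑ i, f i‖ ≤ B := by
  have hN' : (0 : ℝ) < N := by exact_mod_cast hN
  rw [norm_smul, Real.norm_of_nonneg (by positivity)]
  calc 1 / (N : ℝ) * ‖∑ i, f i‖ ≤ 1 / (N : ℝ) * ∑ _i : Fin N, B := by
        gcongr
        exact (norm_sum_le _ _).trans (Finset.sum_le_sum fun i _ => hf i)
    _ = B := by
        rw [Finset.sum_const, Finset.card_univ, Fintype.card_fin, nsmul_eq_mul]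
        field_simp

variable (M : MDPs S A N) (μ : S → stdSimplex ℝ A) (Φ : Matrix S (Fin d) ℝ) (γ : ℝ)
  (w : EuclideanSpace ℝ (Fin d))

/-- Average over the agents of the TD errors at `w`. -/
noncomputable def MDPs.tdAvg (x : Fin N → S) (o : Fin N → A × S) : EuclideanSpace ℝ (Fin d) :=
  (1 / (N : ℝ)) • ∑ i, tdError Φ γ (M.R i) (x i) (o i).1 (o i).2 w

/-- Average over the agents of the linear parts of the TD errors. -/
noncomputable def tdLinearAvg (x : Fin N → S) (o : Fin N → A × S)
    (z : EuclideanSpace ℝ (Fin d)) : EuclideanSpace ℝ (Fin d) :=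
  (1 / (N : ℝ)) • ∑ i, tdLinear Φ γ (x i) (o i) z

variable [DecidableEq S]

/-- Average of the Poisson solutions, constant part. -/
noncomputable def MDPs.poissonConstAvg (x : Fin N → S) : EuclideanSpace ℝ (Fin d) :=
  (1 / (N : ℝ)) • ∑ i, M.poissonConst μ Φ γ w i (x i)

/-- Average of the Poisson solutions, linear part. -/
noncomputable def MDPs.poissonLinAvg (x : Fin N → S) :
    EuclideanSpace ℝ (Fin d) →ₗ[ℝ] EuclideanSpace ℝ (Fin d) :=
  (1 / (N : ℝ)) • ∑ i, M.poissonLin μ Φ γ i (x i)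

/-- Average of the operators `Υ_i`. -/
noncomputable def MDPs.UpsAvg : EuclideanSpace ℝ (Fin d) →ₗ[ℝ] EuclideanSpace ℝ (Fin d) :=
  (1 / (N : ℝ)) • ∑ i, (Matrix.toEuclideanCLM (n := Fin d) (𝕜 := ℝ) (M.Ups μ Φ γ i)).toLinearMap

theorem MDPs.poissonLinAvg_apply (x : Fin N → S) (z : EuclideanSpace ℝ (Fin d)) :
    M.poissonLinAvg μ Φ γ x z = (1 / (N : ℝ)) • ∑ i, M.poissonLin μ Φ γ i (x i) z := by
  rw [poissonLinAvg, LinearMap.smul_apply, LinearMap.sum_apply]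

theorem MDPs.UpsAvg_apply (z : EuclideanSpace ℝ (Fin d)) :
    M.UpsAvg μ Φ γ z = (1 / (N : ℝ)) •
      ∑ i, Matrix.toEuclideanCLM (n := Fin d) (𝕜 := ℝ) (M.Ups μ Φ γ i) z := by
  rw [UpsAvg, LinearMap.smul_apply, LinearMap.sum_apply]
  rfl

variable {M μ Φ γ w} {m : ℕ} {c κ Rmax L : ℝ}

/-- The corrector of each agent depends on its own state only, so averaging the agents' Poisson
equations solves that of the joint chain. The choice of `w` cancels the constants `b_i - Υ_i w` in
the sum. Given the current state, the increments of the agents are independent and bounded, so their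
average has variance of order `1 / N`. -/
theorem MDPs.isLinearSA [Nonempty S] (ν : stdSimplex ℝ (Fin N → S)) (hN : 0 < N)
    (hc₀ : 0 < c) (hc : ∀ i x y, c ≤ (M.Pμ μ i ^ m) x y) (hΦ : ∀ x, ‖feature Φ x‖ ≤ 1)
    (hγ₀ : 0 ≤ γ) (hγ₁ : γ ≤ 1) (hR : M.RewardBound Rmax) (hRmax : 0 ≤ Rmax)
    (hκ : ∀ i z, κ * ‖z‖ ^ 2 ≤
      inner ℝ z (Matrix.toEuclideanCLM (n := Fin d) (𝕜 := ℝ) (M.Ups μ Φ γ i) z))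
    (hw : ∑ i, M.b μ Φ i =
      ∑ i, Matrix.toEuclideanCLM (n := Fin d) (𝕜 := ℝ) (M.Ups μ Φ γ i) w)
    (hL₁ : 2 * (1 + 2 * (m / c)) ≤ L) (hL₂ : (1 + 2 * (m / c)) * (Rmax + 2 * ‖w‖) ≤ L)
    (hL₃ : 8 * ((1 + 2 * (m / c)) * (Rmax + 2 * ‖w‖ + 2)) ^ 2 ≤ L) :
    IsLinearSA (M.sampler μ ν) (M.tdAvg Φ γ w) (tdLinearAvg Φ γ) (M.poissonConstAvg μ Φ γ w)
      (M.poissonLinAvg μ Φ γ) (M.UpsAvg μ Φ γ) κ L (1 / N) := by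
  have hN' : (0 : ℝ) < N := by exact_mod_cast hN
  set ρ : ℝ := m / c with hρ
  have hρ0 : 0 ≤ ρ := by positivity
  set B : ℝ := Rmax + 2 * ‖w‖ with hB
  have hB0 : 0 ≤ B := by positivity
  have hρB : 0 ≤ ρ * B := mul_nonneg hρ0 hB0
  have hpc : ∀ i x, ‖M.poissonConst μ Φ γ w i x‖ ≤ ρ * (2 * B) := fun i x =>
    MDPs.norm_poissonConst_le hc₀ hc hΦ hγ₀ hγ₁ hR i x
  have hpl : ∀ i x z, ‖M.poissonLin μ Φ γ i x z‖ ≤ ρ * (2 * (2 * ‖z‖)) := fun i x z =>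
    MDPs.norm_poissonLin_le hc₀ hc hΦ hγ₀ hγ₁ i x z
  have hmean : ∀ (x : Fin N → S) (z : EuclideanSpace ℝ (Fin d)), (1 / (N : ℝ)) • ∑ i,
      ∑ p, M.agentWeight μ i (x i) p •
        ((tdError Φ γ (M.R i) (x i) p.1 p.2 w - tdLinear Φ γ (x i) p z) +
        (M.poissonConst μ Φ γ w i p.2 - M.poissonLin μ Φ γ i p.2 z)) =
      -M.UpsAvg μ Φ γ z + (M.poissonConstAvg μ Φ γ w x - M.poissonLinAvg μ Φ γ x z) := by
    intro x z
    simp_rw [MDPs.sum_agentWeight_poisson hc₀ hc, map_add]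
    rw [Finset.sum_add_distrib, Finset.sum_sub_distrib, Finset.sum_add_distrib, hw,
      Finset.sum_sub_distrib, UpsAvg_apply, poissonConstAvg, poissonLinAvg_apply, smul_add,
      smul_sub (1 / (N : ℝ)) (∑ i, M.poissonConst μ Φ γ w i (x i)), smul_sub, smul_add]
    abel
  have hfun : ∀ (x : Fin N → S) (o : Fin N → A × S) (z : EuclideanSpace ℝ (Fin d)),
      (M.tdAvg Φ γ w x o - tdLinearAvg Φ γ x o z) +
        (M.poissonConstAvg μ Φ γ w ((M.sampler μ ν).next o) -
          M.poissonLinAvg μ Φ γ ((M.sampler μ ν).next o) z) = (1 / (N : ℝ)) • ∑ i,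
        ((tdError Φ γ (M.R i) (x i) (o i).1 (o i).2 w - tdLinear Φ γ (x i) (o i) z) +
        (M.poissonConst μ Φ γ w i (o i).2 - M.poissonLin μ Φ γ i (o i).2 z)) := by
    intro x o z
    rw [tdAvg, tdLinearAvg, poissonConstAvg, poissonLinAvg_apply, Finset.sum_add_distrib,
      Finset.sum_sub_distrib, Finset.sum_sub_distrib, smul_add, smul_sub, smul_sub]
    rfl
  refine ⟨?_, ?_, ?_, ?_, ?_, ?_, ?_⟩
  · intro x o z
    refine norm_average_le hN fun i => (norm_tdLinear_le hΦ hγ₀ hγ₁ _ _ z).trans ?_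
    exact mul_le_mul_of_nonneg_right (by linarith) (norm_nonneg z)
  · intro x o
    refine norm_average_le hN fun i => (norm_tdError_le hΦ hγ₀ hγ₁ (hR i) _ _ w).trans ?_
    linarith
  · intro x
    refine norm_average_le hN fun i => (hpc i (x i)).trans ?_
    linarith
  · intro x z
    rw [poissonLinAvg_apply]
    refine norm_average_le hN fun i => (hpl i (x i) z).trans ?_
    have := mul_le_mul_of_nonneg_right hL₁ (norm_nonneg z)
    linarith [norm_nonneg z]
  · intro z
    rw [UpsAvg_apply, real_inner_smul_right, inner_sum]
    calc κ * ‖z‖ ^ 2 = 1 / (N : ℝ) * ∑ _i : Fin N, κ * ‖z‖ ^ 2 := by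
          rw [Finset.sum_const, Finset.card_univ, Fintype.card_fin, nsmul_eq_mul]
          field_simp
      _ ≤ _ := by
          gcongr with i
          exact hκ i z
  · intro x z
    simp_rw [hfun]
    rw [M.mean_average μ ν x fun i p =>
      (tdError Φ γ (M.R i) (x i) p.1 p.2 w - tdLinear Φ γ (x i) p z) +
        (M.poissonConst μ Φ γ w i p.2 - M.poissonLin μ Φ γ i p.2 z), hmean]
  · intro x z
    set f : Fin N → A × S → EuclideanSpace ℝ (Fin d) := fun i p =>
      (tdError Φ γ (M.R i) (x i) p.1 p.2 w - tdLinear Φ γ (x i) p z) +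
        (M.poissonConst μ Φ γ w i p.2 - M.poissonLin μ Φ γ i p.2 z) with hf
    set g : Fin N → EuclideanSpace ℝ (Fin d) := fun i =>
      ∑ p, M.agentWeight μ i (x i) p • f i p with hg
    have hfB : ∀ i p, ‖f i p‖ ≤ (1 + 2 * ρ) * (B + 2) * (1 + ‖z‖) := by
      intro i p
      have i1 := norm_add_le (tdError Φ γ (M.R i) (x i) p.1 p.2 w - tdLinear Φ γ (x i) p z)
        (M.poissonConst μ Φ γ w i p.2 - M.poissonLin μ Φ γ i p.2 z)
      have i2 := norm_sub_le (tdError Φ γ (M.R i) (x i) p.1 p.2 w) (tdLinear Φ γ (x i) p z)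
      have i3 := norm_sub_le (M.poissonConst μ Φ γ w i p.2) (M.poissonLin μ Φ γ i p.2 z)
      have i4 := norm_tdError_le hΦ hγ₀ hγ₁ (hR i) (x i) p w
      have i5 := norm_tdLinear_le hΦ hγ₀ hγ₁ (x i) p z
      have hz := norm_nonneg z
      have i6 : 0 ≤ B * ‖z‖ := by positivity
      have i7 : 0 ≤ ρ * B * ‖z‖ := by positivity
      calc ‖f i p‖ ≤ (B + 2 * ‖z‖) + (ρ * (2 * B) + ρ * (2 * (2 * ‖z‖))) := by
            linarith [hpc i p.2, hpl i p.2 z]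
        _ ≤ _ := by linarith
    have hgB : ∀ i, ‖g i‖ ≤ (1 + 2 * ρ) * (B + 2) * (1 + ‖z‖) := fun i =>
      M.norm_sum_agentWeight_le μ i (x i) (hfB i)
    have e1 : ∀ o : Fin N → A × S, (M.tdAvg Φ γ w x o - tdLinearAvg Φ γ x o z) +
        (M.poissonConstAvg μ Φ γ w ((M.sampler μ ν).next o) -
          M.poissonLinAvg μ Φ γ ((M.sampler μ ν).next o) z) - (-M.UpsAvg μ Φ γ z +
          (M.poissonConstAvg μ Φ γ w x - M.poissonLinAvg μ Φ γ x z)) =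
        (1 / (N : ℝ)) • ∑ i, (f i (o i) - g i) := by
      intro o
      rw [hfun, ← hmean, Finset.sum_sub_distrib, smul_sub]
    simp_rw [e1]
    refine (M.mean_norm_sq_average_le μ ν hN x (fun i p => f i p - g i)
      (B := 2 * ((1 + 2 * ρ) * (B + 2) * (1 + ‖z‖))) fun i p => ?_).trans ?_
    · linarith [norm_sub_le (f i p) (g i), hfB i p, hgB i]
    · have e2 : ∀ i, ∑ p, M.agentWeight μ i (x i) p • (f i p - g i) = 0 := by
        intro i
        simp only [smul_sub, Finset.sum_sub_distrib]
        rw [← Finset.sum_smul, M.agentWeight_sum, one_smul, sub_self]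
      simp only [e2, Finset.sum_const_zero, smul_zero, norm_zero]
      rw [zero_pow two_ne_zero, add_zero]
      refine mul_le_mul_of_nonneg_left ?_ (by positivity)
      have i1 : (1 + ‖z‖) ^ 2 ≤ 2 * (1 + ‖z‖ ^ 2) := by linarith [sq_nonneg (1 - ‖z‖)]
      calc (2 * ((1 + 2 * ρ) * (B + 2) * (1 + ‖z‖))) ^ 2
          = 4 * ((1 + 2 * ρ) * (B + 2)) ^ 2 * (1 + ‖z‖) ^ 2 := by ring
        _ ≤ 4 * ((1 + 2 * ρ) * (B + 2)) ^ 2 * (2 * (1 + ‖z‖ ^ 2)) := by gcongr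
        _ = 8 * ((1 + 2 * ρ) * (B + 2)) ^ 2 * (1 + ‖z‖ ^ 2) := by ring
        _ ≤ _ := by gcongr

theorem one_div_sq_le_stepSize {β : ℝ} (hβ : β ≤ 1) (t : ℕ) :
    (1 / ((t : ℝ) + 1)) ^ 2 ≤ stepSize β t := by
  have h1 := one_div_le_stepSize hβ t
  have h2 : 1 / ((t : ℝ) + 1) ≤ 1 := by
    rw [div_le_one (by positivity)]
    linarith [t.cast_nonneg (α := ℝ)]
  have h3 : 0 ≤ 1 / ((t : ℝ) + 1) := by positivity
  calc (1 / ((t : ℝ) + 1)) ^ 2 = 1 / ((t : ℝ) + 1) * (1 / ((t : ℝ) + 1)) := sq _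
    _ ≤ 1 / ((t : ℝ) + 1) := mul_le_of_le_one_left h3 h2
    _ ≤ _ := h1

/-- The Poisson solutions are normalized to have stationary mean zero, which is what the mixing
bound for averages over agents requires. -/
theorem MDPs.ex_poissonConstAvg_le [Nonempty S] (ν : stdSimplex ℝ (Fin N → S)) (hN : 0 < N)
    {Y : Type*} (y₀ : (Fin N → S) → Y) (G : ℕ → Y → (Fin N → S) → (Fin N → A × S) → Y)
    (hm : 0 < m) (hc₀ : 0 < c) (hc₁ : c < 1) (hc : ∀ i x y, c ≤ (M.Pμ μ i ^ m) x y)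
    (hΦ : ∀ x, ‖feature Φ x‖ ≤ 1) (hγ₀ : 0 ≤ γ) (hγ₁ : γ ≤ 1) (hR : M.RewardBound Rmax)
    (hRmax : 0 ≤ Rmax) {β : ℝ} (hβ : β ≤ 1) (t : ℕ) :
    (M.sampler μ ν).ex y₀ G t (fun _ x => ‖M.poissonConstAvg μ Φ γ w x‖ ^ 2) ≤
      (m / c * (2 * (Rmax + 2 * ‖w‖))) ^ 2 * (1 + (m / c) ^ 2) * (1 / N + stepSize β t) := by
  set B := m / c * (2 * (Rmax + 2 * ‖w‖)) with hB
  have hB0 : 0 ≤ B := by positivity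
  have hP := fun i => M.Pμ_mem_rowStochastic μ i
  have h1 := M.ex_norm_sq_average_le μ ν hN y₀ G hm hc₀ hc₁ hc
    (fun i => isStationary_stationaryDist (hP i)) (fun i => M.poissonConst μ Φ γ w i)
    (fun i => (poisson_spec (hP i) (isStationary_stationaryDist (hP i)) hc₀ (hc i) _).1) hB0
    (fun i x => MDPs.norm_poissonConst_le hc₀ hc hΦ hγ₀ hγ₁ hR i x) t
  refine h1.trans ?_
  have h2 := mul_le_mul_of_nonneg_left (one_div_sq_le_stepSize hβ t)
    (show 0 ≤ B ^ 2 * (m / c) ^ 2 by positivity)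
  have h3 : (m / c / (t + 1) * B) ^ 2 = B ^ 2 * (m / c) ^ 2 * (1 / ((t : ℝ) + 1)) ^ 2 := by ring
  have h4 : 0 ≤ B ^ 2 * (m / c) ^ 2 * (1 / (N : ℝ)) := by positivity
  have h5 : 0 ≤ B ^ 2 * stepSize β t := mul_nonneg (sq_nonneg B) (stepSize_pos β t).le
  rw [h3]
  linarith

/-- The conditional variance is at most `B² / N`; the conditional mean, after centering, is an
average of mean-zero functions of the states. Together these give the factor `5 = 1 + 4`, the `4`
coming from the doubled bound of the centered functions. -/
theorem MDPs.ex_tdAvg_le [Nonempty S] (ν : stdSimplex ℝ (Fin N → S)) (hN : 0 < N)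
    {Y : Type*} (y₀ : (Fin N → S) → Y) (G : ℕ → Y → (Fin N → S) → (Fin N → A × S) → Y)
    (hm : 0 < m) (hc₀ : 0 < c) (hc₁ : c < 1) (hc : ∀ i x y, c ≤ (M.Pμ μ i ^ m) x y)
    (hΦ : ∀ x, ‖feature Φ x‖ ≤ 1) (hγ₀ : 0 ≤ γ) (hγ₁ : γ ≤ 1) (hR : M.RewardBound Rmax)
    (hRmax : 0 ≤ Rmax) (hw : ∑ i, M.b μ Φ i =
      ∑ i, Matrix.toEuclideanCLM (n := Fin d) (𝕜 := ℝ) (M.Ups μ Φ γ i) w)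
    {β : ℝ} (hβ : β ≤ 1) (t : ℕ) :
    (M.sampler μ ν).ex y₀ G t
      (fun _ x => (M.sampler μ ν).mean x fun o => ‖M.tdAvg Φ γ w x o‖ ^ 2) ≤
      5 * (Rmax + 2 * ‖w‖) ^ 2 * (1 + (m / c) ^ 2) * (1 / N + stepSize β t) := by
  set B := Rmax + 2 * ‖w‖ with hB
  have hB0 : 0 ≤ B := by positivity
  have hP := fun i => M.Pμ_mem_rowStochastic μ i
  have hq := fun i => isStationary_stationaryDist (hP i)
  set f : Fin N → S → EuclideanSpace ℝ (Fin d) := fun i x => M.tdMean μ Φ γ w i x -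
    ∑ y, stationaryDist (M.Pμ μ i) y • M.tdMean μ Φ γ w i y with hf
  have hbd : ∀ i x, ‖M.tdMean μ Φ γ w i x‖ ≤ B := fun i x =>
    M.norm_sum_agentWeight_le μ i x fun p => norm_tdError_le hΦ hγ₀ hγ₁ (hR i) x p w
  have hsum : ∀ x : Fin N → S, ∑ i, M.tdMean μ Φ γ w i (x i) = ∑ i, f i (x i) := by
    intro x
    -- A single agent's stationary mean `b_i - Υ_i w` need not vanish; only the sum over the agents
    -- does, so centering each agent leaves the average unchanged.
    have h1 : ∑ i, ∑ y, stationaryDist (M.Pμ μ i) y • M.tdMean μ Φ γ w i y = 0 := by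
      simp only [tdMean, M.sum_stationary_tdError, Finset.sum_sub_distrib, hw, sub_self]
    simp only [hf, Finset.sum_sub_distrib, h1, sub_zero]
  have hpt : ∀ x : Fin N → S, (M.sampler μ ν).mean x (fun o => ‖M.tdAvg Φ γ w x o‖ ^ 2) ≤
      1 / N * B ^ 2 + ‖(1 / (N : ℝ)) • ∑ i, f i (x i)‖ ^ 2 := by
    intro x
    rw [← hsum]
    exact M.mean_norm_sq_average_le μ ν hN x (fun i p => tdError Φ γ (M.R i) (x i) p.1 p.2 w)
      fun i p => norm_tdError_le hΦ hγ₀ hγ₁ (hR i) (x i) p w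
  refine ((M.sampler μ ν).ex_mono y₀ G t fun _ x => hpt x).trans ?_
  rw [Sampler.ex_add, Sampler.ex_const]
  have h1 := M.ex_norm_sq_average_le μ ν hN y₀ G hm hc₀ hc₁ hc hq f
    (fun i => sum_smul_centered (hq i) _) (show 0 ≤ 2 * B by positivity)
    (fun i x => norm_centered_le (hq i) (hbd i) x) t
  have h2 := mul_le_mul_of_nonneg_left (one_div_sq_le_stepSize hβ t)
    (show 0 ≤ 4 * B ^ 2 * (m / c) ^ 2 by positivity)
  have h3 : (m / c / (t + 1) * (2 * B)) ^ 2 =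
      4 * B ^ 2 * (m / c) ^ 2 * (1 / ((t : ℝ) + 1)) ^ 2 := by ring
  rw [h3] at h1
  have h4 : 0 ≤ 5 * B ^ 2 * (m / c) ^ 2 * (1 / (N : ℝ)) := by positivity
  have h5 : 0 ≤ B ^ 2 * stepSize β t := mul_nonneg (sq_nonneg B) (stepSize_pos β t).le
  have h6 : 0 ≤ B ^ 2 * (m / c) ^ 2 * stepSize β t :=
    mul_nonneg (by positivity) (stepSize_pos β t).le
  linarith

end FederatedTD

/-! ### The mean square error around an arbitrary parameter. -/

section AverageBound

variable {S A : Type*} [Fintype S] {N d : ℕ}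

theorem iterate_succ_sub (M : MDPs S A N) (Φ : Matrix S (Fin d) ℝ) (γ β : ℝ)
    (v₀ w : EuclideanSpace ℝ (Fin d)) (s : ℕ → Fin N → S) (a : ℕ → Fin N → A) (t : ℕ) :
    iterate M Φ γ β v₀ s a (t + 1) - w = (iterate M Φ γ β v₀ s a t - w) +
      stepSize β t • (M.tdAvg Φ γ w (s t) (fun i => (a t i, s (t + 1) i)) -
        tdLinearAvg Φ γ (s t) (fun i => (a t i, s (t + 1) i)) (iterate M Φ γ β v₀ s a t - w)) := by
  have h : ∀ i, tdError Φ γ (M.R i) (s t i) (a t i) (s (t + 1) i) (iterate M Φ γ β v₀ s a t) =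
      tdError Φ γ (M.R i) (s t i) (a t i) (s (t + 1) i) w -
        tdLinear Φ γ (s t i) (a t i, s (t + 1) i) (iterate M Φ γ β v₀ s a t - w) := by
    intro i
    rw [← tdError_add Φ γ (M.R i) (s t i) (a t i, s (t + 1) i) w, add_sub_cancel]
  rw [iterate, MDPs.tdAvg, tdLinearAvg, ← smul_sub, ← Finset.sum_sub_distrib, smul_smul, stepSize]
  simp_rw [h]
  rw [div_eq_mul_one_div (1 / ((t : ℝ) + 1) ^ β) (N : ℝ), add_sub_right_comm]

/-- Thus `t` times the centered average is the sum of the centered iterates before `t`, the second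
component of the analyzed state. -/
theorem average_succ_sub (M : MDPs S A N) (Φ : Matrix S (Fin d) ℝ) (γ β : ℝ)
    (v₀ w : EuclideanSpace ℝ (Fin d)) (s : ℕ → Fin N → S) (a : ℕ → Fin N → A) (t : ℕ) :
    ((t : ℝ) + 1) • (average M Φ γ β v₀ s a (t + 1) - w) =
      (t : ℝ) • (average M Φ γ β v₀ s a t - w) + (iterate M Φ γ β v₀ s a t - w) := by
  have ht : ((t : ℝ) + 1) ≠ 0 := by positivity
  rw [average, add_sub_right_comm, smul_add, smul_smul, mul_one_div_cancel ht, one_smul, add_smul,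
    one_smul]
  abel

universe u₁ w₁

/-- Mean square error of the Polyak-Ruppert averages with respect to an arbitrary parameter `z`, in
terms of the distance of `z` to the solution `w` of the averaged equation. -/
theorem exists_average_bound {S : Type u₁} {A : Type w₁} [Fintype S] [DecidableEq S] [Nonempty S]
    [Fintype A] {β κ c Rmax W : ℝ} {m : ℕ} (hβ₀ : 0 < β) (hβ₁ : β < 1) (hκ : 0 < κ) (hm : 0 < m)
    (hc₀ : 0 < c) (hc₁ : c < 1) (hRmax : 0 ≤ Rmax) (hW : 0 ≤ W)
    {γ : ℝ} (hγ₀ : 0 ≤ γ) (hγ₁ : γ ≤ 1) (v₀ : EuclideanSpace ℝ (Fin d))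
    {Φ : Matrix S (Fin d) ℝ} (hΦ : ∀ x, ‖feature Φ x‖ ≤ 1) (μ : S → stdSimplex ℝ A) :
    ∃ K > 0, ∀ (N : ℕ) (M : MDPs S A N) (w : EuclideanSpace ℝ (Fin d)), 0 < N →
      (∀ i x y, c ≤ (M.Pμ μ i ^ m) x y) → M.RewardBound Rmax →
      (∀ i z, κ * ‖z‖ ^ 2 ≤
        inner ℝ z (Matrix.toEuclideanCLM (n := Fin d) (𝕜 := ℝ) (M.Ups μ Φ γ i) z)) →
      ∑ i, M.b μ Φ i = ∑ i, Matrix.toEuclideanCLM (n := Fin d) (𝕜 := ℝ) (M.Ups μ Φ γ i) w →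
      ‖w‖ ≤ W → ∀ {Ω : Type*} [MeasurableSpace Ω] (ℙ : Measure Ω) [IsProbabilityMeasure ℙ]
      (ν : stdSimplex ℝ (Fin N → S)) (s : ℕ → Fin N → Ω → S) (a : ℕ → Fin N → Ω → A),
      IsMarkovSample ℙ M μ ν s a → ∀ (z : EuclideanSpace ℝ (Fin d)) (c' : ℝ), 0 < c' →
      ∀ T : ℕ, 1 ≤ T →
      ∫ ω, ‖average M Φ γ β v₀ (fun t j => s t j ω) (fun t j => a t j ω) T - z‖ ^ 2 ∂ℙ ≤
        (1 + c'⁻¹) * (K * (1 / (N * T) + (T : ℝ) ^ (-(2 * β)))) + (1 + c') * ‖w - z‖ ^ 2 := by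
  set ρ : ℝ := m / c with hρ
  have hρ0 : 0 ≤ ρ := by positivity
  set L₁ : ℝ := 2 * (1 + 2 * ρ) with hL₁
  set L₂ : ℝ := (1 + 2 * ρ) * (Rmax + 2 * W) with hL₂
  set L₃ : ℝ := 8 * ((1 + 2 * ρ) * (Rmax + 2 * W + 2)) ^ 2 with hL₃
  set L₄ : ℝ := (ρ * (2 * (Rmax + 2 * W))) ^ 2 * (1 + ρ ^ 2) with hL₄
  set L₅ : ℝ := 5 * (Rmax + 2 * W) ^ 2 * (1 + ρ ^ 2) with hL₅
  have p₁ : 0 ≤ L₁ := by positivity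
  have p₂ : 0 ≤ L₂ := by positivity
  have p₃ : 0 ≤ L₃ := by positivity
  have p₄ : 0 ≤ L₄ := by positivity
  have p₅ : 0 ≤ L₅ := by positivity
  -- One constant dominating every bound that is required; it uses `W` instead of `‖w‖`, since `w`
  -- depends on the agents.
  set L : ℝ := L₁ + L₂ + L₃ + L₄ + L₅ + (‖v₀‖ + W) with hL
  have hL0 : 0 ≤ L := by positivity
  obtain ⟨K, hK, hbound⟩ := exists_averaging_bound.{u₁, max u₁ w₁}
    (E := EuclideanSpace ℝ (Fin d)) hβ₀ hβ₁ hκ hL0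
  refine ⟨K, hK, ?_⟩
  intro N M w hN hc hR hpos hw hwW Ω _ ℙ _ ν s a hs z c' hc' T hT
  have hN' : (0 : ℝ) < N := by exact_mod_cast hN
  have hT' : (0 : ℝ) < T := by exact_mod_cast hT
  have hN1 : (1 : ℝ) ≤ N := by exact_mod_cast hN
  have hw0 := norm_nonneg w
  have hv0 := norm_nonneg v₀
  have hB : Rmax + 2 * ‖w‖ ≤ Rmax + 2 * W := by linarith
  have hB0 : 0 ≤ Rmax + 2 * ‖w‖ := by positivity
  set C := M.sampler μ ν with hC
  have hSA : IsLinearSA C (M.tdAvg Φ γ w) (tdLinearAvg Φ γ) (M.poissonConstAvg μ Φ γ w)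
      (M.poissonLinAvg μ Φ γ) (M.UpsAvg μ Φ γ) κ L (1 / N) := by
    refine MDPs.isLinearSA ν hN hc₀ hc hΦ hγ₀ hγ₁ hR hRmax hpos hw ?_ ?_ ?_
    · linarith
    · have : (1 + 2 * (m / c)) * (Rmax + 2 * ‖w‖) ≤ L₂ := by
        rw [hL₂]; gcongr
      linarith
    · have : 8 * ((1 + 2 * (m / c)) * (Rmax + 2 * ‖w‖ + 2)) ^ 2 ≤ L₃ := by
        rw [hL₃]; gcongr
      linarith
  set G := saUpdate β C (M.tdAvg Φ γ w) (tdLinearAvg Φ γ) (M.poissonLinAvg μ Φ γ) with hG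
  set y₀ := saInit (M.poissonConstAvg μ Φ γ w) (M.poissonLinAvg μ Φ γ) (v₀ - w) with hy₀
  have hbd := hbound (Fin N → S) (Fin N → A × S) C _ _ _ _ _ (1 / N) (v₀ - w) (by positivity)
    (by rw [div_le_one hN']; exact hN1) ((norm_sub_le _ _).trans (by linarith)) hSA
    (fun t => ((MDPs.ex_tdAvg_le ν hN _ _ hm hc₀ hc₁ hc hΦ hγ₀ hγ₁ hR hRmax hw hβ₁.le t).trans
      (mul_le_mul_of_nonneg_right (by
        have : 5 * (Rmax + 2 * ‖w‖) ^ 2 * (1 + (m / c) ^ 2) ≤ L₅ := by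
          rw [hL₅]; gcongr
        linarith) (add_nonneg (by positivity) (stepSize_pos β t).le))))
    (fun t => ((MDPs.ex_poissonConstAvg_le ν hN _ _ hm hc₀ hc₁ hc hΦ hγ₀ hγ₁ hR hRmax hβ₁.le
      t).trans (mul_le_mul_of_nonneg_right (by
        have : (m / c * (2 * (Rmax + 2 * ‖w‖))) ^ 2 * (1 + (m / c) ^ 2) ≤ L₄ := by
          rw [hL₄]; gcongr
        linarith) (add_nonneg (by positivity) (stepSize_pos β t).le)))) T hT
  let y : ℕ → Ω → EuclideanSpace ℝ (Fin d) × EuclideanSpace ℝ (Fin d) × EuclideanSpace ℝ (Fin d) :=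
    fun t ω => Nat.rec (y₀ fun i => s 0 i ω)
      (fun t yt => G t yt (fun i => s t i ω) fun i => (a t i ω, s (t + 1) i ω)) t
  have hy1 : ∀ t ω, (y t ω).1 =
      iterate M Φ γ β v₀ (fun t j => s t j ω) (fun t j => a t j ω) t - w := by
    intro t ω
    induction t with
    | zero => rfl
    | succ t ih =>
      rw [iterate_succ_sub, ← ih]
      rfl
  have hy2 : ∀ t ω, (y t ω).2.1 =
      (t : ℝ) • (average M Φ γ β v₀ (fun t j => s t j ω) (fun t j => a t j ω) t - w) := by
    intro t ω
    induction t with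
    | zero => rw [Nat.cast_zero, zero_smul]; rfl
    | succ t ih =>
      rw [Nat.cast_succ, average_succ_sub, ← ih, ← hy1]
      rfl
  have havg : ∀ ω, average M Φ γ β v₀ (fun t j => s t j ω) (fun t j => a t j ω) T - z =
      (w - z) + (1 / (T : ℝ)) • (y T ω).2.1 := by
    intro ω
    rw [hy2, smul_smul, one_div_mul_cancel hT'.ne', one_smul]
    abel
  simp_rw [havg]
  rw [hs.integral_eq y₀ G y (fun _ => rfl) (fun _ _ => rfl)
    (fun y _ => ‖(w - z) + (1 / (T : ℝ)) • y.2.1‖ ^ 2) T]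
  -- The cross term between fluctuation and bias is not estimated but absorbed by Young's
  -- inequality; the free parameter `c'` is chosen later to fit the heterogeneity gap.
  refine (C.ex_mono (f := fun y _ => ‖(w - z) + (1 / (T : ℝ)) • y.2.1‖ ^ 2)
    (g := fun y _ => (1 + c') * ‖w - z‖ ^ 2 + ((1 + c'⁻¹) * (1 / (T : ℝ)) ^ 2) * ‖y.2.1‖ ^ 2)
    y₀ G T fun y _ => ?_).trans ?_
  · refine (norm_sq_add_le_of_pos _ _ hc').trans (le_of_eq ?_)
    rw [norm_smul, Real.norm_of_nonneg (by positivity)]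
    ring
  · rw [Sampler.ex_add, Sampler.ex_const, Sampler.ex_mul]
    have hTβ : (1 / (T : ℝ)) ^ 2 * (T : ℝ) ^ (2 - 2 * β) = (T : ℝ) ^ (-(2 * β)) := by
      rw [sub_eq_add_neg, Real.rpow_add hT', Real.rpow_two]
      field_simp
    have h1 : (1 / (T : ℝ)) ^ 2 * (1 / N * T) = 1 / (N * T) := by field_simp
    calc (1 + c') * ‖w - z‖ ^ 2 + (1 + c'⁻¹) * (1 / (T : ℝ)) ^ 2 *
          C.ex y₀ G T (fun y _ => ‖y.2.1‖ ^ 2)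
        ≤ (1 + c') * ‖w - z‖ ^ 2 + (1 + c'⁻¹) * (1 / (T : ℝ)) ^ 2 *
          (K * (1 / N * T + (T : ℝ) ^ (2 - 2 * β))) := by gcongr
      _ = (1 + c') * ‖w - z‖ ^ 2 + (1 + c'⁻¹) * (K * ((1 / (T : ℝ)) ^ 2 * (1 / N * T) +
          (1 / (T : ℝ)) ^ 2 * (T : ℝ) ^ (2 - 2 * β))) := by ring
      _ = _ := by rw [hTβ, h1]; ring

end AverageBound

/-! ### Spectral norm estimates and coercive matrices. -/

section MatrixNorm

variable {m n : Type*} [Fintype m] [Fintype n] [DecidableEq n]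

theorem l2_opNorm_le_frobenius (X : Matrix m n ℝ) : ‖X‖ ≤ Real.sqrt (∑ i, ∑ j, X i j ^ 2) := by
  rw [Matrix.l2_opNorm_def]
  refine ContinuousLinearMap.opNorm_le_bound _ (Real.sqrt_nonneg _) fun z => ?_
  rw [EuclideanSpace.norm_eq, EuclideanSpace.norm_eq z, ← Real.sqrt_mul (by positivity)]
  refine Real.sqrt_le_sqrt ?_
  rw [Finset.sum_mul]
  refine Finset.sum_le_sum fun i _ => ?_
  simp only [Real.norm_eq_abs, sq_abs]
  exact Finset.sum_mul_sq_le_sq_mul_sq Finset.univ (fun j => X i j) fun j => z j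

/-- Entries of a stochastic matrix satisfy `P² ≤ P`, so each row of `X` has Euclidean norm at most
`ε`, and the Frobenius norm is at most `ε √n`. -/
theorem l2_opNorm_le_of_abs_le {P X : Matrix n n ℝ} (hP : P ∈ Matrix.rowStochastic ℝ n) {ε : ℝ}
    (hε : 0 ≤ ε) (hX : ∀ i j, |X i j| ≤ ε * P i j) : ‖X‖ ≤ ε * Real.sqrt (Fintype.card n) := by
  have hP1 := fun i j => Matrix.le_one_of_mem_rowStochastic hP (i := i) (j := j)
  rw [Matrix.mem_rowStochastic_iff_sum] at hP
  refine (l2_opNorm_le_frobenius X).trans ?_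
  have h : ∑ i, ∑ j, X i j ^ 2 ≤ ε ^ 2 * Fintype.card n := by
    calc ∑ i, ∑ j, X i j ^ 2 ≤ ∑ i, ∑ j, ε ^ 2 * P i j := by
          refine Finset.sum_le_sum fun i _ => Finset.sum_le_sum fun j _ => ?_
          have h0 := hP.1 i j
          calc X i j ^ 2 = |X i j| ^ 2 := (sq_abs _).symm
            _ ≤ (ε * P i j) ^ 2 := pow_le_pow_left₀ (abs_nonneg _) (hX i j) 2
            _ = ε ^ 2 * (P i j * P i j) := by ring
            _ ≤ ε ^ 2 * (P i j * 1) := by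
              gcongr
              exact hP1 i j
            _ = _ := by rw [mul_one]
      _ = ∑ _i : n, ε ^ 2 := by
          refine Finset.sum_congr rfl fun i _ => ?_
          rw [← Finset.mul_sum, hP.2 i, mul_one]
      _ = _ := by rw [Finset.sum_const, Finset.card_univ, nsmul_eq_mul, mul_comm]
  calc Real.sqrt (∑ i, ∑ j, X i j ^ 2) ≤ Real.sqrt (ε ^ 2 * Fintype.card n) := Real.sqrt_le_sqrt h
    _ = _ := by rw [Real.sqrt_mul (sq_nonneg ε), Real.sqrt_sq hε]

/-- Coercivity of a square matrix. -/
def MatrixCoercive (κ : ℝ) (X : Matrix n n ℝ) : Prop :=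
  ∀ z, κ * ‖z‖ ^ 2 ≤ inner ℝ z (Matrix.toEuclideanCLM (n := n) (𝕜 := ℝ) X z)

variable {κ : ℝ} {X : Matrix n n ℝ}

theorem MatrixCoercive.mul_norm_le (h : MatrixCoercive κ X) (z : EuclideanSpace ℝ n) :
    κ * ‖z‖ ≤ ‖Matrix.toEuclideanCLM (n := n) (𝕜 := ℝ) X z‖ := by
  rcases (norm_nonneg z).eq_or_lt with hz | hz
  · rw [← hz, mul_zero]
    exact norm_nonneg _
  · have h1 := (h z).trans (real_inner_le_norm _ _)
    rw [sq, ← mul_assoc, mul_comm ‖z‖ ‖_‖] at h1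
    exact le_of_mul_le_mul_right h1 hz

theorem MatrixCoercive.isUnit_det (h : MatrixCoercive κ X) (hκ : 0 < κ) : IsUnit X.det := by
  rw [isUnit_iff_ne_zero]
  intro hdet
  obtain ⟨z, hz0, hz⟩ := Matrix.exists_mulVec_eq_zero_iff.mpr hdet
  have h1 := h.mul_norm_le (WithLp.toLp 2 z)
  rw [Matrix.toEuclideanCLM_toLp, hz] at h1
  have h2 : ‖(WithLp.toLp 2 (0 : n → ℝ) : EuclideanSpace ℝ n)‖ = 0 := by simp
  rw [h2] at h1
  have h3 : ‖(WithLp.toLp 2 z : EuclideanSpace ℝ n)‖ = 0 := by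
    nlinarith [norm_nonneg (WithLp.toLp 2 z : EuclideanSpace ℝ n)]
  rw [norm_eq_zero] at h3
  exact hz0 (by simpa using congrArg WithLp.ofLp h3)

theorem MatrixCoercive.norm_inv_le (h : MatrixCoercive κ X) (hκ : 0 < κ) : ‖X⁻¹‖ ≤ 1 / κ := by
  have hu := h.isUnit_det hκ
  rw [← Matrix.l2_opNorm_toEuclideanCLM]
  refine ContinuousLinearMap.opNorm_le_bound _ (by positivity) fun z => ?_
  have h1 := h.mul_norm_le (Matrix.toEuclideanCLM (n := n) (𝕜 := ℝ) X⁻¹ z)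
  have h2 : Matrix.toEuclideanCLM (n := n) (𝕜 := ℝ) X
      (Matrix.toEuclideanCLM (n := n) (𝕜 := ℝ) X⁻¹ z) = z := by
    rw [← mul_apply_eq_comp, ← map_mul, Matrix.mul_nonsing_inv _ hu, map_one]
    rfl
  rw [h2] at h1
  rw [one_div, inv_mul_eq_div, le_div_iff₀ hκ]
  linarith

theorem MatrixCoercive.le_norm [Nonempty n] (h : MatrixCoercive κ X) : κ ≤ ‖X‖ := by
  obtain ⟨z, hz⟩ := exists_ne (0 : EuclideanSpace ℝ n)
  have h1 := h.mul_norm_le z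
  have h2 := (Matrix.toEuclideanCLM (n := n) (𝕜 := ℝ) X).le_opNorm z
  rw [Matrix.l2_opNorm_toEuclideanCLM] at h2
  exact le_of_mul_le_mul_right (h1.trans h2) (norm_pos_iff.mpr hz)

theorem MatrixCoercive.one_le_norm_mul [Nonempty n] (h : MatrixCoercive κ X) (hκ : 0 < κ) :
    1 ≤ ‖X‖ * ‖X⁻¹‖ := by
  have h1 := Matrix.l2_opNorm_mul X X⁻¹
  rw [Matrix.mul_nonsing_inv _ (h.isUnit_det hκ)] at h1
  have h2 : ‖(1 : Matrix n n ℝ)‖ = 1 := by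
    rw [← Matrix.diagonal_one, Matrix.l2_opNorm_diagonal]
    exact norm_one
  linarith

end MatrixNorm

/-! ### Consequences of the feature condition. -/

section Features

theorem inner_feature {S : Type*} {d : ℕ} {Φ : Matrix S (Fin d) ℝ} (x : S)
    (z : EuclideanSpace ℝ (Fin d)) :
    inner ℝ (feature Φ x) z = (Φ *ᵥ z.ofLp) x := by
  simp only [feature, Matrix.mulVec, dotProduct, PiLp.inner_apply, RCLike.inner_apply, conj_trivial]
  exact Finset.sum_congr rfl fun k _ => mul_comm _ _

variable {S : Type*} [Fintype S] {d : ℕ} {Φ : Matrix S (Fin d) ℝ}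

theorem FeatureCondition.norm_feature_le (h : FeatureCondition Φ) (x : S) : ‖feature Φ x‖ ≤ 1 := by
  rw [← h.2, EuclideanSpace.norm_eq]
  refine Real.sqrt_le_sqrt ?_
  simp only [Real.norm_eq_abs, sq_abs, feature]
  exact Finset.single_le_sum (f := fun s => ∑ k, Φ s k ^ 2)
    (fun s _ => Finset.sum_nonneg fun k _ => sq_nonneg _) (Finset.mem_univ x)

theorem FeatureCondition.nonempty (h : FeatureCondition Φ) : Nonempty S ∧ Nonempty (Fin d) := by
  constructor
  · by_contra hS
    rw [not_nonempty_iff] at hS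
    have := h.2
    simp at this
  · by_contra hd
    rw [not_nonempty_iff] at hd
    have := h.2
    simp at this

theorem FeatureCondition.norm_le (h : FeatureCondition Φ) : ‖Φ‖ ≤ 1 :=
  (l2_opNorm_le_frobenius Φ).trans h.2.le

/-- Full column rank makes `Φ` injective, and an injective linear map in finite dimension is bounded
below. The constant depends on `Φ` only. -/
theorem FeatureCondition.exists_sum_sq_ge (h : FeatureCondition Φ) :
    ∃ σ > 0, ∀ z : EuclideanSpace ℝ (Fin d), σ * ‖z‖ ^ 2 ≤ ∑ x, inner ℝ (feature Φ x) z ^ 2 := by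
  have hker : LinearMap.ker (Matrix.toEuclideanLin (𝕜 := ℝ) Φ) = ⊥ := by
    have h1 := LinearMap.finrank_range_add_finrank_ker Φ.mulVecLin
    have h2 : Module.finrank ℝ (LinearMap.range Φ.mulVecLin) = d := h.1
    rw [h2, Module.finrank_fin_fun] at h1
    have h3 : LinearMap.ker Φ.mulVecLin = ⊥ := by
      rw [← Submodule.finrank_eq_zero (R := ℝ)]
      omega
    rw [LinearMap.ker_eq_bot'] at h3 ⊢
    intro z hz
    have h4 := h3 z.ofLp (by simpa using congrArg WithLp.ofLp hz)
    ext k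
    exact congrFun h4 k
  obtain ⟨K, hK, hanti⟩ := LinearMap.exists_antilipschitzWith _ hker
  have hK' : (0 : ℝ) < K := hK
  refine ⟨1 / (K : ℝ) ^ 2, by positivity, fun z => ?_⟩
  have h1 := hanti.le_mul_dist z 0
  rw [map_zero, dist_zero_right, dist_zero_right] at h1
  have h2 : ‖Matrix.toEuclideanLin (𝕜 := ℝ) Φ z‖ ^ 2 = ∑ x, inner ℝ (feature Φ x) z ^ 2 := by
    rw [EuclideanSpace.norm_eq, Real.sq_sqrt (by positivity)]
    refine Finset.sum_congr rfl fun x _ => ?_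
    rw [inner_feature, Real.norm_eq_abs, sq_abs]
    rfl
  rw [← h2, one_div, inv_mul_le_iff₀ (by positivity), ← mul_pow]
  exact pow_le_pow_left₀ (norm_nonneg z) h1 2

end Features

/-! ### Elementary bounds on the gap functions. -/

section Gaps

theorem Cd_nonneg (n : ℕ) {ε : ℝ} (hε₀ : 0 ≤ ε) (hε₁ : ε < 1) : 0 ≤ Cd n ε := by
  have h : 1 ≤ (1 + ε) / (1 - ε) := by
    rw [le_div_iff₀ (by linarith)]
    linarith
  rw [Cd, sub_nonneg]
  exact one_le_pow₀ h

theorem UpsGap_nonneg (n : ℕ) {ε : ℝ} (hε₀ : 0 ≤ ε) (hε₁ : ε < 1) : 0 ≤ UpsGap n ε := by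
  have := Cd_nonneg n hε₀ hε₁
  rw [UpsGap]
  positivity

theorem bGap_nonneg (n : ℕ) {Rmax εp εr : ℝ} (hR : 0 ≤ Rmax) (hε₀ : 0 ≤ εp) (hε₁ : εp < 1)
    (hεr : 0 ≤ εr) : 0 ≤ bGap n Rmax εp εr := by
  have := Cd_nonneg n hε₀ hε₁
  rw [bGap]
  positivity

/-- At `ε = 1/3` the ratio `(1 + ε) / (1 - ε)` equals `2`, and its powers are no smaller. -/
theorem lt_one_third_of_Cd_lt {n : ℕ} (hn : 0 < n) {ε : ℝ} (hε₁ : ε < 1)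
    (h : Cd n ε < 1) : ε < 1 / 3 := by
  by_contra! hcon
  have h1 : 2 ≤ (1 + ε) / (1 - ε) := by
    rw [le_div_iff₀ (by linarith)]
    linarith
  have h2 : (1 + ε) / (1 - ε) ≤ ((1 + ε) / (1 - ε)) ^ n := le_self_pow₀ (by linarith) hn.ne'
  rw [Cd] at h
  linarith

end Gaps

/-! ### How `Υ_i` and `b_i` vary with the agent. -/

section Perturbation

theorem MDPs.abs_Rμ_sub_le {S A : Type*} [Fintype S] [Fintype A] {N : ℕ} {M : MDPs S A N}
    {μ : S → stdSimplex ℝ A} {εp εr : ℝ} (h : M.HeterogeneityBound μ εp εr) (i j : Fin N) (x : S) :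
    |M.Rμ μ i x - M.Rμ μ j x| ≤ εr := by
  have h1 : ∀ a, |M.R i x a - M.R j x a| ≤ εr := by
    intro a
    refine le_trans ?_ (h i j).2
    refine Real.abs_le_sqrt ?_
    calc (M.R i x a - M.R j x a) ^ 2 ≤ ∑ a, (M.R i x a - M.R j x a) ^ 2 :=
          Finset.single_le_sum (f := fun a => (M.R i x a - M.R j x a) ^ 2)
            (fun a _ => sq_nonneg _) (Finset.mem_univ a)
      _ ≤ _ := Finset.single_le_sum (f := fun s => ∑ a, (M.R i s a - M.R j s a) ^ 2)
            (fun s _ => Finset.sum_nonneg fun a _ => sq_nonneg _) (Finset.mem_univ x)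
  rw [Rμ, Rμ, ← Finset.sum_sub_distrib]
  calc _ ≤ ∑ a, |μ x a * M.R i x a - μ x a * M.R j x a| := Finset.abs_sum_le_sum_abs _ _
    _ ≤ ∑ a, μ x a * εr := by
      refine Finset.sum_le_sum fun a _ => ?_
      rw [← mul_sub, abs_mul, abs_of_nonneg (stdSimplex.zero_le _ _)]
      exact mul_le_mul_of_nonneg_left (h1 a) (stdSimplex.zero_le _ _)
    _ = εr := by rw [← Finset.sum_mul, stdSimplex.sum_eq_one, one_mul]

variable {S A : Type*} [Fintype S] [DecidableEq S] [Fintype A] {N d : ℕ}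
  {M : MDPs S A N} {μ : S → stdSimplex ℝ A} {Φ : Matrix S (Fin d) ℝ} {γ Rmax : ℝ}

theorem MDPs.coercive_Ups [Nonempty S] (hγ₀ : 0 ≤ γ) (hγ₁ : γ ≤ 1) {σ c : ℝ} {i : Fin N}
    (hσ : ∀ z : EuclideanSpace ℝ (Fin d), σ * ‖z‖ ^ 2 ≤ ∑ x, inner ℝ (feature Φ x) z ^ 2)
    (hc₀ : 0 ≤ c) (hc : ∀ x, c ≤ stationaryDist (M.Pμ μ i) x) :
    MatrixCoercive ((1 - γ) * (c * σ)) (M.Ups μ Φ γ i) := by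
  intro z
  refine le_trans ?_ (M.inner_Ups_ge μ hγ₀ i z)
  have hγ : 0 ≤ 1 - γ := by linarith
  calc (1 - γ) * (c * σ) * ‖z‖ ^ 2 = (1 - γ) * (c * (σ * ‖z‖ ^ 2)) := by ring
    _ ≤ (1 - γ) * (c * ∑ x, inner ℝ (feature Φ x) z ^ 2) := by
      gcongr
      exact hσ z
    _ ≤ _ := by
      rw [Finset.mul_sum]
      gcongr with x
      exact hc x

theorem norm_one_sub_smul_le [Nonempty S] {P : Matrix S S ℝ} (hP : P ∈ Matrix.rowStochastic ℝ S)
    (hγ₀ : 0 ≤ γ) : ‖1 - γ • P‖ ≤ 1 + γ * Real.sqrt (Fintype.card S) := by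
  have h1 : ‖(1 : Matrix S S ℝ)‖ = 1 := by
    rw [← Matrix.diagonal_one, Matrix.l2_opNorm_diagonal]
    exact norm_one
  have h2 : ‖P‖ ≤ 1 * Real.sqrt (Fintype.card S) := by
    refine l2_opNorm_le_of_abs_le hP zero_le_one fun x y => ?_
    rw [one_mul, abs_of_nonneg ((Matrix.mem_rowStochastic_iff_sum.mp hP).1 x y)]
  calc ‖1 - γ • P‖ ≤ ‖(1 : Matrix S S ℝ)‖ + ‖γ • P‖ := norm_sub_le _ _
    _ ≤ _ := by
      rw [h1, norm_smul, Real.norm_of_nonneg hγ₀]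
      have := mul_le_mul_of_nonneg_left h2 hγ₀
      linarith

theorem norm_conj_le (hΦ : ‖Φ‖ ≤ 1) (X : Matrix S S ℝ) : ‖Φᵀ * X * Φ‖ ≤ ‖X‖ := by
  have h1 : ‖Φᵀ‖ ≤ 1 := by
    rw [← Matrix.conjTranspose_eq_transpose_of_trivial, Matrix.l2_opNorm_conjTranspose]
    exact hΦ
  calc ‖Φᵀ * X * Φ‖ ≤ ‖Φᵀ‖ * ‖X‖ * ‖Φ‖ := (Matrix.l2_opNorm_mul _ _).trans
        (mul_le_mul_of_nonneg_right (Matrix.l2_opNorm_mul _ _) (norm_nonneg _))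
    _ ≤ 1 * ‖X‖ * 1 := by gcongr
    _ = ‖X‖ := by ring

theorem norm_diagonal_le {v : S → ℝ} {C : ℝ} (hC : 0 ≤ C) (h : ∀ x, |v x| ≤ C) :
    ‖Matrix.diagonal v‖ ≤ C := by
  rw [Matrix.l2_opNorm_diagonal]
  exact (pi_norm_le_iff_of_nonneg hC).mpr h

theorem MDPs.norm_Ups_le [Nonempty S] (hΦ : ‖Φ‖ ≤ 1) (hγ₀ : 0 ≤ γ) (i : Fin N) :
    ‖M.Ups μ Φ γ i‖ ≤ 1 + γ * Real.sqrt (Fintype.card S) := by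
  have hP := M.Pμ_mem_rowStochastic μ i
  have hq := isStationary_stationaryDist hP
  rw [Ups, Matrix.mul_assoc Φᵀ]
  refine (norm_conj_le hΦ _).trans ((Matrix.l2_opNorm_mul _ _).trans ?_)
  have h1 := norm_diagonal_le (v := stationaryDist (M.Pμ μ i)) zero_le_one fun x => by
    rw [abs_of_nonneg (hq.nonneg x)]
    exact hq.le_one x
  have h2 := norm_one_sub_smul_le hP hγ₀
  calc _ ≤ 1 * ‖1 - γ • M.Pμ μ i‖ := by gcongr
    _ ≤ _ := by rwa [one_mul]

theorem MDPs.Ergodic.abs_stationaryDist_sub_le [Nonempty S] (herg : M.Ergodic μ) {εp εr : ℝ}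
    (hε₀ : 0 ≤ εp) (hε₁ : εp < 1) (h : M.HeterogeneityBound μ εp εr) (i j : Fin N) (x : S) :
    |stationaryDist (M.Pμ μ j) x - stationaryDist (M.Pμ μ i) x| ≤ Cd (Fintype.card S) εp := by
  have hPi := M.Pμ_mem_rowStochastic μ i
  have hPj := M.Pμ_mem_rowStochastic μ j
  have hqi := isStationary_stationaryDist hPi
  have hqj := isStationary_stationaryDist hPj
  obtain ⟨h1, h2⟩ := stationary_ratio hPi (herg i).1 hPj hqi hqj hε₀ hε₁ (h i j).1 x
  have hC := Cd_nonneg (Fintype.card S) hε₀ hε₁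
  have hpow : ((1 + εp) / (1 - εp)) ^ Fintype.card S = 1 + Cd (Fintype.card S) εp := by
    rw [Cd]; ring
  rw [hpow] at h1 h2
  have h3 := mul_le_of_le_one_right hC (hqi.le_one x)
  have h4 := mul_le_of_le_one_right hC (hqj.le_one x)
  rw [abs_le]
  constructor <;> linarith

/-- Change `D` and `P` one after the other. Both discount factors are kept: they make this bound
smaller than `UpsGap` by a factor `ρ < 1`, the slack on which the coefficient one of the
heterogeneity gap rests. -/
theorem MDPs.norm_Ups_sub_le [Nonempty S] (hΦ : ‖Φ‖ ≤ 1) (hγ₀ : 0 ≤ γ) (herg : M.Ergodic μ)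
    {εp εr : ℝ} (hε₀ : 0 ≤ εp) (hε₁ : εp < 1) (h : M.HeterogeneityBound μ εp εr) (i j : Fin N) :
    ‖M.Ups μ Φ γ i - M.Ups μ Φ γ j‖ ≤
      Cd (Fintype.card S) εp * (1 + γ * Real.sqrt (Fintype.card S)) +
        γ * (εp * Real.sqrt (Fintype.card S)) := by
  have hPi := M.Pμ_mem_rowStochastic μ i
  have hPj := M.Pμ_mem_rowStochastic μ j
  have hqi := isStationary_stationaryDist hPi
  have hC := Cd_nonneg (Fintype.card S) hε₀ hε₁
  set Di := Matrix.diagonal (stationaryDist (M.Pμ μ i)) with hDi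
  set Dj := Matrix.diagonal (stationaryDist (M.Pμ μ j)) with hDj
  have e : M.Ups μ Φ γ i - M.Ups μ Φ γ j = Φᵀ * ((Di - Dj) * (1 - γ • M.Pμ μ j) +
      Di * (γ • (M.Pμ μ j - M.Pμ μ i))) * Φ := by
    rw [Ups, Ups, ← hDi, ← hDj, ← Matrix.sub_mul, Matrix.mul_assoc Φᵀ, Matrix.mul_assoc Φᵀ,
      ← Matrix.mul_sub]
    congr 2
    simp only [smul_sub, Matrix.mul_sub, Matrix.sub_mul, Matrix.mul_one]
    abel
  rw [e]
  refine (norm_conj_le hΦ _).trans ((norm_add_le _ _).trans (add_le_add ?_ ?_))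
  · refine (Matrix.l2_opNorm_mul _ _).trans ?_
    have h1 : ‖Di - Dj‖ ≤ Cd (Fintype.card S) εp := by
      rw [hDi, hDj, Matrix.diagonal_sub]
      exact norm_diagonal_le hC fun x => herg.abs_stationaryDist_sub_le hε₀ hε₁ h j i x
    exact mul_le_mul h1 (norm_one_sub_smul_le hPj hγ₀) (norm_nonneg _) hC
  · refine (Matrix.l2_opNorm_mul _ _).trans ?_
    have h1 : ‖Di‖ ≤ 1 := norm_diagonal_le zero_le_one fun x => by
      rw [abs_of_nonneg (hqi.nonneg x)]
      exact hqi.le_one x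
    have h2 : ‖M.Pμ μ j - M.Pμ μ i‖ ≤ εp * Real.sqrt (Fintype.card S) := by
      refine l2_opNorm_le_of_abs_le hPi hε₀ fun x y => ?_
      rw [Matrix.sub_apply, abs_sub_comm]
      exact (h i j).1 x y
    rw [norm_smul, Real.norm_of_nonneg hγ₀]
    calc _ ≤ 1 * (γ * ‖M.Pμ μ j - M.Pμ μ i‖) := by gcongr
      _ ≤ _ := by rw [one_mul]; gcongr

theorem MDPs.norm_b_le [Nonempty S] (hΦ : ∀ x, ‖feature Φ x‖ ≤ 1) (hR : M.RewardBound Rmax)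
    (i : Fin N) : ‖M.b μ Φ i‖ ≤ Rmax := by
  have hq := isStationary_stationaryDist (M.Pμ_mem_rowStochastic μ i)
  rw [b_eq]
  calc _ ≤ ∑ x, stationaryDist (M.Pμ μ i) x * Rmax := by
        refine (norm_sum_le _ _).trans (Finset.sum_le_sum fun x _ => ?_)
        rw [norm_smul, Real.norm_of_nonneg (hq.nonneg x), norm_smul, Real.norm_eq_abs]
        refine mul_le_mul_of_nonneg_left ?_ (hq.nonneg x)
        exact (mul_le_of_le_one_right (abs_nonneg _) (hΦ x)).trans (M.abs_Rμ_le μ hR i x)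
    _ = Rmax := by rw [← Finset.sum_mul, hq.sum_eq_one, one_mul]

theorem MDPs.norm_b_sub_le [Nonempty S] (hΦ : ‖Φ‖ ≤ 1) (herg : M.Ergodic μ)
    (hR : M.RewardBound Rmax) (hRmax : 0 ≤ Rmax) {εp εr : ℝ} (hε₀ : 0 ≤ εp) (hε₁ : εp < 1)
    (hεr : 0 ≤ εr) (h : M.HeterogeneityBound μ εp εr) (i j : Fin N) :
    ‖M.b μ Φ i - M.b μ Φ j‖ ≤ bGap (Fintype.card S) Rmax εp εr := by
  have hqi := isStationary_stationaryDist (M.Pμ_mem_rowStochastic μ i)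
  have hC := Cd_nonneg (Fintype.card S) hε₀ hε₁
  set v : S → ℝ := fun x => stationaryDist (M.Pμ μ i) x * M.Rμ μ i x -
    stationaryDist (M.Pμ μ j) x * M.Rμ μ j x with hv
  have hvb : ∀ x, |v x| ≤ εr + Cd (Fintype.card S) εp * Rmax := by
    intro x
    have e : v x = stationaryDist (M.Pμ μ i) x * (M.Rμ μ i x - M.Rμ μ j x) +
        (stationaryDist (M.Pμ μ i) x - stationaryDist (M.Pμ μ j) x) * M.Rμ μ j x := by
      simp only [hv]; ring
    rw [e]
    refine (abs_add_le _ _).trans (add_le_add ?_ ?_)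
    · rw [abs_mul, abs_of_nonneg (hqi.nonneg x)]
      exact (mul_le_of_le_one_left (abs_nonneg _) (hqi.le_one x)).trans (abs_Rμ_sub_le h i j x)
    · rw [abs_mul]
      exact mul_le_mul (herg.abs_stationaryDist_sub_le hε₀ hε₁ h j i x) (M.abs_Rμ_le μ hR j x)
        (abs_nonneg _) hC
  have e : M.b μ Φ i - M.b μ Φ j = WithLp.toLp 2 (Φᵀ *ᵥ v) := by
    rw [b, b, ← WithLp.toLp_sub, ← Matrix.mulVec_sub]
    congr 2
    funext x
    simp only [hv, Pi.sub_apply, Matrix.mulVec_diagonal]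
  have h1 : ‖Φᵀ‖ ≤ 1 := by
    rw [← Matrix.conjTranspose_eq_transpose_of_trivial, Matrix.l2_opNorm_conjTranspose]
    exact hΦ
  rw [e]
  refine (Matrix.l2_opNorm_mulVec Φᵀ (WithLp.toLp 2 v)).trans
    ((mul_le_of_le_one_left (norm_nonneg _) h1).trans ?_)
  rw [EuclideanSpace.norm_eq, bGap]
  have hs : 0 ≤ εr + Cd (Fintype.card S) εp * Rmax := by positivity
  rw [← Real.sqrt_sq hs, ← Real.sqrt_mul (Nat.cast_nonneg _)]
  refine Real.sqrt_le_sqrt ?_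
  calc ∑ x, ‖v x‖ ^ 2 ≤ ∑ _x : S, (εr + Cd (Fintype.card S) εp * Rmax) ^ 2 :=
        Finset.sum_le_sum fun x _ => pow_le_pow_left₀ (norm_nonneg _) (hvb x) 2
    _ = _ := by
      rw [Finset.sum_const, Finset.card_univ, nsmul_eq_mul]

end Perturbation

/-- Here `Y` and `I` are the norms of `Υ_i` and its inverse, `t` and `b` those of the local solution
and of `b_i`, and `e` is the distance to be bounded. Multiplying `he` by `Y` and absorbing the part
linear in `e` gives `e (Y - Y I g) ≤ Y I Y t (ρ x + y)` with relative perturbations `x = g / Y`, `y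
= h / b`. Then `(ρ x + y)² ≤ (1 + ρ²)(x² + y²)` beats the naive factor `2`. -/
theorem perturbation_sq_le {Y I g ρ e t b h : ℝ} (hI : 0 ≤ I) (hg : 0 ≤ g) (hρ₁ : ρ ≤ 1)
    (he₀ : 0 ≤ e) (hb₀ : 0 < b) (hh : 0 ≤ h) (hY : 0 < Y)
    (hsmall : Y * I * g < Y) (hb : b ≤ Y * t) (he : e ≤ I * (ρ * g * (e + t) + h)) :
    2 / (1 + ρ ^ 2) * e ^ 2 ≤
      2 * (Y * I) ^ 2 * Y ^ 2 * t ^ 2 / (Y - Y * I * g) ^ 2 * (g ^ 2 / Y ^ 2 + h ^ 2 / b ^ 2) := by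
  set D := Y - Y * I * g with hD
  have hD0 : 0 < D := by rw [hD]; linarith
  set x := g / Y with hx
  set y := h / b with hy
  have hy0 : 0 ≤ y := by positivity
  have hgx : g = x * Y := by rw [hx]; field_simp
  have hhy : h ≤ y * (Y * t) := by
    calc h = y * b := by rw [hy]; field_simp
      _ ≤ _ := by gcongr
  have h1 : e * D ≤ Y * I * Y * t * (ρ * x + y) := by
    have h2 : Y * e ≤ Y * (I * (ρ * g * (e + t) + h)) := by gcongr
    have h3 : Y * I * h ≤ Y * I * (y * (Y * t)) := by gcongr
    have h4 : Y * I * g * e * ρ ≤ Y * I * g * e * 1 := by gcongr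
    have h5 : Y * I * ρ * g * t = Y * I * ρ * (x * Y) * t := by rw [← hgx]
    have h6 : e * D = Y * e - Y * I * g * e := by rw [hD]; ring
    linarith
  have h2 : (e * D) ^ 2 ≤ (Y * I * Y * t) ^ 2 * ((1 + ρ ^ 2) * (x ^ 2 + y ^ 2)) := by
    calc (e * D) ^ 2 ≤ (Y * I * Y * t * (ρ * x + y)) ^ 2 :=
          pow_le_pow_left₀ (mul_nonneg he₀ hD0.le) h1 2
      _ = (Y * I * Y * t) ^ 2 * (ρ * x + y) ^ 2 := by ring
      _ ≤ _ := by
        gcongr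
        linarith [sq_nonneg (x - ρ * y)]
  have hρ2 : 0 < 1 + ρ ^ 2 := by positivity
  have h3 : g ^ 2 / Y ^ 2 + h ^ 2 / b ^ 2 = x ^ 2 + y ^ 2 := by rw [hx, hy, div_pow, div_pow]
  rw [h3, div_mul_eq_mul_div, div_mul_eq_mul_div, div_le_div_iff₀ hρ2 (by positivity)]
  linarith

/-! ### Distance between the averaged and the local solutions. -/

section Comparison

variable {S A : Type*} [Fintype S] [DecidableEq S] [Fintype A] {N d : ℕ}
  {M : MDPs S A N} {μ : S → stdSimplex ℝ A} {Φ : Matrix S (Fin d) ℝ} {γ Rmax κ : ℝ}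

theorem MDPs.Ergodic.exists_coercive_Ups (herg : M.Ergodic μ) (hΦ : FeatureCondition Φ)
    (hγ₀ : 0 ≤ γ) (hγ₁ : γ < 1) (i : Fin N) : ∃ κ > 0, MatrixCoercive κ (M.Ups μ Φ γ i) := by
  obtain ⟨hS, -⟩ := hΦ.nonempty
  obtain ⟨σ, hσ, hσΦ⟩ := hΦ.exists_sum_sq_ge
  have hq := isStationary_stationaryDist (M.Pμ_mem_rowStochastic μ i)
  obtain ⟨x, hx⟩ := Finite.exists_min (stationaryDist (M.Pμ μ i))
  have hpos := hq.pos (herg i).1 x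
  have hγ : 0 < 1 - γ := by linarith
  exact ⟨_, by positivity, MDPs.coercive_Ups hγ₀ hγ₁.le hσΦ hpos.le hx⟩

theorem MDPs.SmallPerturbation.UpsGap_lt (herg : M.Ergodic μ) (hΦ : FeatureCondition Φ)
    (hγ₀ : 0 ≤ γ) (hγ₁ : γ < 1) {εp : ℝ} (hε₀ : 0 ≤ εp) (hε₁ : εp < 1)
    (h : M.SmallPerturbation μ Φ γ εp) (i : Fin N) :
    UpsGap (Fintype.card S) εp < ‖M.Ups μ Φ γ i‖ := by
  obtain ⟨-, hd⟩ := hΦ.nonempty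
  obtain ⟨κ, hκ, hcoer⟩ := herg.exists_coercive_Ups hΦ hγ₀ hγ₁ i
  refine lt_of_le_of_lt ?_ (h i)
  exact le_mul_of_one_le_left (UpsGap_nonneg _ hε₀ hε₁) (hcoer.one_le_norm_mul hκ)

/-- A condition number is at least one, so `UpsGap < ‖Υ_i‖ ≤ 1 + √n`; the summand `Cd (1 + √n)` of
`UpsGap` then forces `Cd < 1`. -/
theorem MDPs.SmallPerturbation.lt_one_third (herg : M.Ergodic μ) (hΦ : FeatureCondition Φ)
    (hγ₀ : 0 ≤ γ) (hγ₁ : γ < 1) {εp : ℝ} (hε₀ : 0 ≤ εp) (hε₁ : εp < 1)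
    (h : M.SmallPerturbation μ Φ γ εp) (i : Fin N) : εp < 1 / 3 := by
  obtain ⟨hS, -⟩ := hΦ.nonempty
  have hn : 0 < Fintype.card S := Fintype.card_pos
  have h1 := h.UpsGap_lt herg hΦ hγ₀ hγ₁ hε₀ hε₁ i
  have h2 := M.norm_Ups_le (μ := μ) hΦ.norm_le hγ₀ i
  refine lt_one_third_of_Cd_lt hn hε₁ ?_
  set r := Real.sqrt (Fintype.card S) with hr
  have hr0 : 0 ≤ r := Real.sqrt_nonneg _
  have h3 : γ * r ≤ r := mul_le_of_le_one_left hr0 hγ₁.le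
  have h4 : Cd (Fintype.card S) εp * (1 + r) < 1 * (1 + r) := by
    have h5 : 0 ≤ εp * r := by positivity
    rw [UpsGap] at h1
    linarith
  exact lt_of_mul_lt_mul_right h4 (by positivity)

/-- Coercivity, unlike mere invertibility, is inherited by averages. -/
theorem MDPs.exists_averaged_solution (hN : 0 < N) (hκ : 0 < κ)
    (hcoer : ∀ i, MatrixCoercive κ (M.Ups μ Φ γ i)) {B : ℝ} (hB : ∀ i, ‖M.b μ Φ i‖ ≤ B) :
    ∃ w, ∑ i, M.b μ Φ i =
      ∑ i, Matrix.toEuclideanCLM (n := Fin d) (𝕜 := ℝ) (M.Ups μ Φ γ i) w ∧ ‖w‖ ≤ B / κ := by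
  have hN' : (0 : ℝ) < N := by exact_mod_cast hN
  have hU : ∀ z, κ * ‖z‖ ^ 2 ≤ inner ℝ z (M.UpsAvg μ Φ γ z) := by
    intro z
    rw [UpsAvg_apply, real_inner_smul_right, inner_sum]
    calc κ * ‖z‖ ^ 2 = 1 / (N : ℝ) * ∑ _i : Fin N, κ * ‖z‖ ^ 2 := by
          rw [Finset.sum_const, Finset.card_univ, Fintype.card_fin, nsmul_eq_mul]
          field_simp
      _ ≤ _ := by
          gcongr with i
          exact hcoer i z
  have hU' : ∀ z, κ * ‖z‖ ≤ ‖M.UpsAvg μ Φ γ z‖ := by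
    intro z
    rcases (norm_nonneg z).eq_or_lt with hz | hz
    · rw [← hz, mul_zero]
      exact norm_nonneg _
    · have h1 := (hU z).trans (real_inner_le_norm _ _)
      rw [sq, ← mul_assoc, mul_comm ‖z‖ ‖_‖] at h1
      exact le_of_mul_le_mul_right h1 hz
  have hinj : Function.Injective (M.UpsAvg μ Φ γ) := by
    rw [← LinearMap.ker_eq_bot, LinearMap.ker_eq_bot']
    intro z hz
    have h1 := hU' z
    rw [hz, norm_zero] at h1
    rw [← norm_eq_zero]
    nlinarith [norm_nonneg z]
  obtain ⟨w, hw⟩ := (LinearMap.injective_iff_surjective.mp hinj)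
    ((1 / (N : ℝ)) • ∑ i, M.b μ Φ i)
  refine ⟨w, ?_, ?_⟩
  · rw [UpsAvg_apply] at hw
    exact (smul_right_injective _ (one_div_ne_zero hN'.ne') hw).symm
  · have h1 := hU' w
    rw [hw] at h1
    rw [le_div_iff₀ hκ, mul_comm]
    exact h1.trans (norm_average_le hN hB)

theorem toEuclideanCLM_inv_apply {X : Matrix (Fin d) (Fin d) ℝ} (hX : IsUnit X.det)
    (z : EuclideanSpace ℝ (Fin d)) :
    Matrix.toEuclideanCLM (n := Fin d) (𝕜 := ℝ) X⁻¹
      (Matrix.toEuclideanCLM (n := Fin d) (𝕜 := ℝ) X z) = z := by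
  rw [← mul_apply_eq_comp, ← map_mul, Matrix.nonsing_inv_mul _ hX, map_one]
  rfl

theorem MDPs.localSol_eq (M : MDPs S A N) (μ : S → stdSimplex ℝ A) (Φ : Matrix S (Fin d) ℝ)
    (γ : ℝ) (i : Fin N) : M.localSol μ Φ γ i =
      Matrix.toEuclideanCLM (n := Fin d) (𝕜 := ℝ) (M.Ups μ Φ γ i)⁻¹ (M.b μ Φ i) := rfl

theorem MDPs.Ups_localSol (i : Fin N) (hX : IsUnit (M.Ups μ Φ γ i).det) :
    Matrix.toEuclideanCLM (n := Fin d) (𝕜 := ℝ) (M.Ups μ Φ γ i) (M.localSol μ Φ γ i) =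
      M.b μ Φ i := by
  rw [localSol_eq, ← mul_apply_eq_comp, ← map_mul, Matrix.mul_nonsing_inv _ hX, map_one]
  rfl

theorem MDPs.norm_localSol_le (M : MDPs S A N) (μ : S → stdSimplex ℝ A) (Φ : Matrix S (Fin d) ℝ)
    (γ : ℝ) (i : Fin N) : ‖M.localSol μ Φ γ i‖ ≤ ‖(M.Ups μ Φ γ i)⁻¹‖ * ‖M.b μ Φ i‖ := by
  rw [localSol_eq, ← Matrix.l2_opNorm_toEuclideanCLM]
  exact ContinuousLinearMap.le_opNorm _ _

/-- The contribution of the agent `i` to `hetGap`. -/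
noncomputable def MDPs.agentGap (M : MDPs S A N) (μ : S → stdSimplex ℝ A)
    (Φ : Matrix S (Fin d) ℝ) (γ Rmax εp εr : ℝ) (i : Fin N) : ℝ :=
  2 * condNumber (M.Ups μ Φ γ i) ^ 2 * ‖M.Ups μ Φ γ i‖ ^ 2 * ‖M.localSol μ Φ γ i‖ ^ 2 /
      (‖M.Ups μ Φ γ i‖ - condNumber (M.Ups μ Φ γ i) * UpsGap (Fintype.card S) εp) ^ 2 *
    (UpsGap (Fintype.card S) εp ^ 2 / ‖M.Ups μ Φ γ i‖ ^ 2 +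
      bGap (Fintype.card S) Rmax εp εr ^ 2 / ‖M.b μ Φ i‖ ^ 2)

theorem MDPs.agentGap_le_hetGap (M : MDPs S A N) (μ : S → stdSimplex ℝ A)
    (Φ : Matrix S (Fin d) ℝ) (γ Rmax εp εr : ℝ) (i : Fin N) :
    M.agentGap μ Φ γ Rmax εp εr i ≤ M.hetGap μ Φ γ Rmax εp εr :=
  le_ciSup (f := M.agentGap μ Φ γ Rmax εp εr) (Set.finite_range _).bddAbove i

/-- The residual `Υ_i w - b_i` is an average of differences between agents, and `Υ_i⁻¹` maps it to
`w` minus the local solution. Since `‖w‖` is bounded by that same distance plus the norm of the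
local solution, the estimate is implicit and is resolved by `perturbation_sq_le`. -/
theorem MDPs.norm_sub_localSol_le (herg : M.Ergodic μ) (hΦ : FeatureCondition Φ)
    (hγ₀ : 0 ≤ γ) (hγ₁ : γ < 1) (hR : M.RewardBound Rmax) (hRmax : 0 ≤ Rmax) {εp εr : ℝ}
    (hε₀ : 0 ≤ εp) (hε₁ : εp < 1) (hεr : 0 ≤ εr) (h : M.HeterogeneityBound μ εp εr)
    (hb : ∀ i, M.b μ Φ i ≠ 0) (hsmall : M.SmallPerturbation μ Φ γ εp)
    {w : EuclideanSpace ℝ (Fin d)} (hw : ∑ i, M.b μ Φ i =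
      ∑ i, Matrix.toEuclideanCLM (n := Fin d) (𝕜 := ℝ) (M.Ups μ Φ γ i) w) {ρ : ℝ}
    (hρ₁ : ρ ≤ 1)
    (hρ : 1 + γ * Real.sqrt (Fintype.card S) = ρ * (1 + Real.sqrt (Fintype.card S)))
    (hγρ : γ ≤ ρ) (i : Fin N) :
    2 / (1 + ρ ^ 2) * ‖w - M.localSol μ Φ γ i‖ ^ 2 ≤ M.hetGap μ Φ γ Rmax εp εr := by
  obtain ⟨hS, hd⟩ := hΦ.nonempty
  have hN : 0 < N := i.pos
  have hN' : (N : ℝ) ≠ 0 := by exact_mod_cast hN.ne'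
  obtain ⟨κ, hκ, hcoer⟩ := herg.exists_coercive_Ups hΦ hγ₀ hγ₁ i
  have hu := hcoer.isUnit_det hκ
  have hg := UpsGap_nonneg (Fintype.card S) hε₀ hε₁
  have hh := bGap_nonneg (Fintype.card S) hRmax hε₀ hε₁ hεr
  have hY : 0 < ‖M.Ups μ Φ γ i‖ := hκ.trans_le hcoer.le_norm
  refine le_trans ?_ (M.agentGap_le_hetGap μ Φ γ Rmax εp εr i)
  refine perturbation_sq_le (norm_nonneg _) hg hρ₁ (norm_nonneg _)
    (norm_pos_iff.mpr (hb i)) hh hY (hsmall i) ?_ ?_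
  · rw [← MDPs.Ups_localSol i hu, ← Matrix.l2_opNorm_toEuclideanCLM]
    exact ContinuousLinearMap.le_opNorm _ _
  · have hUps : ∀ j, ‖M.Ups μ Φ γ i - M.Ups μ Φ γ j‖ ≤ ρ * UpsGap (Fintype.card S) εp := by
      intro j
      refine (MDPs.norm_Ups_sub_le hΦ.norm_le hγ₀ herg hε₀ hε₁ h i j).trans ?_
      rw [hρ, UpsGap]
      have h1 : γ * (εp * Real.sqrt (Fintype.card S)) ≤ ρ * (εp * Real.sqrt (Fintype.card S)) := by
        gcongr
      linarith
    have e1 : Matrix.toEuclideanCLM (n := Fin d) (𝕜 := ℝ) (M.Ups μ Φ γ i) w - M.b μ Φ i =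
        (1 / (N : ℝ)) • ∑ j, (Matrix.toEuclideanCLM (n := Fin d) (𝕜 := ℝ)
          (M.Ups μ Φ γ i - M.Ups μ Φ γ j) w + (M.b μ Φ j - M.b μ Φ i)) := by
      simp only [map_sub, sub_apply, Finset.sum_add_distrib,
        Finset.sum_sub_distrib, Finset.sum_const, Finset.card_univ, Fintype.card_fin]
      rw [hw, sub_add_sub_cancel, ← smul_sub, ← Nat.cast_smul_eq_nsmul ℝ, smul_smul,
        one_div_mul_cancel hN', one_smul]
    have e2 : ‖Matrix.toEuclideanCLM (n := Fin d) (𝕜 := ℝ) (M.Ups μ Φ γ i) w - M.b μ Φ i‖ ≤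
        ρ * UpsGap (Fintype.card S) εp * ‖w‖ + bGap (Fintype.card S) Rmax εp εr := by
      rw [e1]
      refine norm_average_le hN fun j => (norm_add_le _ _).trans (add_le_add ?_ ?_)
      · refine (ContinuousLinearMap.le_opNorm _ _).trans ?_
        rw [Matrix.l2_opNorm_toEuclideanCLM]
        exact mul_le_mul_of_nonneg_right (hUps j) (norm_nonneg _)
      · exact MDPs.norm_b_sub_le hΦ.norm_le herg hR hRmax hε₀ hε₁ hεr h j i
    have e3 : w - M.localSol μ Φ γ i = Matrix.toEuclideanCLM (n := Fin d) (𝕜 := ℝ)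
        (M.Ups μ Φ γ i)⁻¹
        (Matrix.toEuclideanCLM (n := Fin d) (𝕜 := ℝ) (M.Ups μ Φ γ i) w - M.b μ Φ i) := by
      rw [map_sub, toEuclideanCLM_inv_apply hu, MDPs.localSol_eq]
    have hρ0 : 0 ≤ ρ := hγ₀.trans hγρ
    have e4 : ‖w‖ ≤ ‖w - M.localSol μ Φ γ i‖ + ‖M.localSol μ Φ γ i‖ := by
      simpa using norm_add_le (w - M.localSol μ Φ γ i) (M.localSol μ Φ γ i)
    calc ‖w - M.localSol μ Φ γ i‖ ≤ ‖(M.Ups μ Φ γ i)⁻¹‖ *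
          ‖Matrix.toEuclideanCLM (n := Fin d) (𝕜 := ℝ) (M.Ups μ Φ γ i) w - M.b μ Φ i‖ := by
          rw [← Matrix.l2_opNorm_toEuclideanCLM (M.Ups μ Φ γ i)⁻¹]
          conv_lhs => rw [e3]
          exact ContinuousLinearMap.le_opNorm _ _
      _ ≤ ‖(M.Ups μ Φ γ i)⁻¹‖ *
          (ρ * UpsGap (Fintype.card S) εp * ‖w‖ + bGap (Fintype.card S) Rmax εp εr) := by gcongr
      _ ≤ _ := by gcongr

end Comparison

/-! ### Vanishing of the heterogeneity gap and constants uniform over the agents. -/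

section Vanishing

theorem tendsto_UpsGap (n : ℕ) :
    Tendsto (fun ε : ℝ × ℝ => UpsGap n ε.1) (𝓝 (0, 0)) (𝓝 0) := by
  have h : ContinuousAt (fun ε : ℝ × ℝ => UpsGap n ε.1) (0, 0) := by
    unfold UpsGap Cd
    have : (1 : ℝ) - ((0, 0) : ℝ × ℝ).1 ≠ 0 := by norm_num
    fun_prop (disch := assumption)
  simpa [ContinuousAt, UpsGap, Cd] using h

theorem tendsto_bGap (n : ℕ) (Rmax : ℝ) :
    Tendsto (fun ε : ℝ × ℝ => bGap n Rmax ε.1 ε.2) (𝓝 (0, 0)) (𝓝 0) := by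
  have h : ContinuousAt (fun ε : ℝ × ℝ => bGap n Rmax ε.1 ε.2) (0, 0) := by
    unfold bGap Cd
    have : (1 : ℝ) - ((0, 0) : ℝ × ℝ).1 ≠ 0 := by norm_num
    fun_prop (disch := assumption)
  simpa [ContinuousAt, bGap, Cd] using h

variable {S A : Type*} [Fintype S] [DecidableEq S] [Fintype A] {N d : ℕ}
  {M : MDPs S A N} {μ : S → stdSimplex ℝ A} {Φ : Matrix S (Fin d) ℝ} {γ Rmax κ : ℝ}

theorem MDPs.agentGap_nonneg (M : MDPs S A N) (μ : S → stdSimplex ℝ A)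
    (Φ : Matrix S (Fin d) ℝ) (γ Rmax εp εr : ℝ) (i : Fin N) :
    0 ≤ M.agentGap μ Φ γ Rmax εp εr i := by
  unfold agentGap
  positivity

theorem MDPs.tendsto_hetGap (herg : M.Ergodic μ) (hΦ : FeatureCondition Φ)
    (hγ₀ : 0 ≤ γ) (hγ₁ : γ < 1) :
    Tendsto (fun ε : ℝ × ℝ => M.hetGap μ Φ γ Rmax ε.1 ε.2) (𝓝 (0, 0)) (𝓝 0) := by
  obtain ⟨-, hd⟩ := hΦ.nonempty
  have h : ∀ i, Tendsto (fun ε : ℝ × ℝ => M.agentGap μ Φ γ Rmax ε.1 ε.2 i) (𝓝 (0, 0)) (𝓝 0) := by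
    intro i
    obtain ⟨κ, hκ, hcoer⟩ := herg.exists_coercive_Ups hΦ hγ₀ hγ₁ i
    have hY : 0 < ‖M.Ups μ Φ γ i‖ := hκ.trans_le hcoer.le_norm
    have hu := tendsto_UpsGap (Fintype.card S)
    have hb := tendsto_bGap (Fintype.card S) Rmax
    have h1 := ((hu.const_mul (condNumber (M.Ups μ Φ γ i))).const_sub ‖M.Ups μ Φ γ i‖).pow 2
    have h2 := ((hu.pow 2).div_const (‖M.Ups μ Φ γ i‖ ^ 2)).add
      ((hb.pow 2).div_const (‖M.b μ Φ i‖ ^ 2))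
    have h3 := ((tendsto_const_nhds (x := 2 * condNumber (M.Ups μ Φ γ i) ^ 2 *
      ‖M.Ups μ Φ γ i‖ ^ 2 * ‖M.localSol μ Φ γ i‖ ^ 2)).div h1 (by
        rw [mul_zero, sub_zero]
        positivity)).mul h2
    rw [zero_pow two_ne_zero, zero_div, zero_div, add_zero, mul_zero (_ / _)] at h3
    exact h3
  -- The finite supremum of nonnegative terms is dominated by their sum.
  refine squeeze_zero (g := fun ε => ∑ i, M.agentGap μ Φ γ Rmax ε.1 ε.2 i)
    (fun ε => Real.iSup_nonneg fun i => M.agentGap_nonneg μ Φ γ Rmax ε.1 ε.2 i) (fun ε => ?_) ?_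
  · refine Real.iSup_le (fun i => ?_)
      (Finset.sum_nonneg fun i _ => M.agentGap_nonneg μ Φ γ Rmax ε.1 ε.2 i)
    exact Finset.single_le_sum (f := M.agentGap μ Φ γ Rmax ε.1 ε.2)
      (fun i _ => M.agentGap_nonneg μ Φ γ Rmax ε.1 ε.2 i) (Finset.mem_univ i)
  · simpa using tendsto_finsetSum Finset.univ fun i _ => h i

/-- Agent `i₀` has the matrix `Q`, so with `εp ≤ 1/3` every agent's chain dominates `2/3` of `Q` and
inherits its minorization. The minorization also bounds all stationary probabilities below, hence
the coercivity of all `Υ_i`. -/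
theorem exists_uniform_constants (hΦ : FeatureCondition Φ) (μ : S → stdSimplex ℝ A)
    (hγ₀ : 0 ≤ γ) (hγ₁ : γ < 1) (Q : Matrix S S ℝ) :
    ∃ m : ℕ, 0 < m ∧ ∃ c : ℝ, 0 < c ∧ c < 1 ∧ ∃ κ : ℝ, 0 < κ ∧
      ∀ (N : ℕ) (M : MDPs S A N) (εp εr : ℝ), M.Ergodic μ → (∃ i₀, M.Pμ μ i₀ = Q) →
        εp ≤ 1 / 3 → M.HeterogeneityBound μ εp εr →
        (∀ i x y, c ≤ (M.Pμ μ i ^ m) x y) ∧ ∀ i, MatrixCoercive κ (M.Ups μ Φ γ i) := by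
  obtain ⟨hS, -⟩ := hΦ.nonempty
  by_cases hQ : Q ∈ Matrix.rowStochastic ℝ S ∧ Q.IsIrreducible ∧ IsAperiodic Q
  · obtain ⟨m, hm, c, hc₀, hc₁, hmin⟩ := exists_minorization hQ.1 hQ.2.1 hQ.2.2
    obtain ⟨σ, hσ, hσΦ⟩ := hΦ.exists_sum_sq_ge
    have hγ : 0 < 1 - γ := by linarith
    refine ⟨m, hm, c, hc₀, hc₁, (1 - γ) * (c * σ), by positivity, ?_⟩
    rintro N M εp εr - ⟨i₀, hi₀⟩ hε h
    have hlow : ∀ i x y, c ≤ (M.Pμ μ i ^ m) x y := by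
      intro i
      refine hmin _ fun x y => ?_
      have h0 := (Matrix.mem_rowStochastic_iff_sum.mp hQ.1).1 x y
      have h1 := (abs_le.mp ((h i₀ i).1 x y)).2
      rw [hi₀] at h1
      have h2 := mul_le_mul_of_nonneg_right hε h0
      linarith
    exact ⟨hlow, fun i => MDPs.coercive_Ups hγ₀ hγ₁.le hσΦ hc₀.le fun x =>
      (isStationary_stationaryDist (M.Pμ_mem_rowStochastic μ i)).ge_of_minorization (hlow i) x⟩
  -- If `Q` is not an ergodic stochastic matrix, no admissible agent has it, and any constants will
  -- do.
  · refine ⟨1, one_pos, 1 / 2, by norm_num, by norm_num, 1, one_pos, ?_⟩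
    rintro N M εp εr herg ⟨i₀, rfl⟩ - -
    exact absurd ⟨M.Pμ_mem_rowStochastic μ i₀, herg i₀⟩ hQ

/-- Coercivity bounds the condition number by `‖Υ_i‖ / κ`, so the denominator is at least `(‖Υ_i‖ /
2)²`. The local solution is at most `‖b_i‖ / κ`, which cancels the division by `‖b_i‖`; no lower
bound on `b_i` is needed. -/
theorem MDPs.agentGap_le (hΦ : FeatureCondition Φ) (hγ₀ : 0 ≤ γ) (hR : M.RewardBound Rmax)
    {i : Fin N} (hκ : 0 < κ) (hcoer : MatrixCoercive κ (M.Ups μ Φ γ i)) {εp εr : ℝ}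
    (hε₀ : 0 ≤ εp) (hε₁ : εp < 1) (hgap : UpsGap (Fintype.card S) εp ≤ κ / 2) :
    condNumber (M.Ups μ Φ γ i) * UpsGap (Fintype.card S) εp < ‖M.Ups μ Φ γ i‖ ∧
    M.agentGap μ Φ γ Rmax εp εr i ≤ 8 / κ ^ 4 * (Rmax ^ 2 * UpsGap (Fintype.card S) εp ^ 2 +
      (1 + γ * Real.sqrt (Fintype.card S)) ^ 2 * bGap (Fintype.card S) Rmax εp εr ^ 2) := by
  obtain ⟨hS, hd⟩ := hΦ.nonempty
  have hY : 0 < ‖M.Ups μ Φ γ i‖ := hκ.trans_le hcoer.le_norm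
  have hY₁ := M.norm_Ups_le (μ := μ) hΦ.norm_le hγ₀ i
  have hinv := hcoer.norm_inv_le hκ
  have hb := MDPs.norm_b_le (μ := μ) hΦ.norm_feature_le hR i
  have hu := UpsGap_nonneg (Fintype.card S) hε₀ hε₁
  have hk : condNumber (M.Ups μ Φ γ i) ≤ ‖M.Ups μ Φ γ i‖ / κ := by
    rw [condNumber, div_eq_mul_one_div]
    gcongr
  have hk0 : 0 ≤ condNumber (M.Ups μ Φ γ i) := by
    rw [condNumber]
    positivity
  have ht : ‖M.localSol μ Φ γ i‖ ≤ ‖M.b μ Φ i‖ / κ := by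
    refine (M.norm_localSol_le μ Φ γ i).trans ?_
    rw [div_eq_mul_one_div, mul_comm]
    gcongr
  have hku : condNumber (M.Ups μ Φ γ i) * UpsGap (Fintype.card S) εp ≤ ‖M.Ups μ Φ γ i‖ / 2 := by
    calc _ ≤ ‖M.Ups μ Φ γ i‖ / κ * (κ / 2) := by gcongr
      _ = _ := by field_simp
  refine ⟨by linarith, ?_⟩
  rw [agentGap]
  set Y := ‖M.Ups μ Φ γ i‖
  set k := condNumber (M.Ups μ Φ γ i)
  set t := ‖M.localSol μ Φ γ i‖
  set b := ‖M.b μ Φ i‖ with hbdef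
  set u := UpsGap (Fintype.card S) εp
  set h := bGap (Fintype.card S) Rmax εp εr
  have ht0 : 0 ≤ t := norm_nonneg _
  have hb0 : 0 ≤ b := norm_nonneg _
  have h1 : k * t * (u / Y) ≤ Rmax * u / κ ^ 2 := by
    calc k * t * (u / Y) ≤ Y / κ * (Rmax / κ) * (u / Y) := by
          gcongr
          exact ht.trans (by gcongr)
      _ = _ := by field_simp
  have h2 : k * t * (|h| / b) ≤ (1 + γ * Real.sqrt (Fintype.card S)) * |h| / κ ^ 2 := by
    calc k * t * (|h| / b) ≤ ((1 + γ * Real.sqrt (Fintype.card S)) / κ) * (b / κ) * (|h| / b) := by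
          gcongr
          exact hk.trans (by gcongr)
      -- The quotient `b / b` is kept because `b` may be zero; it is at most `1` in any case.
      _ = (1 + γ * Real.sqrt (Fintype.card S)) * |h| / κ ^ 2 * (b / b) := by field_simp
      _ ≤ _ := mul_le_of_le_one_right (by positivity) (div_self_le_one b)
  have h3 : 2 * k ^ 2 * Y ^ 2 * t ^ 2 / (Y - k * u) ^ 2 ≤ 8 * (k * t) ^ 2 := by
    rw [div_le_iff₀ (by
      have : 0 < Y - k * u := by linarith
      positivity)]
    have h4 : (Y / 2) ^ 2 ≤ (Y - k * u) ^ 2 := pow_le_pow_left₀ (by positivity) (by linarith) 2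
    have h5 := mul_le_mul_of_nonneg_left h4 (show 0 ≤ 8 * (k * t) ^ 2 by positivity)
    linarith
  calc _ ≤ 8 * (k * t) ^ 2 * (u ^ 2 / Y ^ 2 + h ^ 2 / b ^ 2) := by gcongr
    _ = 8 * ((k * t * (u / Y)) ^ 2 + (k * t * (|h| / b)) ^ 2) := by
      rw [mul_pow _ (u / Y), mul_pow _ (|h| / b), div_pow, div_pow, sq_abs]
      ring
    _ ≤ 8 * ((Rmax * u / κ ^ 2) ^ 2 +
        ((1 + γ * Real.sqrt (Fintype.card S)) * |h| / κ ^ 2) ^ 2) := by gcongr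
    _ = _ := by
      rw [div_pow, div_pow, mul_pow, mul_pow _ |h|, sq_abs]
      ring

theorem exists_hetGap_le (hΦ : FeatureCondition Φ) (μ : S → stdSimplex ℝ A)
    (hγ₀ : 0 ≤ γ) (hγ₁ : γ < 1) (Rmax : ℝ) (Q : Matrix S S ℝ) {η : ℝ} (hη : 0 < η) :
    ∃ δ > 0, ∀ (N : ℕ) (M : MDPs S A N) (εp εr : ℝ),
      M.Ergodic μ → M.RewardBound Rmax → (∃ i₀, M.Pμ μ i₀ = Q) →
      0 ≤ εp → εp ≤ δ → 0 ≤ εr → εr ≤ δ → M.HeterogeneityBound μ εp εr →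
      M.SmallPerturbation μ Φ γ εp ∧ M.hetGap μ Φ γ Rmax εp εr ≤ η := by
  obtain ⟨m, -, c, -, -, κ, hκ, hunif⟩ := exists_uniform_constants hΦ μ hγ₀ hγ₁ Q
  have hu := tendsto_UpsGap (Fintype.card S)
  have hb := tendsto_bGap (Fintype.card S) Rmax
  have h1 : Tendsto (fun ε : ℝ × ℝ => 8 / κ ^ 4 * (Rmax ^ 2 * UpsGap (Fintype.card S) ε.1 ^ 2 +
      (1 + γ * Real.sqrt (Fintype.card S)) ^ 2 * bGap (Fintype.card S) Rmax ε.1 ε.2 ^ 2))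
      (𝓝 (0, 0)) (𝓝 0) := by
    simpa using (((hu.pow 2).const_mul (Rmax ^ 2)).add ((hb.pow 2).const_mul
      ((1 + γ * Real.sqrt (Fintype.card S)) ^ 2))).const_mul (8 / κ ^ 4)
  have h2 := (hu.eventually_le_const (show (0 : ℝ) < κ / 2 by positivity)).and
    (h1.eventually_le_const hη)
  obtain ⟨r, hr, hball⟩ := Metric.eventually_nhds_iff.mp h2
  refine ⟨min (1 / 3) (r / 2), by positivity, ?_⟩
  intro N M εp εr herg hR hQ hp0 hp hr0 hr' hhet
  have hp1 : εp ≤ 1 / 3 := hp.trans (min_le_left _ _)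
  have hp2 : εp ≤ r / 2 := hp.trans (min_le_right _ _)
  have hr2 : εr ≤ r / 2 := hr'.trans (min_le_right _ _)
  have hdist : dist ((εp, εr) : ℝ × ℝ) (0, 0) < r := by
    rw [Prod.dist_eq, Real.dist_eq, Real.dist_eq, sub_zero, sub_zero, abs_of_nonneg hp0,
      abs_of_nonneg hr0]
    exact max_lt (by linarith) (by linarith)
  obtain ⟨h3, h4⟩ := hball hdist
  have h5 := fun i => MDPs.agentGap_le hΦ hγ₀ hR hκ ((hunif N M εp εr herg hQ hp1 hhet).2 i)
    (εr := εr) hp0 (by linarith) h3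
  exact ⟨fun i => (h5 i).1, Real.iSup_le (fun i => (h5 i).2.trans h4) hη.le⟩

end Vanishing

/-! ### Fluctuation and heterogeneity combined. -/

section MeanSquareError

variable {S A : Type*} [Fintype S] [DecidableEq S] [Fintype A] {d : ℕ}

theorem exists_mse_bound {Φ : Matrix S (Fin d) ℝ} (hΦ : FeatureCondition Φ)
    (μ : S → stdSimplex ℝ A) {γ β Rmax : ℝ} (hγ₀ : 0 ≤ γ) (hγ₁ : γ < 1) (hβ₀ : 0 < β)
    (hβ₁ : β < 1) (hRmax : 0 ≤ Rmax) (v₀ : EuclideanSpace ℝ (Fin d)) (Q : Matrix S S ℝ) :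
    ∃ K > 0, ∃ B ≥ 0, ∀ (N : ℕ) (M : MDPs S A N) (εp εr : ℝ),
      M.Ergodic μ → M.RewardBound Rmax → (∃ i₀, M.Pμ μ i₀ = Q) →
      0 ≤ εp → εp < 1 → 0 ≤ εr → M.HeterogeneityBound μ εp εr →
      (∀ i, M.b μ Φ i ≠ 0) → M.SmallPerturbation μ Φ γ εp →
      ∀ {Ω : Type*} [MeasurableSpace Ω] (ℙ : Measure Ω) [IsProbabilityMeasure ℙ]
        (ν : stdSimplex ℝ (Fin N → S)) (s : ℕ → Fin N → Ω → S) (a : ℕ → Fin N → Ω → A),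
        IsMarkovSample ℙ M μ ν s a → ∀ i : Fin N,
        mse ℙ M μ Φ γ β v₀ s a i 0 ≤ B ∧ ∀ T : ℕ, 1 ≤ T → mse ℙ M μ Φ γ β v₀ s a i T ≤
          K * (1 / (N * T) + (T : ℝ) ^ (-(2 * β))) + M.hetGap μ Φ γ Rmax εp εr := by
  obtain ⟨hS, hd⟩ := hΦ.nonempty
  obtain ⟨m, hm, c, hc₀, hc₁, κ, hκ, hunif⟩ := exists_uniform_constants hΦ μ hγ₀ hγ₁ Q
  obtain ⟨K, hK, hbound⟩ := exists_average_bound hβ₀ hβ₁ hκ hm hc₀ hc₁ hRmax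
    (show 0 ≤ Rmax / κ by positivity) hγ₀ hγ₁.le v₀ hΦ.norm_feature_le μ
  set r := Real.sqrt (Fintype.card S) with hr
  have hr0 : 0 < r := Real.sqrt_pos.mpr (by exact_mod_cast Fintype.card_pos)
  set ρ : ℝ := (1 + γ * r) / (1 + r) with hρ
  have hρ0 : 0 ≤ ρ := by positivity
  have hρ1 : ρ < 1 := by
    rw [hρ, div_lt_one (by positivity)]
    nlinarith
  have hγρ : γ ≤ ρ := by
    rw [hρ, le_div_iff₀ (by positivity)]
    linarith
  have hρeq : 1 + γ * r = ρ * (1 + r) := by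
    rw [hρ]
    field_simp
  have hρ2 : 0 < 1 - ρ ^ 2 := by nlinarith
  -- Chosen so that `1 + c' = 2 / (1 + ρ²)`, the exact surplus of the heterogeneity bound; it is
  -- positive because `γ < 1` gives `ρ < 1`.
  set c' : ℝ := (1 - ρ ^ 2) / (1 + ρ ^ 2) with hc'
  have hc'0 : 0 < c' := by positivity
  have hc'1 : 1 + c' = 2 / (1 + ρ ^ 2) := by
    rw [hc']
    field_simp
    ring
  refine ⟨(1 + c'⁻¹) * K, by positivity, (‖v₀‖ + Rmax / κ) ^ 2, by positivity, ?_⟩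
  intro N M εp εr herg hR hQ hp0 hp1 hr0 hhet hb hsm Ω _ ℙ _ ν s a hs i
  obtain ⟨hlow, hcoer⟩ := hunif N M εp εr herg hQ
    (hsm.lt_one_third herg hΦ hγ₀ hγ₁ hp0 hp1 i).le hhet
  have hbR := MDPs.norm_b_le (μ := μ) hΦ.norm_feature_le hR
  constructor
  · simp only [mse, average, integral_const, probReal_univ, one_smul]
    have h1 : ‖M.localSol μ Φ γ i‖ ≤ Rmax / κ := by
      refine (M.norm_localSol_le μ Φ γ i).trans ?_
      have h2 := (hcoer i).norm_inv_le hκ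
      calc _ ≤ 1 / κ * Rmax := mul_le_mul h2 (hbR i) (norm_nonneg _) (by positivity)
        _ = _ := by ring
    exact pow_le_pow_left₀ (norm_nonneg _) ((norm_sub_le _ _).trans (by linarith)) 2
  · intro T hT
    obtain ⟨w, hw, hwn⟩ := MDPs.exists_averaged_solution i.pos hκ hcoer hbR
    have h1 := hbound N M w i.pos hlow hR hcoer hw hwn ℙ ν s a hs (M.localSol μ Φ γ i) c' hc'0 T hT
    have h2 := MDPs.norm_sub_localSol_le herg hΦ hγ₀ hγ₁ hR hRmax hp0 hp1 hr0 hhet hb hsm hw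
      hρ1.le hρeq hγρ i
    rw [← hc'1] at h2
    rw [mse]
    linarith

end MeanSquareError

/-! ### Conversion of `1/(NT) + T^(-2β)` into the stated rates. -/

section Rates

theorem one_div_mul_natCast_le {N T : ℕ} (hN : 0 < N) (hT : 1 ≤ T) :
    1 / ((N : ℝ) * T) ≤ 2 / (N * ((T : ℝ) + 1)) := by
  have hN' : (0 : ℝ) < N := by exact_mod_cast hN
  have hT' : (1 : ℝ) ≤ T := by exact_mod_cast hT
  rw [div_le_div_iff₀ (by positivity) (by positivity)]
  have := mul_le_mul_of_nonneg_left hT' hN'.le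
  linarith

theorem natCast_rpow_neg_le {β : ℝ} (hβ₀ : 0 ≤ β) (hβ₁ : β ≤ 1) {T : ℕ} (hT : 1 ≤ T) :
    (T : ℝ) ^ (-(2 * β)) ≤ 4 / ((T : ℝ) + 1) ^ (2 * β) := by
  have hT' : (1 : ℝ) ≤ T := by exact_mod_cast hT
  rw [Real.rpow_neg (by linarith), ← one_div, div_le_div_iff₀ (by positivity) (by positivity),
    one_mul]
  calc ((T : ℝ) + 1) ^ (2 * β) ≤ (2 * (T : ℝ)) ^ (2 * β) := by
        gcongr
        linarith
    _ = 2 ^ (2 * β) * (T : ℝ) ^ (2 * β) := Real.mul_rpow (by norm_num) (by linarith)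
    _ ≤ 4 * (T : ℝ) ^ (2 * β) := by
      gcongr
      calc (2 : ℝ) ^ (2 * β) ≤ 2 ^ (2 : ℝ) := Real.rpow_le_rpow_of_exponent_le (by norm_num)
            (by linarith)
        _ = 4 := by norm_num

/-- Since `2β > 1`, the power `(T+1)^(2β-1)` eventually exceeds `2N`, and from then on the
second-order term is below the leading one. -/
theorem exists_natCast_rpow_neg_le {β : ℝ} (hβ₀ : 1 / 2 < β) (hβ₁ : β ≤ 1) (N : ℕ) :
    ∃ T₀ : ℕ, 1 ≤ T₀ ∧ ∀ T : ℕ, T₀ ≤ T → 0 < N →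
      (T : ℝ) ^ (-(2 * β)) ≤ 2 / (N * ((T : ℝ) + 1)) := by
  have h1 : Tendsto (fun T : ℕ => ((T : ℝ) + 1) ^ (2 * β - 1)) atTop atTop :=
    (tendsto_rpow_atTop (by linarith)).comp
      (tendsto_atTop_add_const_right _ _ tendsto_natCast_atTop_atTop)
  obtain ⟨T₀, hT₀⟩ := eventually_atTop.mp (h1.eventually_ge_atTop (2 * (N : ℝ)))
  refine ⟨max 1 T₀, le_max_left _ _, fun T hT hN => ?_⟩
  have hN' : (0 : ℝ) < N := by exact_mod_cast hN
  have h2 := hT₀ T ((le_max_right _ _).trans hT)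
  refine (natCast_rpow_neg_le (by linarith) hβ₁ ((le_max_left _ _).trans hT)).trans ?_
  have hT' : (0 : ℝ) < (T : ℝ) + 1 := by positivity
  rw [div_le_div_iff₀ (by positivity) (by positivity)]
  have h3 : ((T : ℝ) + 1) ^ (2 * β) = ((T : ℝ) + 1) ^ (2 * β - 1) * ((T : ℝ) + 1) := by
    rw [← Real.rpow_add_one hT'.ne', sub_add_cancel]
  rw [h3]
  have h4 := mul_le_mul_of_nonneg_right h2 hT'.le
  linarith

theorem natCast_rpow_neg_le_inv {β : ℝ} (hβ₀ : 1 / 2 ≤ β) {N T : ℕ} (hN : 0 < N) (hT : 1 ≤ T) :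
    (T : ℝ) ^ (-(2 * β)) ≤ 2 * N / (N * ((T : ℝ) + 1)) := by
  have hN' : (0 : ℝ) < N := by exact_mod_cast hN
  have hT' : (1 : ℝ) ≤ T := by exact_mod_cast hT
  calc (T : ℝ) ^ (-(2 * β)) ≤ (T : ℝ) ^ (-1 : ℝ) :=
        Real.rpow_le_rpow_of_exponent_le hT' (by linarith)
    _ = 1 / T := by rw [Real.rpow_neg_one, one_div]
    _ ≤ _ := by
      rw [div_le_div_iff₀ (by positivity) (by positivity)]
      have := mul_le_mul_of_nonneg_left hT' hN'.le
      linarith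

end Rates

end FedTD

theorem theorem2 {S A : Type*} [Fintype S] [DecidableEq S] [Fintype A] {d : ℕ}
    (Φ : Matrix S (Fin d) ℝ) (hΦ : FedTD.FeatureCondition Φ) (μ : S → stdSimplex ℝ A)
    (γ : ℝ) (hγ₀ : 0 ≤ γ) (hγ₁ : γ < 1) (β : ℝ) (hβ₀ : 1 / 2 < β) (hβ₁ : β < 1)
    (Rmax : ℝ) (hRmax : 0 < Rmax) (v₀ : EuclideanSpace ℝ (Fin d)) (Q : Matrix S S ℝ) :
    -- `C` and `C'` depend only on the data above, `K` and `T₀` on these and on `N`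
    (∃ C > 0, ∃ C' > 0, ∀ N : ℕ, ∃ K > 0, ∃ T₀ : ℕ,
      ∀ (M : FedTD.MDPs S A N) (εp εr : ℝ),
        M.Ergodic μ → M.RewardBound Rmax → (∃ i₀, M.Pμ μ i₀ = Q) →
        0 ≤ εp → εp < 1 → 0 ≤ εr → M.HeterogeneityBound μ εp εr →
        (∀ i, M.b μ Φ i ≠ 0) → M.SmallPerturbation μ Φ γ εp →
      ∀ {Ω : Type*} [MeasurableSpace Ω] (ℙ : Measure Ω) [IsProbabilityMeasure ℙ]
        (ν : stdSimplex ℝ (Fin N → S)) (s : ℕ → Fin N → Ω → S) (a : ℕ → Fin N → Ω → A),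
        FedTD.IsMarkovSample ℙ M μ ν s a →
      ∀ i : Fin N,
        -- nonasymptotic bound, with constants that do not depend on `N`
        (∀ T : ℕ, 2 ≤ T → FedTD.mse ℙ M μ Φ γ β v₀ s a i T ≤
          C / (N * ((T : ℝ) + 1)) + C' * Real.log T ^ 2 / ((T : ℝ) + 1) ^ (2 * β) +
            M.hetGap μ Φ γ Rmax εp εr) ∧
        -- the rate `1 / (N (T + 1))` with a constant that does not depend on `N`
        (∀ T : ℕ, T₀ ≤ T → FedTD.mse ℙ M μ Φ γ β v₀ s a i T ≤
          C / (N * ((T : ℝ) + 1)) + M.hetGap μ Φ γ Rmax εp εr) ∧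
        -- the same rate at all times, for each fixed `N`
        (∀ T : ℕ, FedTD.mse ℙ M μ Φ γ β v₀ s a i T ≤
          K / (N * ((T : ℝ) + 1)) + M.hetGap μ Φ γ Rmax εp εr)) ∧
    -- the heterogeneity gap of given MDPs vanishes as `εp, εr → 0`
    (∀ (N : ℕ) (M : FedTD.MDPs S A N), M.Ergodic μ → M.RewardBound Rmax →
      Tendsto (fun ε : ℝ × ℝ => M.hetGap μ Φ γ Rmax ε.1 ε.2) (𝓝 (0, 0)) (𝓝 0)) ∧
    -- and it does so uniformly over `N` and the MDPs; small `εp` satisfy `SmallPerturbation`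
    (∀ η > 0, ∃ δ > 0, ∀ (N : ℕ) (M : FedTD.MDPs S A N) (εp εr : ℝ),
      M.Ergodic μ → M.RewardBound Rmax → (∃ i₀, M.Pμ μ i₀ = Q) →
      0 ≤ εp → εp ≤ δ → 0 ≤ εr → εr ≤ δ → M.HeterogeneityBound μ εp εr →
      M.SmallPerturbation μ Φ γ εp ∧ M.hetGap μ Φ γ Rmax εp εr ≤ η) := by
  refine ⟨?_, fun N M herg _ => FedTD.MDPs.tendsto_hetGap herg hΦ hγ₀ hγ₁,
    fun η hη => FedTD.exists_hetGap_le hΦ μ hγ₀ hγ₁ Rmax Q hη⟩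
  obtain ⟨K, hK, B, hB, hbound⟩ := FedTD.exists_mse_bound hΦ μ hγ₀ hγ₁ (by linarith : 0 < β) hβ₁
    hRmax.le v₀ Q
  have hlog : 0 < Real.log 2 := Real.log_pos (by norm_num)
  -- The estimate carries no logarithm; for `T ≥ 2` it is inserted through `log T ≥ log 2`. After
  -- `T₀` each of the two terms costs `2 K`, hence `4 * K`.
  refine ⟨4 * K, by positivity, 4 * K / Real.log 2 ^ 2, by positivity, fun N => ?_⟩
  obtain ⟨T₀, hT₀, hrate⟩ := FedTD.exists_natCast_rpow_neg_le hβ₀ hβ₁.le N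
  -- `N * B` covers `T = 0`; `2 K` and `2 K N` cover `1/(NT)` and `T^(-2β) ≤ 1/T` for `T ≥ 1`.
  refine ⟨N * B + 2 * K * (1 + N), by positivity, T₀, ?_⟩
  intro M εp εr herg hR hQ hp0 hp1 hr0 hhet hb hsm Ω _ ℙ _ ν s a hs i
  obtain ⟨hzero, hpos⟩ := hbound N M εp εr herg hR hQ hp0 hp1 hr0 hhet hb hsm ℙ ν s a hs i
  have hN : 0 < N := i.pos
  have hN' : (0 : ℝ) < N := by exact_mod_cast hN
  have hgap : 0 ≤ M.hetGap μ Φ γ Rmax εp εr :=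
    Real.iSup_nonneg fun i => M.agentGap_nonneg μ Φ γ Rmax εp εr i
  refine ⟨fun T hT => ?_, fun T hT => ?_, fun T => ?_⟩
  · refine (hpos T (by omega)).trans (add_le_add_left ?_ _)
    have h1 := mul_le_mul_of_nonneg_left
      (FedTD.one_div_mul_natCast_le hN (show 1 ≤ T by omega)) hK.le
    have h2 := mul_le_mul_of_nonneg_left
      (FedTD.natCast_rpow_neg_le (by linarith : 0 ≤ β) hβ₁.le (show 1 ≤ T by omega)) hK.le
    have h3 : Real.log 2 ^ 2 ≤ Real.log T ^ 2 :=
      pow_le_pow_left₀ hlog.le (Real.log_le_log (by norm_num) (by exact_mod_cast hT)) 2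
    have h4 : 4 * K / (N * ((T : ℝ) + 1)) =
        K * (2 / (N * ((T : ℝ) + 1))) + K * (2 / (N * ((T : ℝ) + 1))) := by ring
    have h5 : 0 ≤ K * (2 / (N * ((T : ℝ) + 1))) := by positivity
    have h6 : K * (4 / ((T : ℝ) + 1) ^ (2 * β)) ≤
        4 * K / Real.log 2 ^ 2 * Real.log T ^ 2 / ((T : ℝ) + 1) ^ (2 * β) := by
      calc K * (4 / ((T : ℝ) + 1) ^ (2 * β)) =
            4 * K / Real.log 2 ^ 2 * Real.log 2 ^ 2 / ((T : ℝ) + 1) ^ (2 * β) := by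
            field_simp
        _ ≤ _ := by gcongr
    linarith
  · refine (hpos T (hT₀.trans hT)).trans (add_le_add_left ?_ _)
    have h1 := mul_le_mul_of_nonneg_left
      (FedTD.one_div_mul_natCast_le hN (hT₀.trans hT)) hK.le
    have h2 := mul_le_mul_of_nonneg_left (hrate T hT hN) hK.le
    have h3 : 4 * K / (N * ((T : ℝ) + 1)) =
        K * (2 / (N * ((T : ℝ) + 1))) + K * (2 / (N * ((T : ℝ) + 1))) := by ring
    linarith
  · rcases Nat.eq_zero_or_pos T with rfl | hT
    · have h1 : B ≤ (N * B + 2 * K * (1 + N)) / (N * (((0 : ℕ) : ℝ) + 1)) := by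
        rw [le_div_iff₀ (by positivity), Nat.cast_zero, zero_add, mul_one]
        have : 0 ≤ 2 * K * (1 + N) := by positivity
        linarith
      linarith
    · refine (hpos T hT).trans (add_le_add_left ?_ _)
      have h1 := mul_le_mul_of_nonneg_left (FedTD.one_div_mul_natCast_le hN hT) hK.le
      have h2 := mul_le_mul_of_nonneg_left
        (FedTD.natCast_rpow_neg_le_inv hβ₀.le hN hT) hK.le
      have h3 : (N * B + 2 * K * (1 + N)) / (N * ((T : ℝ) + 1)) = N * B / (N * ((T : ℝ) + 1)) +
          K * (2 / (N * ((T : ℝ) + 1))) + K * (2 * N / (N * ((T : ℝ) + 1))) := by ring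
      have h4 : 0 ≤ N * B / (N * ((T : ℝ) + 1)) := by positivity
      linarith
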